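/- Let $\lambda,\kappa\in\mathbb R$ with $\lambda\kappa<0$. For 1-periodic functions of $x$ consider the generalized Hunter–Saxton system $$u_{xt}+uu_{xx}-\lambda u_x^2-\kappa\rho^2=I(t),\qquad \rho_t+u\rho_x=2\lambda\rho u_x,\qquad I(t)=-\kappa\int_0^1\rho^2\,dx-(1+\lambda)\int_0^1u_x^2\,dx,$$ with initial data $u(x,0)=u_0(x)$, $\rho(x,0)=\rho_0(x)$; a smooth solution on $[0,T)$ is a pair $(u,\rho)$ that is $C^\infty$ on $\mathbb R\times[0,T)$, 1-periodic in $x$, has these initial values and satisfies the equations for $0<t<T$. Write $\|\cdot\|_p$ for the norm of $L^p([0,1])$. Call $(u_0,\rho_0)$ *admissible* (for $\lambda$) if $u_0,\rho_0$ are $C^\infty$ and 1-periodic on $\mathbb R$, $\rho_0$ has finitely many zeros $x_1,\dots,x_n$ in $[0,1]$, $\lambda u_0'(x_i)\ne0$ for all $i$, $\lambda u_0'(x_i)>0$ for some $i$, and at every *extremal zero*, i.e. every $x_i$ with $u_0'(x_i)=\min_j u_0'(x_j)$ (if $\lambda<0$), resp. $u_0'(x_i)=\max_j u_0'(x_j)$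 (if $\lambda>0$), one has $u_0''(x_i)=0$ and $u_0'''(x_i)>0$ (if $\lambda<0$), resp. $u_0'''(x_i)<0$ (if $\lambda>0$). Then there is a pair $(u_0,\rho_0)$ that, for all $\lambda,\kappa$ with $\lambda\kappa<0$, is admissible and satisfies $\rho_0'=0$ at some extremal zero. Moreover, let $\lambda\kappa<0$, $\lambda\in(-\infty,0)\cup(1,\infty)$, and let $(u_0,\rho_0)$ be admissible. Then there is a finite $L^\infty$ blowup time $t_*>0$: a smooth solution on $[0,t_*)$ exists, and every smooth solution on $[0,t_*)$ satisfies $\lim_{t\nearrow t_*}\|u_x(\cdot,t)\|_\infty=+\infty$. Every smooth solution on $[0,t_*)$ also satisfies the following. 1. For $p\in(1,\infty)$ and $\lambda\in(-\infty,-2/p]\cup(1,\infty)$, where in the case $\lambda\le-2/p$ it is assumed in addition that $\rho_0'=0$ at some extremal zero, $\lim_{t\nearrow t_*}\|u_x(\cdot,t)\|_p=+\infty$. 2. For $p\in[1,\infty)$ and $\lambda\in(-2/(2p-1),0)$, the limit $\lim_{t\nearrow t_*}\|u_x(\cdot,t)\|_p$ exists and is finite. -/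

import Mathlib

open Set Filter Topology MeasureTheory
open scoped ContDiff

namespace GenHunterSaxton

/-- The spatial derivative `u_x(x, t)` of a function `u = u(x, t)`. -/
noncomputable def dx (u : ℝ → ℝ → ℝ) (x t : ℝ) : ℝ := deriv (fun y => u y t) x

/-- The time derivative `u_t(x, t)` of a function `u = u(x, t)`. -/
noncomputable def dt (u : ℝ → ℝ → ℝ) (x t : ℝ) : ℝ := deriv (fun s => u x s) t

/-- The norm `‖u_x(·, t)‖_q` in `L^q([0, 1])`, `q ∈ [0, ∞]`, as an extended nonnegative real. -/
noncomputable def uxNorm (u : ℝ → ℝ → ℝ) (q : ENNReal) (t : ℝ) : ENNReal :=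
  eLpNorm (fun x => dx u x t) q (volume.restrict (Icc (0 : ℝ) 1))

/-- The nonlocal term
`I(t) = - κ ∫_0^1 ρ² dx - (1 + λ) ∫_0^1 u_x² dx`. -/
noncomputable def nonlocalTerm (lam kap : ℝ) (u ρ : ℝ → ℝ → ℝ) (t : ℝ) : ℝ :=
  -kap * (∫ x in (0 : ℝ)..1, ρ x t ^ 2) - (1 + lam) * ∫ x in (0 : ℝ)..1, dx u x t ^ 2

/-- `(u, ρ)` is a smooth solution, 1-periodic in `x`, of the generalized Hunter-Saxton system on
the time interval `[0, T)` with initial data `(u₀, ρ₀)`. Smoothness is joint in `(x, t)`, up to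
`t = 0`; values for `t` outside `[0, T)` play no role. -/
structure IsSmoothSolution (lam kap : ℝ) (u₀ ρ₀ : ℝ → ℝ) (T : ℝ) (u ρ : ℝ → ℝ → ℝ) : Prop where
  smooth_u : ContDiffOn ℝ ∞ (fun z : ℝ × ℝ => u z.1 z.2) (univ ×ˢ Ico 0 T)
  smooth_rho : ContDiffOn ℝ ∞ (fun z : ℝ × ℝ => ρ z.1 z.2) (univ ×ˢ Ico 0 T)
  periodic_u : ∀ t ∈ Ico 0 T, Function.Periodic (fun x => u x t) 1
  periodic_rho : ∀ t ∈ Ico 0 T, Function.Periodic (fun x => ρ x t) 1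
  momentum : ∀ t ∈ Ioo 0 T, ∀ x : ℝ,
    dt (dx u) x t + u x t * dx (dx u) x t - lam * dx u x t ^ 2 - kap * ρ x t ^ 2
      = nonlocalTerm lam kap u ρ t
  transport : ∀ t ∈ Ioo 0 T, ∀ x : ℝ,
    dt ρ x t + u x t * dx ρ x t = 2 * lam * ρ x t * dx u x t
  initial_u : ∀ x : ℝ, u x 0 = u₀ x
  initial_rho : ∀ x : ℝ, ρ x 0 = ρ₀ x

/-- `T` is the (finite) `L^∞` blowup time for the data `(u₀, ρ₀)`: smooth solutions exist on
`[0, T)`, and for each of them `‖u_x(·, t)‖_∞ → ∞` as `t ↗ T`. (The system determines `u` only up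
to a time-dependent translation in `x`, whence "each". There is at most one such `T`.) -/
def IsBlowupTime (lam kap : ℝ) (u₀ ρ₀ : ℝ → ℝ) (T : ℝ) : Prop :=
  0 < T ∧ (∃ u ρ : ℝ → ℝ → ℝ, IsSmoothSolution lam kap u₀ ρ₀ T u ρ) ∧
    ∀ u ρ : ℝ → ℝ → ℝ, IsSmoothSolution lam kap u₀ ρ₀ T u ρ →
      Tendsto (uxNorm u ⊤) (𝓝[<] T) (𝓝 ⊤)

/-- The zeros of `ρ₀` in `[0, 1]`. -/
def zeroSet (ρ₀ : ℝ → ℝ) : Set ℝ := {x | x ∈ Icc (0 : ℝ) 1 ∧ ρ₀ x = 0}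

/-- The zeros of `ρ₀` at which `λ u₀'` is maximal among all zeros of `ρ₀`: for `λ < 0` these are
the zeros at which `m₀ = min u₀'` is attained, for `λ > 0` those at which `M₀ = max u₀'` is. -/
def extremalZeros (lam : ℝ) (u₀ ρ₀ : ℝ → ℝ) : Set ℝ :=
  {x | x ∈ zeroSet ρ₀ ∧ ∀ y ∈ zeroSet ρ₀, lam * deriv u₀ y ≤ lam * deriv u₀ x}

/-- The class of initial data: smooth, 1-periodic, `ρ₀` with finitely many zeros `xᵢ` in `[0, 1]`,
`λ u₀'(xᵢ) ≠ 0` for all `i` and `λ u₀'(xᵢ) > 0` for some `i`; and, where the extreme value of `u₀'`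
on the zeros is attained, `u₀'' = 0` and `u₀''' > 0` (if `λ < 0`), `u₀''' < 0` (if `λ > 0`). -/
structure IsAdmissible (lam : ℝ) (u₀ ρ₀ : ℝ → ℝ) : Prop where
  smooth_u : ContDiff ℝ ∞ u₀
  smooth_rho : ContDiff ℝ ∞ ρ₀
  periodic_u : Function.Periodic u₀ 1
  periodic_rho : Function.Periodic ρ₀ 1
  finite_zeros : (zeroSet ρ₀).Finite
  ne_zero : ∀ x ∈ zeroSet ρ₀, lam * deriv u₀ x ≠ 0
  exists_pos : ∃ x ∈ zeroSet ρ₀, 0 < lam * deriv u₀ x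
  deriv_two : ∀ x ∈ extremalZeros lam u₀ ρ₀, iteratedDeriv 2 u₀ x = 0
  deriv_three : ∀ x ∈ extremalZeros lam u₀ ρ₀, lam * iteratedDeriv 3 u₀ x < 0

/-- At some zero of `ρ₀` at which the extreme value of `u₀'` is attained, `ρ₀' = 0` as well. -/
def HasFlatExtremalZero (lam : ℝ) (u₀ ρ₀ : ℝ → ℝ) : Prop :=
  ∃ x ∈ extremalZeros lam u₀ ρ₀, deriv ρ₀ x = 0

end GenHunterSaxton

/-! Let J be the Jacobian of the characteristic with label α, so that (log J)' = u_x along it. Then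
ψ = J^(-λ) solves the Ermakov equation ψ'' = -λ I(t) ψ + r² ψ⁻³ with r² = -λκ ρ₀², which is
nonnegative because λκ < 0. The nonlocal term enters only through the coefficient k = -λ I, common
to all labels. At a zero of ρ₀ the equation is linear, and the nonlinear superposition principle
(`ermakov_superposition`) expresses every ψ through one such linear solution.

Put a = λ u₀', let μ be the maximum of a over the zeros of ρ₀, let y solve y'' = k y with y(0) = 1,
y'(0) = 0, and let η = ∫ y⁻² dt. Then ψ² = y² ((1 - η a)² + (η r)²), that is y² `quad`. A period
keeps length one, so J has mean one; this forces y² = `mass` ^ (2λ) and hence dt = `mass` ^ (2λ) dη.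
The unknown I has disappeared: Jacobian, time and u_x are the explicit functions `jac`, `clock` and
`strain` of (α, η). `IsSmoothSolution.representation` proves this for an arbitrary smooth solution.
Conversely, inverting (α, η) ↦ (position, time) turns the formulas into a solution
(`IsProfile.exists_isSmoothSolution`).

`quad` first vanishes at η = 1/μ, exactly at the peaks: the zeros of r where a = μ. The blowup time
is `clock` at 1/μ. It is finite: for λ < 0 `mass` stays bounded and positive, and for λ > 1 the
singularity of `mass` ^ (2λ) is integrable.

By change of variables the p-th power of the L^p norm of u_x is `moment`. Write ε = 1 - μη. Near a
peak a is critical and strictly concave, while r vanishes to order one or at least two; accordingly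
√`quad` is comparable to ε on a neighbourhood of width ε^(1/k), with k = 1 or 2. There `logSlope`
has size 1/ε and varies by an amount of that size, so no additive constant can cancel it. This
bounds the moment below by ε^(-p - 1/λ + 1/k) times a power of `mass`, and blowup follows from
counting exponents. For small negative λ, √`quad` ≥ c |x - z|² yields an integrable majorant and
dominated convergence gives the finite limit. -/

namespace GenHunterSaxton

/-! ### Calculus: parameter integrals, smooth inverses, equality from equal derivatives. -/

section Calculus

/-- Differentiation under the integral sign, for a smooth integrand. -/
theorem hasFDerivAt_intervalIntegral_of_contDiffOn {E F : Type} [NormedAddCommGroup E]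
    [NormedSpace ℝ E] [FiniteDimensional ℝ E] [NormedAddCommGroup F] [NormedSpace ℝ F]
    [CompleteSpace F] {f : E → ℝ → F} {U : Set E} (hU : IsOpen U) (a b : ℝ)
    (hf : ContDiffOn ℝ 1 (fun z : E × ℝ => f z.1 z.2) (U ×ˢ univ)) {x : E} (hx : x ∈ U) :
    HasFDerivAt (fun x => ∫ t in a..b, f x t)
      (∫ t in a..b, (fderiv ℝ (fun z : E × ℝ => f z.1 z.2) (x, t)).comp
        (ContinuousLinearMap.inl ℝ E ℝ)) x := by
  have hUo : IsOpen (U ×ˢ (univ : Set ℝ)) := hU.prod isOpen_univ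
  have hF' : ContinuousOn (fun z : E × ℝ => (fderiv ℝ (fun z : E × ℝ => f z.1 z.2) z).comp
      (ContinuousLinearMap.inl ℝ E ℝ)) (U ×ˢ univ) :=
    ((hf.continuousOn_fderiv_of_isOpen hUo le_rfl)).clm_comp continuousOn_const
  have hslice : ∀ y ∈ U, Continuous (fun t : ℝ => f y t) := fun y hy =>
    (hf.continuousOn.comp_continuous (by fun_prop : Continuous fun t : ℝ => (y, t))
      (fun t => ⟨hy, mem_univ _⟩))
  have hslice' : ∀ y ∈ U, Continuous (fun t : ℝ => (fderiv ℝ (fun z : E × ℝ => f z.1 z.2)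
      (y, t)).comp (ContinuousLinearMap.inl ℝ E ℝ)) := fun y hy =>
    (hF'.comp_continuous (by fun_prop : Continuous fun t : ℝ => (y, t))
      (fun t => ⟨hy, mem_univ _⟩))
  obtain ⟨δ, hδ, hball⟩ := Metric.nhds_basis_closedBall.mem_iff.1 (hU.mem_nhds hx)
  have hcomp : IsCompact (Metric.closedBall x δ ×ˢ uIcc a b) :=
    (isCompact_closedBall x δ).prod isCompact_uIcc
  obtain ⟨C, hC⟩ := hcomp.exists_bound_of_continuousOn
    (hF'.mono (prod_mono hball (subset_univ _)))
  refine intervalIntegral.hasFDerivAt_integral_of_dominated_of_fderiv_le (𝕜 := ℝ)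
    (s := Metric.closedBall x δ) (bound := fun _ => C)
    (F' := fun y t => (fderiv ℝ (fun z : E × ℝ => f z.1 z.2) (y, t)).comp
        (ContinuousLinearMap.inl ℝ E ℝ))
    (Metric.closedBall_mem_nhds x hδ) ?_ ((hslice x hx).intervalIntegrable _ _)
    (hslice' x hx).aestronglyMeasurable ?_ intervalIntegrable_const ?_
  · filter_upwards [hU.mem_nhds hx] with y hy
    exact (hslice y hy).aestronglyMeasurable
  · refine Eventually.of_forall fun t ht y hy => hC (y, t) ⟨hy, uIoc_subset_uIcc ht⟩
  · refine Eventually.of_forall fun t _ y hy => ?_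
    have h1 : HasFDerivAt (fun z : E × ℝ => f z.1 z.2)
        (fderiv ℝ (fun z : E × ℝ => f z.1 z.2) (y, t)) (y, t) :=
      ((hf.differentiableOn one_ne_zero).differentiableAt
        (hUo.mem_nhds ⟨hball hy, mem_univ _⟩)).hasFDerivAt
    have h2 : HasFDerivAt (fun y : E => (y, t)) (ContinuousLinearMap.inl ℝ E ℝ) y :=
      hasFDerivAt_prodMk_left y t
    exact h1.comp y h2

/-- The codomain is quantified inside the induction on `n`, because the derivative of the integral
is again such an integral, now with values in the linear maps `E →L[ℝ] F`. -/
theorem contDiffOn_nat_intervalIntegral {E : Type} [NormedAddCommGroup E]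
    [NormedSpace ℝ E] [FiniteDimensional ℝ E] {U : Set E} (hU : IsOpen U) (a b : ℝ) (n : ℕ) :
    ∀ {F : Type} [NormedAddCommGroup F] [NormedSpace ℝ F] [CompleteSpace F] (f : E → ℝ → F),
    ContDiffOn ℝ n (fun z : E × ℝ => f z.1 z.2) (U ×ˢ univ) →
    ContDiffOn ℝ n (fun x => ∫ t in a..b, f x t) U := by
  have hUo : IsOpen (U ×ˢ (univ : Set ℝ)) := hU.prod isOpen_univ
  induction n with
  | zero =>
    intro F _ _ _ f hf
    simp only [Nat.cast_zero, contDiffOn_zero] at hf ⊢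
    intro x hx
    refine ContinuousAt.continuousWithinAt ?_
    have hslice : ∀ y ∈ U, Continuous (fun t : ℝ => f y t) := fun y hy =>
      (hf.comp_continuous (by fun_prop : Continuous fun t : ℝ => (y, t))
        (fun t => ⟨hy, mem_univ _⟩))
    obtain ⟨δ, hδ, hball⟩ := Metric.nhds_basis_closedBall.mem_iff.1 (hU.mem_nhds hx)
    have hcomp : IsCompact (Metric.closedBall x δ ×ˢ uIcc a b) :=
      (isCompact_closedBall x δ).prod isCompact_uIcc
    obtain ⟨C, hC⟩ := hcomp.exists_bound_of_continuousOn
      (hf.mono (prod_mono hball (subset_univ _)))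
    refine intervalIntegral.continuousAt_of_dominated_interval (bound := fun _ => C) ?_ ?_
      intervalIntegrable_const ?_
    · filter_upwards [hU.mem_nhds hx] with y hy
      exact (hslice y hy).aestronglyMeasurable
    · filter_upwards [Metric.closedBall_mem_nhds x hδ] with y hy
      exact Eventually.of_forall fun t ht => hC (y, t) ⟨hy, uIoc_subset_uIcc ht⟩
    · refine Eventually.of_forall fun t _ => ?_
      exact (hf.continuousAt (hUo.mem_nhds ⟨hx, mem_univ t⟩)).comp
        (f := fun y : E => (y, t)) (by fun_prop)
  | succ n ih =>
    intro F _ _ _ f hf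
    have hf1 : ContDiffOn ℝ 1 (fun z : E × ℝ => f z.1 z.2) (U ×ˢ univ) :=
      hf.of_le (by exact_mod_cast Nat.le_add_left 1 n)
    push_cast at hf ⊢
    rw [contDiffOn_succ_iff_fderiv_of_isOpen hUo] at hf
    rw [contDiffOn_succ_iff_fderiv_of_isOpen hU]
    refine ⟨fun x hx => (hasFDerivAt_intervalIntegral_of_contDiffOn hU a b hf1
      hx).differentiableAt.differentiableWithinAt, by simp, ?_⟩
    refine (ih (fun x t => (fderiv ℝ (fun z : E × ℝ => f z.1 z.2) (x, t)).comp
        (ContinuousLinearMap.inl ℝ E ℝ)) (hf.2.2.clm_comp contDiffOn_const)).congr fun x hx => ?_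
    exact (hasFDerivAt_intervalIntegral_of_contDiffOn hU a b hf1 hx).fderiv

/-- An integral depending on a parameter is smooth if its integrand is. -/
theorem contDiffOn_intervalIntegral {E F : Type} [NormedAddCommGroup E]
    [NormedSpace ℝ E] [FiniteDimensional ℝ E] [NormedAddCommGroup F] [NormedSpace ℝ F]
    [CompleteSpace F] {f : E → ℝ → F} {U : Set E} (hU : IsOpen U) (a b : ℝ)
    (hf : ContDiffOn ℝ ∞ (fun z : E × ℝ => f z.1 z.2) (U ×ˢ univ)) :
    ContDiffOn ℝ ∞ (fun x => ∫ t in a..b, f x t) U :=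
  contDiffOn_infty.2 fun n => contDiffOn_nat_intervalIntegral hU a b n f (contDiffOn_infty.1 hf n)

/-- An injective smooth map with invertible derivatives on an open set has an open image and a
smooth inverse. -/
theorem exists_contDiffOn_inverse {E : Type} [NormedAddCommGroup E] [NormedSpace ℝ E]
    [CompleteSpace E] {f : E → E} {U : Set E} (hU : IsOpen U) (hf : ContDiffOn ℝ ∞ f U)
    (hinj : InjOn f U) (hf' : ∀ x ∈ U, ∃ e : E ≃L[ℝ] E, HasFDerivAt f (e : E →L[ℝ] E) x) :
    IsOpen (f '' U) ∧ ∃ h : E → E, ContDiffOn ℝ ∞ h (f '' U) ∧ ∀ x ∈ U, h (f x) = x := by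
  have key : ∀ x ∈ U, f '' U ∈ 𝓝 (f x) ∧ ContDiffAt ℝ ∞ (Function.invFunOn f U) (f x) := by
    intro x hx
    obtain ⟨e, he⟩ := hf' x hx
    have hfx : ContDiffAt ℝ ∞ f x := hf.contDiffAt (hU.mem_nhds hx)
    have hs := hfx.hasStrictFDerivAt' he (by simp)
    have hsm := hfx.to_localInverse he (by simp)
    have hc : ∀ᶠ y in 𝓝 (f x), hs.localInverse f e x y ∈ U := by
      have h1 := hs.localInverse_continuousAt
      rw [ContinuousAt, hs.localInverse_apply_image] at h1
      exact h1 (hU.mem_nhds hx)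
    refine ⟨?_, hsm.congr_of_eventuallyEq ?_⟩
    · filter_upwards [hc, hs.eventually_right_inverse] with y hy hy'
      exact ⟨_, hy, hy'⟩
    · filter_upwards [hc, hs.eventually_right_inverse] with y hy hy'
      have hmem : y ∈ f '' U := ⟨_, hy, hy'⟩
      exact hinj (Function.invFunOn_mem hmem) hy ((Function.invFunOn_eq hmem).trans hy'.symm)
  refine ⟨isOpen_iff_mem_nhds.2 ?_, Function.invFunOn f U, ?_, fun x hx => ?_⟩
  · rintro _ ⟨x, hx, rfl⟩
    exact (key x hx).1
  · rintro _ ⟨x, hx, rfl⟩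
    exact (key x hx).2.contDiffWithinAt
  · exact hinj.leftInvOn_invFunOn hx

/-- Derivatives are needed only on the open interval, since the differential equations hold for
positive times only. With `f' = 0` this is the device for verifying conserved quantities. -/
theorem eqOn_of_hasDerivAt_eq {f g f' : ℝ → ℝ} {T : ℝ} (hf : ContinuousOn f (Icc 0 T))
    (hg : ContinuousOn g (Icc 0 T)) (hf' : ∀ t ∈ Ioo 0 T, HasDerivAt f (f' t) t)
    (hg' : ∀ t ∈ Ioo 0 T, HasDerivAt g (f' t) t) (h0 : f 0 = g 0) :
    ∀ t ∈ Icc 0 T, f t = g t := by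
  intro t ht
  rcases ht.1.eq_or_lt with rfl | h
  · exact h0
  have hsub : Icc 0 t ⊆ Icc 0 T := Icc_subset_Icc_right ht.2
  obtain ⟨c, hc, hc'⟩ := exists_hasDerivAt_eq_slope (fun s => f s - g s) (fun s => f' s - f' s) h
    ((hf.mono hsub).sub (hg.mono hsub))
    (fun s hs => (hf' s ⟨hs.1, hs.2.trans_le ht.2⟩).sub (hg' s ⟨hs.1, hs.2.trans_le ht.2⟩))
  rw [sub_self, eq_comm, div_eq_zero_iff] at hc'
  rcases hc' with hc' | hc' <;> linarith

end Calculus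

theorem exists_bound_of_periodic {f : ℝ → ℝ} (hf : Continuous f) (hp : Function.Periodic f 1) :
    ∃ M, 0 < M ∧ ∀ x, |f x| ≤ M := by
  obtain ⟨C, hC⟩ := (isCompact_Icc (a := (0 : ℝ)) (b := 1)).exists_bound_of_continuousOn
    hf.continuousOn
  refine ⟨max C 1, by positivity, fun x => ?_⟩
  obtain ⟨y, hy, hxy⟩ := hp.exists_mem_Ico₀ one_pos x
  rw [hxy]
  exact (hC y ⟨hy.1, hy.2.le⟩).trans (le_max_left _ _)

/-- Second order Taylor expansion at a critical point. -/
theorem eventually_abs_sub_le_of_deriv_eq_zero {f : ℝ → ℝ} (hf : ContDiff ℝ ∞ f) {z : ℝ}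
    (hz : deriv f z = 0) {c : ℝ} (hc : 0 < c) :
    ∀ᶠ x in 𝓝 z, |f x - f z - deriv (deriv f) z / 2 * (x - z) ^ 2| ≤ c * (x - z) ^ 2 := by
  have h := taylor_isLittleO_univ (n := 2) (x₀ := z) (contDiff_infty.1 hf 2)
  filter_upwards [h.bound hc] with x hx
  have e : taylorWithinEval f 2 univ z x = f z + deriv (deriv f) z / 2 * (x - z) ^ 2 := by
    rw [taylorWithinEval_succ, taylorWithinEval_succ, taylor_within_zero_eval]
    simp only [iteratedDerivWithin_univ, iteratedDeriv_succ, iteratedDeriv_zero]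
    simp [hz]
    ring
  rw [e, Real.norm_eq_abs, Real.norm_eq_abs, abs_of_nonneg (sq_nonneg (x - z))] at hx
  rwa [← sub_sub] at hx

/-! ### Explicit formulas in the label and the parameter `η`, and the profiles that feed them. -/

/-- The quadratic polynomial in `η` which governs the Jacobian of the flow. -/
def quad (a r : ℝ → ℝ) (α η : ℝ) : ℝ := (1 - η * a α) ^ 2 + (η * r α) ^ 2

/-- `-1 / 2` times the logarithmic `η`-derivative of `quad`. -/
noncomputable def logSlope (a r : ℝ → ℝ) (α η : ℝ) : ℝ :=
  (a α * (1 - η * a α) - η * r α ^ 2) / quad a r α η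

/-- The integral over a period of the unnormalized Jacobian. -/
noncomputable def mass (lam : ℝ) (a r : ℝ → ℝ) (η : ℝ) : ℝ :=
  ∫ α in (0 : ℝ)..1, quad a r α η ^ (-(2 * lam)⁻¹)

/-- Physical time as a function of `η`. -/
noncomputable def clock (lam : ℝ) (a r : ℝ → ℝ) (η : ℝ) : ℝ :=
  ∫ s in (0 : ℝ)..η, mass lam a r s ^ (2 * lam)

/-- The Jacobian of the flow as a function of the label `α` and of `η`. -/
noncomputable def jac (lam : ℝ) (a r : ℝ → ℝ) (α η : ℝ) : ℝ :=
  quad a r α η ^ (-(2 * lam)⁻¹) / mass lam a r η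

/-- The zeros of `r` in a period at which `a` takes the value `μ`. -/
def peaks (a r : ℝ → ℝ) (μ : ℝ) : Set ℝ := {x | x ∈ Icc (0 : ℝ) 1 ∧ r x = 0 ∧ a x = μ}

/-- Smooth periodic `a`, `r` such that `μ > 0` is the maximum of `a` over the zeros of `r`,
attained only at finitely many points of a period, where `a` is critical and strictly concave. -/
structure IsProfile (a r : ℝ → ℝ) (μ : ℝ) : Prop where
  smooth_a : ContDiff ℝ ∞ a
  smooth_r : ContDiff ℝ ∞ r
  periodic_a : Function.Periodic a 1
  periodic_r : Function.Periodic r 1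
  pos : 0 < μ
  le_max : ∀ x ∈ Icc (0 : ℝ) 1, r x = 0 → a x ≤ μ
  finite_peaks : (peaks a r μ).Finite
  nonempty_peaks : (peaks a r μ).Nonempty
  deriv_eq_zero : ∀ z ∈ peaks a r μ, deriv a z = 0
  deriv_deriv_neg : ∀ z ∈ peaks a r μ, deriv (deriv a) z < 0

section Quad

variable {a r : ℝ → ℝ} {μ : ℝ}

theorem quad_nonneg (a r : ℝ → ℝ) (α η : ℝ) : 0 ≤ quad a r α η := by
  unfold quad; positivity

@[simp] theorem quad_zero (a r : ℝ → ℝ) (α : ℝ) : quad a r α 0 = 1 := by simp [quad]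

theorem quad_periodic (ha : Function.Periodic a 1) (hr : Function.Periodic r 1) (η : ℝ) :
    Function.Periodic (fun α => quad a r α η) 1 := fun α => by simp [quad, ha α, hr α]

theorem logSlope_periodic (ha : Function.Periodic a 1) (hr : Function.Periodic r 1) (η : ℝ) :
    Function.Periodic (fun α => logSlope a r α η) 1 := fun α => by
  simp [logSlope, quad, ha α, hr α]

theorem contDiff_quad (ha : ContDiff ℝ ∞ a) (hr : ContDiff ℝ ∞ r) :
    ContDiff ℝ ∞ (fun z : ℝ × ℝ => quad a r z.1 z.2) := by
  unfold quad; fun_prop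

theorem continuous_quad (ha : Continuous a) (hr : Continuous r) :
    Continuous (fun z : ℝ × ℝ => quad a r z.1 z.2) := by
  unfold quad; fun_prop

theorem sq_le_quad (a r : ℝ → ℝ) (α η : ℝ) : (1 - η * a α) ^ 2 ≤ quad a r α η := by
  unfold quad; nlinarith [sq_nonneg (η * r α)]

theorem sq_le_quad' (a r : ℝ → ℝ) (α η : ℝ) : (η * r α) ^ 2 ≤ quad a r α η := by
  unfold quad; nlinarith [sq_nonneg (1 - η * a α)]

/-- The numerator is a combination, with coefficients `a` and `-r`, of `1 - η a` and `η r`, the two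
quantities whose squares add up to `quad`. So the slope is no more singular than `quad ^ (-1/2)`. -/
theorem abs_logSlope_mul_sqrt_le {M : ℝ} (ha : ∀ x, |a x| ≤ M) (hr : ∀ x, |r x| ≤ M) (α η : ℝ) :
    |logSlope a r α η| * √(quad a r α η) ≤ 2 * M := by
  have hM : 0 ≤ M := (abs_nonneg _).trans (ha 0)
  rcases (quad_nonneg a r α η).eq_or_lt with h | h
  · rw [← h]; simp; exact hM
  have h1 : |1 - η * a α| ≤ √(quad a r α η) := Real.abs_le_sqrt (sq_le_quad a r α η)
  have h2 : |η * r α| ≤ √(quad a r α η) := Real.abs_le_sqrt (sq_le_quad' a r α η)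
  have h3 : |a α * (1 - η * a α) - η * r α ^ 2| ≤ 2 * M * √(quad a r α η) := by
    calc |a α * (1 - η * a α) - η * r α ^ 2|
        = |a α * (1 - η * a α) - r α * (η * r α)| := by ring_nf
      _ ≤ |a α| * |1 - η * a α| + |r α| * |η * r α| := by
        rw [← abs_mul, ← abs_mul]; exact abs_sub _ _
      _ ≤ M * √(quad a r α η) + M * √(quad a r α η) := by
        gcongr <;> first | exact ha α | exact hr α
      _ = _ := by ring
  have hs : 0 < √(quad a r α η) := Real.sqrt_pos.2 h
  rw [logSlope, abs_div, abs_of_pos h, div_mul_eq_mul_div, div_le_iff₀ h]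
  calc _ ≤ 2 * M * √(quad a r α η) * √(quad a r α η) := by gcongr
    _ = 2 * M * quad a r α η := by rw [mul_assoc, Real.mul_self_sqrt h.le]

end Quad

namespace IsProfile

variable {a r : ℝ → ℝ} {μ : ℝ} (h : IsProfile a r μ)
include h

theorem exists_bound : ∃ M, 0 < M ∧ (∀ x, |a x| ≤ M) ∧ ∀ x, |r x| ≤ M := by
  obtain ⟨M, hM, h1⟩ := exists_bound_of_periodic h.smooth_a.continuous h.periodic_a
  obtain ⟨N, hN, h2⟩ := exists_bound_of_periodic h.smooth_r.continuous h.periodic_r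
  exact ⟨max M N, by positivity, fun x => (h1 x).trans (le_max_left _ _),
    fun x => (h2 x).trans (le_max_right _ _)⟩

theorem le_of_eq_zero {x : ℝ} (hx : r x = 0) : a x ≤ μ := by
  have h1 : a (Int.fract x) = a x := by
    rw [Int.fract]
    simpa using h.periodic_a.sub_int_mul_eq ⌊x⌋ (x := x)
  have h2 : r (Int.fract x) = r x := by
    rw [Int.fract]
    simpa using h.periodic_r.sub_int_mul_eq ⌊x⌋ (x := x)
  rw [← h1]
  exact h.le_max _ ⟨Int.fract_nonneg x, (Int.fract_lt_one x).le⟩ (h2.trans hx)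

/-- A sum of two squares vanishes only if both do; at a zero of `r` one has `η a ≤ η μ < 1`. -/
theorem quad_pos (α : ℝ) {η : ℝ} (h0 : 0 ≤ η) (h1 : η < 1 / μ) : 0 < quad a r α η := by
  refine (quad_nonneg a r α η).lt_of_ne' fun h2 => ?_
  have h3 : 1 - η * a α = 0 := by
    have := sq_le_quad a r α η
    rw [h2] at this
    exact pow_eq_zero_iff two_ne_zero |>.1 (le_antisymm this (sq_nonneg _))
  have h4 : η * r α = 0 := by
    have := sq_le_quad' a r α η
    rw [h2] at this
    exact pow_eq_zero_iff two_ne_zero |>.1 (le_antisymm this (sq_nonneg _))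
  rcases mul_eq_zero.1 h4 with h5 | h5
  · simp [h5] at h3
  · have h6 := h.le_of_eq_zero h5
    rw [lt_div_iff₀ h.pos] at h1
    nlinarith

theorem quad_pos_max {α : ℝ} (hα : α ∈ Icc (0 : ℝ) 1) (hα' : α ∉ peaks a r μ) :
    0 < quad a r α (1 / μ) := by
  have hμ := h.pos
  refine (quad_nonneg a r α _).lt_of_ne' fun h2 => hα' ?_
  have h3 : 1 - 1 / μ * a α = 0 := by
    have := sq_le_quad a r α (1 / μ)
    rw [h2] at this
    exact pow_eq_zero_iff two_ne_zero |>.1 (le_antisymm this (sq_nonneg _))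
  have h4 : 1 / μ * r α = 0 := by
    have := sq_le_quad' a r α (1 / μ)
    rw [h2] at this
    exact pow_eq_zero_iff two_ne_zero |>.1 (le_antisymm this (sq_nonneg _))
  refine ⟨hα, ?_, ?_⟩
  · simpa [hμ.ne'] using h4
  · field_simp at h3; linarith

/-- The margin below `0` makes the parameter interval open around `η = 0`; this later gives
smoothness of the constructed solution up to `t = 0`. -/
theorem exists_quad_pos : ∃ e, 0 < e ∧ ∀ α, ∀ η ∈ Ioo (-e) (1 / μ), 0 < quad a r α η := by
  obtain ⟨M, hM, ha, -⟩ := h.exists_bound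
  refine ⟨1 / M, by positivity, fun α η hη => ?_⟩
  rcases le_or_gt 0 η with h0 | h0
  · exact h.quad_pos α h0 hη.2
  · have h1 : η * a α < 1 := by
      calc η * a α ≤ |η * a α| := le_abs_self _
        _ = |η| * |a α| := abs_mul _ _
        _ ≤ |η| * M := by gcongr; exact ha α
        _ < 1 := by
          rw [abs_of_neg h0, ← lt_div_iff₀ hM]; linarith [hη.1]
    exact lt_of_lt_of_le (by nlinarith) (sq_le_quad a r α η)

theorem eventually_sub_bounds {z : ℝ} (hz : z ∈ peaks a r μ) :
    ∃ b B : ℝ, 0 < b ∧ 0 < B ∧ ∀ᶠ x in 𝓝 z,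
      b * (x - z) ^ 2 ≤ μ - a x ∧ μ - a x ≤ B * (x - z) ^ 2 := by
  have h2 := h.deriv_deriv_neg z hz
  -- The Taylor coefficient of `μ - a` is `-a''/2`; an error of half that size leaves a factor
  -- between `-a''/4` and `-3a''/4`.
  refine ⟨-deriv (deriv a) z / 4, -deriv (deriv a) z, by linarith, by linarith, ?_⟩
  filter_upwards [eventually_abs_sub_le_of_deriv_eq_zero h.smooth_a (h.deriv_eq_zero z hz)
    (c := -deriv (deriv a) z / 4) (by linarith)] with x hx
  rw [hz.2.2, abs_le] at hx
  constructor
  · nlinarith [hx.2]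
  · nlinarith [hx.1, sq_nonneg (x - z)]

end IsProfile

/-! ### Smoothness of mass and clock below the critical parameter. -/

section Mass

variable {lam μ : ℝ} {a r : ℝ → ℝ}

theorem mass_pos_of_quad_pos (ha : Continuous a) (hr : Continuous r) {η : ℝ}
    (hq : ∀ α, 0 < quad a r α η) : 0 < mass lam a r η := by
  refine intervalIntegral.intervalIntegral_pos_of_pos_on ?_
    (fun x _ => Real.rpow_pos_of_pos (hq x) _) one_pos
  refine Continuous.intervalIntegrable ?_ _ _
  refine Continuous.rpow_const ?_ fun x => Or.inl (hq x).ne'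
  unfold quad; fun_prop

theorem contDiffOn_quad_rpow (ha : ContDiff ℝ ∞ a) (hr : ContDiff ℝ ∞ r) {U : Set ℝ}
    (hq : ∀ α, ∀ η ∈ U, 0 < quad a r α η) (p : ℝ) :
    ContDiffOn ℝ ∞ (fun z : ℝ × ℝ => quad a r z.2 z.1 ^ p) (U ×ˢ univ) := by
  refine ContDiffOn.rpow_const_of_ne ?_ fun z hz => (hq z.2 z.1 hz.1).ne'
  unfold quad
  have : ContDiff ℝ ∞ fun z : ℝ × ℝ => (1 - z.1 * a z.2) ^ 2 + (z.1 * r z.2) ^ 2 := by fun_prop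
  exact this.contDiffOn

theorem contDiffOn_mass (ha : ContDiff ℝ ∞ a) (hr : ContDiff ℝ ∞ r) {U : Set ℝ} (hU : IsOpen U)
    (hq : ∀ α, ∀ η ∈ U, 0 < quad a r α η) : ContDiffOn ℝ ∞ (mass lam a r) U :=
  contDiffOn_intervalIntegral (f := fun η α => quad a r α η ^ (-(2 * lam)⁻¹)) hU 0 1
    (contDiffOn_quad_rpow ha hr hq _)

theorem hasDerivAt_clock (ha : ContDiff ℝ ∞ a) (hr : ContDiff ℝ ∞ r) {U : Set ℝ} (hU : IsOpen U)
    (hU' : U.OrdConnected) (h0 : 0 ∈ U) (hq : ∀ α, ∀ η ∈ U, 0 < quad a r α η) {η : ℝ}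
    (hη : η ∈ U) : HasDerivAt (clock lam a r) (mass lam a r η ^ (2 * lam)) η := by
  have hc : ContinuousOn (fun s => mass lam a r s ^ (2 * lam)) U :=
    (contDiffOn_mass ha hr hU hq).continuousOn.rpow_const fun s hs =>
      Or.inl (mass_pos_of_quad_pos ha.continuous hr.continuous fun α => hq α s hs).ne'
  refine intervalIntegral.integral_hasDerivAt_right
    ((hc.mono (hU'.uIcc_subset h0 hη)).intervalIntegrable)
    (hc.stronglyMeasurableAtFilter hU η hη) (hc.continuousAt (hU.mem_nhds hη))

@[simp] theorem clock_zero (lam : ℝ) (a r : ℝ → ℝ) : clock lam a r 0 = 0 := by simp [clock]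

end Mass

theorem intervalIntegrable_abs_sub_rpow {s : ℝ} (hs : -1 < s) (z a b : ℝ) :
    IntervalIntegrable (fun x => |x - z| ^ s) volume a b := by
  have h : IntervalIntegrable (fun x : ℝ => |x| ^ s) volume (a - z) (b - z) := by
    have := (intervalIntegral.intervalIntegrable_cpow' (a := a - z) (b := b - z)
      (r := (s : ℂ)) (by simpa using hs)).norm
    refine this.congr fun x _ => ?_
    simp [Complex.norm_cpow_real]
  simpa using h.comp_sub_right z

/-- A peak may sit at the right end of `[0, 1]`; shifting the period to `[z, z + 1]` lets the
estimates always use the points to the right of `z`. -/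
theorem mul_sub_le_integral_of_periodic {f : ℝ → ℝ} (hf : Continuous f)
    (hp : Function.Periodic f 1) (h0 : ∀ x, 0 ≤ f x) {z x y m : ℝ} (hzx : z ≤ x) (hxy : x ≤ y)
    (hyz : y ≤ z + 1) (hm : ∀ t ∈ Icc x y, m ≤ f t) : m * (y - x) ≤ ∫ t in (0 : ℝ)..1, f t := by
  have e : ∫ t in (0 : ℝ)..1, f t = ∫ t in z..z + 1, f t := by
    simpa using hp.intervalIntegral_add_eq 0 z
  rw [e]
  calc m * (y - x) = ∫ _ in x..y, m := by simp [mul_comm]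
    _ ≤ ∫ t in x..y, f t := intervalIntegral.integral_mono_on hxy intervalIntegrable_const
        (hf.intervalIntegrable _ _) hm
    _ ≤ ∫ t in z..z + 1, f t := intervalIntegral.integral_mono_interval hzx hxy hyz
        (Eventually.of_forall h0) (hf.intervalIntegrable _ _)

/-- The minimum serves both signs of `θ`: for `θ ≥ 0` the lower bound on `q` is used, for `θ < 0`
the upper one. -/
theorem min_one_rpow_mul_le {C q e θ : ℝ} (he : 0 < e) (hC : 0 < C) (h1 : e ^ 2 ≤ q)
    (h2 : q ≤ C * e ^ 2) : min 1 (C ^ θ) * e ^ (2 * θ) ≤ q ^ θ := by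
  have e2 : e ^ (2 * θ) = (e ^ 2) ^ θ := by
    rw [Real.rpow_mul he.le]; norm_cast
  have hq : 0 < q := lt_of_lt_of_le (by positivity) h1
  rw [e2]
  rcases le_or_gt 0 θ with hθ | hθ
  · calc _ ≤ 1 * (e ^ 2) ^ θ := by gcongr; exact min_le_left _ _
      _ ≤ q ^ θ := by rw [one_mul]; gcongr
  · calc _ ≤ C ^ θ * (e ^ 2) ^ θ := by gcongr; exact min_le_right _ _
      _ = (C * e ^ 2) ^ θ := (Real.mul_rpow hC.le (by positivity)).symm
      _ ≤ q ^ θ := Real.rpow_le_rpow_of_nonpos hq h2 hθ.le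

/-! ### Lower bounds on `quad`, uniform up to the critical parameter. -/

namespace IsProfile

variable {a r : ℝ → ℝ} {μ : ℝ} (h : IsProfile a r μ)
include h

theorem continuous_quad_rpow {η : ℝ} (h0 : 0 ≤ η) (h1 : η < 1 / μ) (p : ℝ) :
    Continuous (fun α => quad a r α η ^ p) := by
  refine Continuous.rpow_const ?_ fun α => Or.inl (h.quad_pos α h0 h1).ne'
  have ha := h.smooth_a.continuous
  have hr := h.smooth_r.continuous
  unfold quad; fun_prop

theorem continuous_logSlope {η : ℝ} (h0 : 0 ≤ η) (h1 : η < 1 / μ) :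
    Continuous (fun α => logSlope a r α η) := by
  have ha := h.smooth_a.continuous
  have hr := h.smooth_r.continuous
  refine Continuous.div (by fun_prop) ?_ fun α => (h.quad_pos α h0 h1).ne'
  unfold quad; fun_prop

/-- A lower bound for `quad` near the peaks, uniform up to the critical parameter, extends to the
whole period. -/
theorem exists_mul_rpow_le_sqrt_quad {φ : ℝ → ℝ} {k : ℝ} (hk : 0 ≤ k)
    (hφ : ∀ η ∈ Ico (1 / (2 * μ)) (1 / μ), 0 < φ η ∧ φ η ≤ 1)
    (hloc : ∀ z ∈ peaks a r μ, ∃ c, 0 < c ∧ ∀ᶠ x in 𝓝 z, ∀ η ∈ Ico (1 / (2 * μ)) (1 / μ),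
      c * φ η * |x - z| ^ k ≤ √(quad a r x η)) :
    ∃ c, 0 < c ∧ ∀ x ∈ Icc (0 : ℝ) 1, ∀ η ∈ Ico (1 / (2 * μ)) (1 / μ), ∃ z ∈ peaks a r μ,
      c * φ η * |x - z| ^ k ≤ √(quad a r x η) := by
  have hμ := h.pos
  -- Compactness is applied to the closed rectangle, including `η = 1 / μ`, so that the constant
  -- does not degenerate as the critical parameter is approached.
  let p : Set (ℝ × ℝ) → Prop := fun S => ∃ c, 0 < c ∧ ∀ w ∈ S, w.1 ∈ Icc (0 : ℝ) 1 →
    w.2 ∈ Ico (1 / (2 * μ)) (1 / μ) → ∃ z ∈ peaks a r μ,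
      c * φ w.2 * |w.1 - z| ^ k ≤ √(quad a r w.1 w.2)
  have hK : IsCompact (Icc (0 : ℝ) 1 ×ˢ Icc (1 / (2 * μ)) (1 / μ)) :=
    isCompact_Icc.prod isCompact_Icc
  have main : p (Icc (0 : ℝ) 1 ×ˢ Icc (1 / (2 * μ)) (1 / μ)) := by
    refine hK.induction_on (p := p) ⟨1, one_pos, by simp⟩ ?_ ?_ ?_
    · rintro S T hST ⟨c, hc, hT⟩
      exact ⟨c, hc, fun w hw => hT w (hST hw)⟩
    · rintro S T ⟨c, hc, hS⟩ ⟨d, hd, hT⟩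
      refine ⟨min c d, lt_min hc hd, fun w hw h1 h2 => ?_⟩
      have hφ' := (hφ _ h2).1.le
      rcases hw with hw | hw
      · obtain ⟨z, hz, hz'⟩ := hS w hw h1 h2
        refine ⟨z, hz, le_trans ?_ hz'⟩
        gcongr
        exact min_le_left _ _
      · obtain ⟨z, hz, hz'⟩ := hT w hw h1 h2
        refine ⟨z, hz, le_trans ?_ hz'⟩
        gcongr
        exact min_le_right _ _
    · rintro ⟨x, η⟩ ⟨hx, hη⟩
      -- Where `quad` is positive, continuity suffices and any peak will do, since `φ` and the
      -- distance are at most one. It vanishes only at `η = 1 / μ` over a peak, where the local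
      -- hypothesis takes over.
      by_cases hq : 0 < quad a r x η
      · have hcont : Continuous (fun w : ℝ × ℝ => √(quad a r w.1 w.2)) :=
          (continuous_quad h.smooth_a.continuous h.smooth_r.continuous).sqrt
        have hs : √(quad a r x η) / 2 < √(quad a r x η) := half_lt_self (Real.sqrt_pos.2 hq)
        refine ⟨_, mem_nhdsWithin_of_mem_nhds (hcont.continuousAt.eventually (lt_mem_nhds hs)),
          √(quad a r x η) / 2, half_pos (Real.sqrt_pos.2 hq), fun w hw h1 h2 => ?_⟩
        obtain ⟨z, hz⟩ := h.nonempty_peaks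
        refine ⟨z, hz, le_trans ?_ (le_of_lt hw)⟩
        have hd : |w.1 - z| ≤ 1 := abs_le.2 ⟨by linarith [h1.1, hz.1.2], by linarith [h1.2, hz.1.1]⟩
        have h3 := (hφ _ h2)
        calc _ ≤ √(quad a r x η) / 2 * 1 * 1 := by
              gcongr
              · exact h3.2
              · exact Real.rpow_le_one (abs_nonneg _) hd hk
          _ = _ := by simp
      · have hη1 : η = 1 / μ := by
          by_contra hne
          exact hq (h.quad_pos x ((by positivity : (0 : ℝ) ≤ 1 / (2 * μ)).trans hη.1)
            (lt_of_le_of_ne hη.2 hne))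
        have hxp : x ∈ peaks a r μ := by
          by_contra hne
          exact hq (hη1 ▸ h.quad_pos_max hx hne)
        obtain ⟨c, hc, hev⟩ := hloc x hxp
        have : ∀ᶠ w : ℝ × ℝ in 𝓝 (x, η), ∀ η ∈ Ico (1 / (2 * μ)) (1 / μ),
            c * φ η * |w.1 - x| ^ k ≤ √(quad a r w.1 η) :=
          (continuous_fst.tendsto (x, η)).eventually hev
        exact ⟨_, mem_nhdsWithin_of_mem_nhds this, c, hc,
          fun w hw _ h2 => ⟨x, hxp, hw _ h2⟩⟩
  obtain ⟨c, hc, hmain⟩ := main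
  exact ⟨c, hc, fun x hx η hη => hmain (x, η) ⟨hx, hη.1, hη.2.le⟩ hx hη⟩

/-- From `1 - η a = (1 - μ η) + η (μ - a)` and concavity of `a`, `√quad` dominates `(1 - μ η) + (x -
z) ^ 2`. Weighted AM-GM with weights `1 - δ`, `δ` turns the sum into a product; `δ` trades
singularity in `η` against singularity in `x`. -/
theorem exists_mul_rpow_le_sqrt_quad_of_peak {z : ℝ} (hz : z ∈ peaks a r μ) {δ : ℝ} (h0 : 0 ≤ δ)
    (h1 : δ ≤ 1) : ∃ c, 0 < c ∧ ∀ᶠ x in 𝓝 z, ∀ η ∈ Ico (1 / (2 * μ)) (1 / μ),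
      c * (1 - μ * η) ^ (1 - δ) * |x - z| ^ (2 * δ) ≤ √(quad a r x η) := by
  have hμ := h.pos
  obtain ⟨b, B, hb, -, hev⟩ := h.eventually_sub_bounds hz
  refine ⟨min 1 (b / (2 * μ)), by positivity, ?_⟩
  filter_upwards [hev] with x hx η hη
  have hε : 0 < 1 - μ * η := by
    have := hη.2
    rw [lt_div_iff₀ hμ] at this; linarith
  have hη0 : 0 < η := lt_of_lt_of_le (by positivity) hη.1
  have e1 : |x - z| ^ (2 * δ) = ((x - z) ^ 2) ^ δ := by
    rw [Real.rpow_mul (abs_nonneg _)]; norm_cast; rw [sq_abs]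
  have h2 := Real.geom_mean_le_arith_mean2_weighted (by linarith : 0 ≤ 1 - δ) h0 hε.le
    (sq_nonneg (x - z)) (by ring)
  have h3 : (1 - μ * η) ^ (1 - δ) * ((x - z) ^ 2) ^ δ ≤ (1 - μ * η) + (x - z) ^ 2 := by
    nlinarith [sq_nonneg (x - z)]
  rw [e1, mul_assoc]
  calc _ ≤ min 1 (b / (2 * μ)) * ((1 - μ * η) + (x - z) ^ 2) := by gcongr
    _ ≤ 1 * (1 - μ * η) + b / (2 * μ) * (x - z) ^ 2 := by
      rw [mul_add]
      gcongr
      · exact min_le_left _ _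
      · exact min_le_right _ _
    _ = 1 * (1 - μ * η) + 1 / (2 * μ) * (b * (x - z) ^ 2) := by ring
    _ ≤ 1 * (1 - μ * η) + η * (μ - a x) := by
      gcongr
      · exact hη.1
      · exact hx.1
    _ = 1 - η * a x := by ring
    _ ≤ |1 - η * a x| := le_abs_self _
    _ ≤ _ := Real.abs_le_sqrt (sq_le_quad a r x η)

/-- Here the term `η r` alone gives a linear bound, with no loss as `η` becomes critical. -/
theorem exists_mul_rpow_le_sqrt_quad_of_deriv_ne_zero {z : ℝ} (hz : z ∈ peaks a r μ)
    (hz' : deriv r z ≠ 0) : ∃ c, 0 < c ∧ ∀ᶠ x in 𝓝 z, ∀ η ∈ Ico (1 / (2 * μ)) (1 / μ),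
      c * 1 * |x - z| ^ (1 : ℝ) ≤ √(quad a r x η) := by
  have hμ := h.pos
  have hd : HasDerivAt r (deriv r z) z := (h.smooth_r.differentiable (by simp) z).hasDerivAt
  have hpos : 0 < |deriv r z| := abs_pos.2 hz'
  refine ⟨1 / (2 * μ) * (|deriv r z| / 2), by positivity, ?_⟩
  have := hasDerivAt_iff_isLittleO.1 hd
  filter_upwards [this.bound (half_pos hpos)] with x hx η hη
  have hη0 : 0 < η := lt_of_lt_of_le (by positivity) hη.1
  rw [hz.2.1, sub_zero, smul_eq_mul, Real.norm_eq_abs, Real.norm_eq_abs] at hx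
  have h1 : |deriv r z| / 2 * |x - z| ≤ |r x| := by
    have h2 : |(x - z) * deriv r z| ≤ |r x| + |r x - (x - z) * deriv r z| := by
      have := abs_sub (r x) (r x - (x - z) * deriv r z)
      simpa using this
    rw [abs_mul] at h2
    linarith
  rw [Real.rpow_one, mul_one, mul_assoc]
  calc _ ≤ η * |r x| := by gcongr; exact hη.1
    _ = |η * r x| := by rw [abs_mul, abs_of_pos hη0]
    _ ≤ _ := Real.abs_le_sqrt (sq_le_quad' a r x η)

/-- The peak in the lower bound depends on the point; summing over all peaks removes that choice and
keeps the majorant independent of `η` apart from the factor in `φ`. -/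
theorem exists_quad_rpow_le {φ : ℝ → ℝ} {k s : ℝ} (hk : 0 ≤ k) (hs : 0 ≤ s)
    (hφ : ∀ η ∈ Ico (1 / (2 * μ)) (1 / μ), 0 < φ η ∧ φ η ≤ 1)
    (hloc : ∀ z ∈ peaks a r μ, ∃ c, 0 < c ∧ ∀ᶠ x in 𝓝 z, ∀ η ∈ Ico (1 / (2 * μ)) (1 / μ),
      c * φ η * |x - z| ^ k ≤ √(quad a r x η)) :
    ∃ C, 0 < C ∧ ∀ x ∈ Icc (0 : ℝ) 1, x ∉ peaks a r μ → ∀ η ∈ Ico (1 / (2 * μ)) (1 / μ),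
      quad a r x η ^ (-(s / 2)) ≤
        C * φ η ^ (-s) * ∑ z ∈ h.finite_peaks.toFinset, |x - z| ^ (-(k * s)) := by
  obtain ⟨c, hc, hmain⟩ := h.exists_mul_rpow_le_sqrt_quad hk hφ hloc
  refine ⟨c ^ (-s), by positivity, fun x hx hxp η hη => ?_⟩
  obtain ⟨z, hz, hle⟩ := hmain x hx η hη
  have hφ' := (hφ η hη).1
  have hxz : 0 < |x - z| := abs_pos.2 (sub_ne_zero.2 fun e => hxp (e ▸ hz))
  have h1 : quad a r x η ^ (-(s / 2)) = √(quad a r x η) ^ (-s) := by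
    rw [Real.sqrt_eq_rpow, ← Real.rpow_mul (quad_nonneg a r x η)]; ring_nf
  rw [h1]
  calc √(quad a r x η) ^ (-s) ≤ (c * φ η * |x - z| ^ k) ^ (-s) :=
        Real.rpow_le_rpow_of_nonpos (by positivity) hle (by linarith)
    _ = c ^ (-s) * φ η ^ (-s) * |x - z| ^ (-(k * s)) := by
      rw [Real.mul_rpow (by positivity) (by positivity), Real.mul_rpow hc.le hφ'.le,
        ← Real.rpow_mul hxz.le]
      ring_nf
    _ ≤ _ := by
      gcongr
      exact Finset.single_le_sum (f := fun z => |x - z| ^ (-(k * s)))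
        (fun w _ => by positivity) (h.finite_peaks.mem_toFinset.2 hz)

theorem ae_notMem_peaks : ∀ᵐ x : ℝ, x ∉ peaks a r μ :=
  measure_eq_zero_iff_ae_notMem.1 (h.finite_peaks.measure_zero volume)

/-- The condition `k * s < 1` is integrability of `|x - z| ^ (-(k * s))` at a peak. -/
theorem exists_integral_quad_rpow_le {φ : ℝ → ℝ} {k s : ℝ} (hk : 0 ≤ k) (hs : 0 ≤ s)
    (hks : k * s < 1)
    (hφ : ∀ η ∈ Ico (1 / (2 * μ)) (1 / μ), 0 < φ η ∧ φ η ≤ 1)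
    (hloc : ∀ z ∈ peaks a r μ, ∃ c, 0 < c ∧ ∀ᶠ x in 𝓝 z, ∀ η ∈ Ico (1 / (2 * μ)) (1 / μ),
      c * φ η * |x - z| ^ k ≤ √(quad a r x η)) :
    ∃ C, 0 < C ∧ ∀ η ∈ Ico (1 / (2 * μ)) (1 / μ),
      ∫ x in (0 : ℝ)..1, quad a r x η ^ (-(s / 2)) ≤ C * φ η ^ (-s) := by
  have hμ := h.pos
  obtain ⟨C, hC, hle⟩ := h.exists_quad_rpow_le hk hs hφ hloc
  have hint : IntervalIntegrable (fun x => ∑ z ∈ h.finite_peaks.toFinset, |x - z| ^ (-(k * s)))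
      volume 0 1 := by
    have := IntervalIntegrable.sum (μ := volume) (a := 0) (b := 1) h.finite_peaks.toFinset
      (f := fun z x => |x - z| ^ (-(k * s)))
      (fun z _ => intervalIntegrable_abs_sub_rpow (by linarith) z 0 1)
    simpa [Finset.sum_fn] using this
  have hD : 0 ≤ ∫ x in (0 : ℝ)..1, ∑ z ∈ h.finite_peaks.toFinset, |x - z| ^ (-(k * s)) :=
    intervalIntegral.integral_nonneg zero_le_one fun x _ =>
      Finset.sum_nonneg fun z _ => by positivity
  refine ⟨C * ((∫ x in (0 : ℝ)..1, ∑ z ∈ h.finite_peaks.toFinset, |x - z| ^ (-(k * s))) + 1),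
    by positivity, fun η hη => ?_⟩
  have hφ' := (hφ η hη).1
  have hη0 : 0 ≤ η := le_trans (by positivity) hη.1
  calc ∫ x in (0 : ℝ)..1, quad a r x η ^ (-(s / 2))
      ≤ ∫ x in (0 : ℝ)..1,
        C * φ η ^ (-s) * ∑ z ∈ h.finite_peaks.toFinset, |x - z| ^ (-(k * s)) := by
        refine intervalIntegral.integral_mono_ae_restrict zero_le_one
          ((h.continuous_quad_rpow hη0 hη.2 _).intervalIntegrable _ _) (hint.const_mul _) ?_
        rw [EventuallyLE, ae_restrict_iff' measurableSet_Icc]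
        filter_upwards [h.ae_notMem_peaks] with x hx hx'
        exact hle x hx' hx η hη
    _ = C * φ η ^ (-s) *
        (∫ x in (0 : ℝ)..1, ∑ z ∈ h.finite_peaks.toFinset, |x - z| ^ (-(k * s))) :=
        intervalIntegral.integral_const_mul _ _
    _ ≤ _ := by
      have : 0 < φ η ^ (-s) := by positivity
      nlinarith [mul_pos hC this]

end IsProfile

/-! ### Concentration and oscillation of the logarithmic slope near a peak. -/

theorem sq_le_quad_and_quad_le {a r : ℝ → ℝ} {μ B K x η : ℝ} (hμ : 0 < μ)
    (h0 : 0 ≤ η) (h1 : η < 1 / μ) (ha0 : 0 ≤ μ - a x) (ha1 : μ - a x ≤ B * (K * (1 - μ * η)))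
    (hr : |r x| ≤ B * (K * (1 - μ * η))) :
    (1 - μ * η) ≤ 1 - η * a x ∧ (1 - μ * η) ^ 2 ≤ quad a r x η ∧
    quad a r x η ≤ ((1 + B * K / μ) ^ 2 + (B * K / μ) ^ 2) * (1 - μ * η) ^ 2 := by
  have hε : 0 < 1 - μ * η := by
    rw [lt_div_iff₀ hμ] at h1; linarith
  set ε := 1 - μ * η with hεdef
  -- Wherever `μ - a` and `|r|` are of order `ε`, this identity makes `√quad` comparable to `ε` from
  -- both sides.
  have hA : 1 - η * a x = ε + η * (μ - a x) := by rw [hεdef]; ring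
  have hA0 : ε ≤ 1 - η * a x := by rw [hA]; nlinarith
  have hA1 : 1 - η * a x ≤ (1 + B * K / μ) * ε := by
    rw [hA]
    have : η * (μ - a x) ≤ 1 / μ * (B * (K * ε)) := by gcongr
    calc _ ≤ ε + 1 / μ * (B * (K * ε)) := by linarith
      _ = _ := by ring
  have hR : |η * r x| ≤ B * K / μ * ε := by
    rw [abs_mul, abs_of_nonneg h0]
    calc η * |r x| ≤ 1 / μ * (B * (K * ε)) := by gcongr
      _ = _ := by ring
  have h2 : ε ^ 2 ≤ (1 - η * a x) ^ 2 := by gcongr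
  refine ⟨hA0, h2.trans (sq_le_quad a r x η), ?_⟩
  unfold quad
  rw [add_mul, ← mul_pow, ← mul_pow]
  refine add_le_add (pow_le_pow_left₀ (hε.le.trans hA0) hA1 2) ?_
  rw [← sq_abs (η * r x)]
  exact pow_le_pow_left₀ (abs_nonneg _) hR 2

theorem tendsto_one_sub_mul {μ : ℝ} (hμ : 0 < μ) :
    Tendsto (fun η => 1 - μ * η) (𝓝[<] (1 / μ)) (𝓝[>] 0) := by
  refine tendsto_nhdsWithin_iff.2 ⟨?_, ?_⟩
  · have : Continuous fun η : ℝ => 1 - μ * η := by fun_prop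
    have h := this.tendsto (1 / μ)
    rw [mul_one_div_cancel hμ.ne', sub_self] at h
    exact h.mono_left nhdsWithin_le_nhds
  · filter_upwards [self_mem_nhdsWithin] with η hη
    have : η < 1 / μ := hη
    rw [lt_div_iff₀ hμ] at this
    show 0 < 1 - μ * η
    linarith

theorem Ico_mem_nhdsLT_one_div {μ : ℝ} (hμ : 0 < μ) :
    Ico (1 / (2 * μ)) (1 / μ) ∈ 𝓝[<] (1 / μ) :=
  Ico_mem_nhdsLT (by rw [div_lt_div_iff₀ (by positivity) hμ]; linarith)

namespace IsProfile

variable {a r : ℝ → ℝ} {μ : ℝ} (h : IsProfile a r μ)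
include h

/-- Close to a peak `a ≥ μ / 2`, so the first term of the numerator is at least `μ ε / 2` with `ε =
1 - μ η`, while `η r²` is quadratic in `ε` and takes away at most half of that. The denominator
`quad` is of order `ε²`. -/
theorem le_logSlope {B x η : ℝ} (hB : 0 < B) (h0 : 0 ≤ η) (h1 : η < 1 / μ)
    (ha0 : 0 ≤ μ - a x) (ha1 : μ - a x ≤ B * (1 - μ * η)) (hr : |r x| ≤ B * (1 - μ * η))
    (hε1 : B * (1 - μ * η) ≤ μ / 2) (hε2 : B ^ 2 * (1 - μ * η) ≤ μ ^ 2 / 4) :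
    μ / 4 / ((1 + B / μ) ^ 2 + (B / μ) ^ 2) / (1 - μ * η) ≤ logSlope a r x η := by
  have hμ := h.pos
  have hε : 0 < 1 - μ * η := by
    have := h1
    rw [lt_div_iff₀ hμ] at this; linarith
  obtain ⟨hA, hQ0, hQ1⟩ := sq_le_quad_and_quad_le hμ (K := 1) h0 h1 ha0 (by simpa using ha1)
    (by simpa using hr)
  rw [mul_one] at hQ1
  set ε := 1 - μ * η
  have hq := h.quad_pos x h0 h1
  have hnum : μ / 4 * ε ≤ a x * (1 - η * a x) - η * r x ^ 2 := by
    have h3 : μ / 2 * ε ≤ a x * (1 - η * a x) := by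
      have : μ / 2 ≤ a x := by linarith
      have : 0 ≤ a x := by linarith
      gcongr
    have h4 : η * r x ^ 2 ≤ μ / 4 * ε := by
      calc η * r x ^ 2 = η * |r x| ^ 2 := by rw [sq_abs]
        _ ≤ 1 / μ * (B * ε) ^ 2 := by gcongr
        _ = 1 / μ * (B ^ 2 * ε) * ε := by ring
        _ ≤ 1 / μ * (μ ^ 2 / 4) * ε := by gcongr
        _ = μ / 4 * ε := by field_simp
    linarith
  have hC : 0 < (1 + B / μ) ^ 2 + (B / μ) ^ 2 := by positivity
  unfold logSlope
  calc μ / 4 / ((1 + B / μ) ^ 2 + (B / μ) ^ 2) / ε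
      = μ / 4 * ε / (((1 + B / μ) ^ 2 + (B / μ) ^ 2) * ε ^ 2) := by field_simp
    _ ≤ μ / 4 * ε / quad a r x η := by gcongr
    _ ≤ _ := by gcongr

/-- Near a peak where `√quad` behaves like the `k`-th power of the distance at the critical
parameter, the logarithmic slope oscillates so much that its `L^p` distance to constants, weighted
by a power of `quad`, is bounded below by a power of `1 - μ * η`. -/
theorem exists_le_integral_abs_logSlope {z : ℝ} (hz : z ∈ peaks a r μ) {k p θ : ℝ} (hk : 0 < k)
    (hp : 0 ≤ p)
    (hup : ∃ B, 0 < B ∧ ∀ᶠ x in 𝓝 z, μ - a x ≤ B * |x - z| ^ k ∧ |r x| ≤ B * |x - z| ^ k)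
    (hlow : ∃ c, 0 < c ∧ ∀ᶠ x in 𝓝 z, ∀ η ∈ Ico (1 / (2 * μ)) (1 / μ),
      c * |x - z| ^ k ≤ √(quad a r x η)) :
    ∃ c, 0 < c ∧ ∀ᶠ η in 𝓝[<] (1 / μ), ∀ b : ℝ,
      c * (1 - μ * η) ^ (-p + 2 * θ + 1 / k) ≤
        ∫ x in (0 : ℝ)..1, |logSlope a r x η + b| ^ p * quad a r x η ^ θ := by
  have hμ := h.pos
  obtain ⟨M, hM, haM, hrM⟩ := h.exists_bound
  obtain ⟨_, _, hb1, -, hev1⟩ := h.eventually_sub_bounds hz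
  obtain ⟨B, hB, hev2⟩ := hup
  obtain ⟨b₀, hb₀, hev3⟩ := hlow
  obtain ⟨d, hd, hball⟩ := Metric.eventually_nhds_iff_ball.1 (hev1.and (hev2.and hev3))
  -- `cE / ε` bounds the slope from below on the core interval, where `|x - z| ^ k ≤ ε`.
  set cE := μ / 4 / ((1 + B / μ) ^ 2 + (B / μ) ^ 2) with hcE
  have hcE0 : 0 < cE := by positivity
  -- Where `|x - z| ^ k ≥ K ε`, the bound `|logSlope| √quad ≤ 2 M` and this `K` bring the slope down
  -- to at most `cE / (2 ε)`, half of its core value.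
  set K := max 1 (4 * M / (b₀ * cE)) with hKdef
  have hK1 : 1 ≤ K := le_max_left _ _
  set ν := K ^ (1 / k) with hν
  have hν1 : 1 ≤ ν := Real.one_le_rpow hK1 (by positivity)
  have hνk : ν ^ k = K := by
    rw [hν, ← Real.rpow_mul (by positivity), one_div_mul_cancel hk.ne', Real.rpow_one]
  set L := 2 ^ k * K with hL
  have hL1 : 1 ≤ L := by
    have : 1 ≤ (2 : ℝ) ^ k := Real.one_le_rpow one_le_two hk.le
    nlinarith
  set C := (1 + B * L / μ) ^ 2 + (B * L / μ) ^ 2 with hC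
  have hC0 : 0 < C := by positivity
  set m := (cE / 4) ^ p * min 1 (C ^ θ) with hm
  have hm0 : 0 < m := by positivity
  refine ⟨m, hm0, ?_⟩
  -- The next three conditions say that `η` is close enough to critical for `le_logSlope` to apply
  -- and for both test intervals to fit in the neighbourhood of `z` and in one period.
  have hT := tendsto_one_sub_mul hμ
  have hT0 := hT.mono_right nhdsWithin_le_nhds
  have hE1 : ∀ᶠ η in 𝓝[<] (1 / μ), B * (1 - μ * η) ≤ μ / 2 := by
    have := (hT0.const_mul B)
    rw [mul_zero] at this
    exact this.eventually_le_const (by positivity)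
  have hE2 : ∀ᶠ η in 𝓝[<] (1 / μ), B ^ 2 * (1 - μ * η) ≤ μ ^ 2 / 4 := by
    have := (hT0.const_mul (B ^ 2))
    rw [mul_zero] at this
    exact this.eventually_le_const (by positivity)
  have hE3 : ∀ᶠ η in 𝓝[<] (1 / μ), 2 * ν * (1 - μ * η) ^ (1 / k) < min d 1 := by
    have h1 := hT0.rpow_const (p := 1 / k) (Or.inr (by positivity))
    rw [Real.zero_rpow (by positivity)] at h1
    have := (h1.const_mul (2 * ν))
    rw [mul_zero] at this
    exact this.eventually_lt_const (by positivity)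
  filter_upwards [hE1, hE2, hE3, hT self_mem_nhdsWithin, Ico_mem_nhdsLT_one_div hμ]
    with η h1 h2 h3 hε hη b
  have hε0 : 0 < 1 - μ * η := hε
  have hη0 : 0 ≤ η := le_trans (by positivity) hη.1
  clear hE1 hE2 hE3 hε
  set ε := 1 - μ * η with hεdef
  set ℓ := ε ^ (1 / k) with hℓ
  have hℓ0 : 0 < ℓ := by positivity
  have hℓk : ℓ ^ k = ε := by
    rw [hℓ, ← Real.rpow_mul hε0.le, one_div_mul_cancel hk.ne', Real.rpow_one]
  have hνℓ : ℓ ≤ ν * ℓ := by nlinarith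
  have h3d : 2 * ν * ℓ < d := h3.trans_le (min_le_left _ _)
  have h31 : 2 * ν * ℓ < 1 := h3.trans_le (min_le_right _ _)
  have hnear : ∀ x ∈ Icc z (z + 2 * ν * ℓ), 0 ≤ μ - a x ∧ μ - a x ≤ B * |x - z| ^ k ∧
      |r x| ≤ B * |x - z| ^ k ∧ b₀ * |x - z| ^ k ≤ √(quad a r x η) := by
    intro x hx
    have hxd : x ∈ Metric.ball z d := by
      rw [Metric.mem_ball, Real.dist_eq, abs_lt]
      constructor <;> linarith [hx.1, hx.2]
    obtain ⟨q1, q2, q3⟩ := hball x hxd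
    refine ⟨le_trans (by positivity) q1.1, q2.1, q2.2, q3 η hη⟩
  have hpow : ∀ x ∈ Icc z (z + 2 * ν * ℓ), |x - z| ^ k ≤ L * ε := by
    intro x hx
    rw [abs_of_nonneg (by linarith [hx.1])]
    calc (x - z) ^ k ≤ (2 * ν * ℓ) ^ k := by
          have : 0 ≤ x - z := by linarith [hx.1]
          gcongr
          linarith [hx.2]
      _ = L * ε := by
        rw [Real.mul_rpow (by positivity) hℓ0.le, Real.mul_rpow (by norm_num) (by positivity),
          hνk, hℓk]
  have hquad : ∀ x ∈ Icc z (z + 2 * ν * ℓ), min 1 (C ^ θ) * ε ^ (2 * θ) ≤ quad a r x η ^ θ := by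
    intro x hx
    obtain ⟨q1, q2, q3, -⟩ := hnear x hx
    obtain ⟨-, q4, q5⟩ := sq_le_quad_and_quad_le hμ (K := L) hη0 hη.2 q1
      (q2.trans (by gcongr; exact hpow x hx)) (q3.trans (by gcongr; exact hpow x hx))
    exact min_one_rpow_mul_le hε0 hC0 q4 q5
  set f : ℝ → ℝ := fun x => |logSlope a r x η + b| ^ p * quad a r x η ^ θ with hf
  have hfc : Continuous f := by
    refine Continuous.mul ?_ (h.continuous_quad_rpow hη0 hη.2 θ)
    exact (((h.continuous_logSlope hη0 hη.2).add continuous_const).abs).rpow_const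
      fun x => Or.inr hp
  have hfp : Function.Periodic f 1 := fun x => by
    have e1 := quad_periodic h.periodic_a h.periodic_r η x
    have e2 := logSlope_periodic h.periodic_a h.periodic_r η x
    simp only at e1 e2
    simp only [hf, e1, e2]
  have hf0 : ∀ x, 0 ≤ f x := fun x =>
    mul_nonneg (by positivity) (Real.rpow_nonneg (quad_nonneg _ _ _ _) _)
  have hfx : ∀ x ∈ Icc z (z + 2 * ν * ℓ), cE / 4 / ε ≤ |logSlope a r x η + b| →
      m * ε ^ (-p + 2 * θ) ≤ f x := by
    intro x hx hle
    calc m * ε ^ (-p + 2 * θ) = (cE / 4 / ε) ^ p * (min 1 (C ^ θ) * ε ^ (2 * θ)) := by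
          rw [Real.rpow_add hε0, Real.div_rpow (by positivity) hε0.le, Real.rpow_neg hε0.le, hm]
          ring
      _ ≤ f x := by
        have hq := hquad x hx
        simp only [hf]
        gcongr
  have hfin : m * ε ^ (-p + 2 * θ + 1 / k) = m * ε ^ (-p + 2 * θ) * ℓ := by
    rw [Real.rpow_add hε0, ← hℓ]; ring
  rw [hfin]
  -- The slope is at least `cE / ε` on `[z, z + ℓ]` and at most `cE / (2 ε)` on `[z + ν ℓ, z + 2 ν
  -- ℓ]`. Splitting at the midpoint `3 cE / (4 ε)`, any `b` leaves `|logSlope + b| ≥ cE / (4 ε)` on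
  -- one of the two, and both have length at least `ℓ = ε ^ (1 / k)`.
  rcases le_or_gt (-(3 * cE / 4 / ε)) b with hb | hb
  · have := mul_sub_le_integral_of_periodic hfc hfp hf0 (z := z) (x := z) (y := z + ℓ)
      (m := m * ε ^ (-p + 2 * θ)) le_rfl (by linarith) (by linarith) (fun x hx => by
        have hx' : x ∈ Icc z (z + 2 * ν * ℓ) := ⟨hx.1, by linarith [hx.2]⟩
        refine hfx x hx' (le_trans ?_ (le_abs_self _))
        obtain ⟨q1, q2, q3, -⟩ := hnear x hx'
        have hxk : |x - z| ^ k ≤ ε := by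
          rw [abs_of_nonneg (by linarith [hx.1]), ← hℓk]
          have : 0 ≤ x - z := by linarith [hx.1]
          gcongr
          linarith [hx.2]
        have hslope := h.le_logSlope hB hη0 hη.2 q1 (q2.trans (by gcongr)) (q3.trans (by gcongr))
          h1 h2
        rw [← hcE, ← hεdef] at hslope
        have e : cE / 4 / ε = cE / ε - 3 * cE / 4 / ε := by ring
        linarith)
    simpa using this
  · have := mul_sub_le_integral_of_periodic hfc hfp hf0 (z := z) (x := z + ν * ℓ)
      (y := z + 2 * ν * ℓ)
      (m := m * ε ^ (-p + 2 * θ)) (by linarith) (by linarith) (by linarith) (fun x hx => by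
        have hx' : x ∈ Icc z (z + 2 * ν * ℓ) := ⟨by linarith [hx.1], hx.2⟩
        refine hfx x hx' (le_trans ?_ (neg_le_abs _))
        obtain ⟨-, -, -, q4⟩ := hnear x hx'
        have hxk : K * ε ≤ |x - z| ^ k := by
          rw [abs_of_nonneg (by linarith [hx.1]), ← hℓk, ← hνk,
            ← Real.mul_rpow (by positivity) hℓ0.le]
          gcongr
          linarith [hx.1]
        have hs : b₀ * (K * ε) ≤ √(quad a r x η) := le_trans (by gcongr) q4
        have hj : logSlope a r x η * (b₀ * (K * ε)) ≤ 2 * M :=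
          calc _ ≤ |logSlope a r x η| * (b₀ * (K * ε)) := by
                gcongr; exact le_abs_self _
            _ ≤ |logSlope a r x η| * √(quad a r x η) := by gcongr
            _ ≤ 2 * M := abs_logSlope_mul_sqrt_le haM hrM x η
        have hK2 : 4 * M ≤ K * (b₀ * cE) := by
          rw [← div_le_iff₀ (by positivity)]; exact le_max_right _ _
        have hj' : logSlope a r x η ≤ cE / 2 / ε := by
          rw [le_div_iff₀ hε0]
          have hbK : 0 < b₀ * K := by positivity
          have : (logSlope a r x η * ε) * (b₀ * K) ≤ cE / 2 * (b₀ * K) := by linarith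
          exact le_of_mul_le_mul_right this hbK
        have e : cE / 4 / ε = 3 * cE / 4 / ε - cE / 2 / ε := by ring
        linarith)
    refine le_trans ?_ this
    have : 0 < m * ε ^ (-p + 2 * θ) := by positivity
    gcongr
    linarith

end IsProfile

theorem tendsto_rpow_nhdsGT_zero_atTop {e : ℝ} (he : e < 0) :
    Tendsto (fun x : ℝ => x ^ e) (𝓝[>] 0) atTop := by
  have h1 := (tendsto_rpow_atTop (neg_pos.2 he)).comp tendsto_inv_nhdsGT_zero
  refine h1.congr' ?_
  filter_upwards [self_mem_nhdsWithin] with x hx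
  have hx' : (0 : ℝ) < x := hx
  simp [Real.inv_rpow hx'.le, Real.rpow_neg hx'.le]

/-! ### Mass and clock up to the critical parameter; finiteness of the blowup time. -/

namespace IsProfile

variable {a r : ℝ → ℝ} {lam μ : ℝ} (h : IsProfile a r μ)
include h

theorem exists_notMem_peaks : ∃ x ∈ Icc (0 : ℝ) 1, x ∉ peaks a r μ := by
  by_contra! hc
  exact (Icc_infinite (zero_lt_one' ℝ)) (h.finite_peaks.subset hc)

theorem mass_pos {η : ℝ} (h0 : 0 ≤ η) (h1 : η < 1 / μ) : 0 < mass lam a r η :=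
  mass_pos_of_quad_pos h.smooth_a.continuous h.smooth_r.continuous fun α => h.quad_pos α h0 h1

/-- For negative `lam` the exponent `-(2 * lam)⁻¹` is positive, so zeros of `quad` do no harm. -/
theorem continuous_mass (hlam : lam < 0) : Continuous (mass lam a r) := by
  have ha := h.smooth_a.continuous
  have hr := h.smooth_r.continuous
  refine intervalIntegral.continuous_parametric_intervalIntegral_of_continuous' (μ := volume)
    (f := fun η α => quad a r α η ^ (-(2 * lam)⁻¹)) ?_ 0 1
  have : Continuous (fun w : ℝ × ℝ => quad a r w.2 w.1) := by unfold quad; fun_prop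
  refine this.rpow_const fun w => Or.inr ?_
  rw [neg_nonneg, inv_nonpos]; linarith

theorem mass_pos_max (hlam : lam < 0) : 0 < mass lam a r (1 / μ) := by
  have ha := h.smooth_a.continuous
  have hr := h.smooth_r.continuous
  obtain ⟨x, hx, hxp⟩ := h.exists_notMem_peaks
  refine intervalIntegral.integral_pos one_pos ?_
    (fun y _ => Real.rpow_nonneg (quad_nonneg _ _ _ _) _)
    ⟨x, hx, Real.rpow_pos_of_pos (h.quad_pos_max hx hxp) _⟩
  have : Continuous (fun y : ℝ => quad a r y (1 / μ)) := by unfold quad; fun_prop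
  refine (this.rpow_const fun w => Or.inr ?_).continuousOn
  rw [neg_nonneg, inv_nonpos]; linarith

theorem one_sub_mul_mem {η : ℝ} (hη : η ∈ Ico (1 / (2 * μ)) (1 / μ)) :
    0 < 1 - μ * η ∧ 1 - μ * η ≤ 1 := by
  have hμ := h.pos
  have h1 := hη.2
  rw [lt_div_iff₀ hμ] at h1
  have : 0 ≤ η := le_trans (by positivity) hη.1
  constructor <;> nlinarith

/-- The integrand is `√quad ^ (-1 / lam)`. The interpolated bound leaves `|x - z| ^ (-2 δ / lam)`,
integrable because `δ < lam / 2`. -/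
theorem exists_mass_le (hlam : 1 < lam) {δ : ℝ} (h0 : 0 ≤ δ) (h1 : δ ≤ 1) (h2 : δ < lam / 2) :
    ∃ C, 0 < C ∧ ∀ η ∈ Ico (1 / (2 * μ)) (1 / μ),
      mass lam a r η ≤ C * (1 - μ * η) ^ (-((1 - δ) / lam)) := by
  obtain ⟨C, hC, hle⟩ := h.exists_integral_quad_rpow_le (φ := fun η => (1 - μ * η) ^ (1 - δ))
    (k := 2 * δ) (s := lam⁻¹) (by positivity) (by positivity)
    (by rw [← div_eq_mul_inv, div_lt_one (by linarith)]; linarith)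
    (fun η hη => ⟨Real.rpow_pos_of_pos (h.one_sub_mul_mem hη).1 _,
      Real.rpow_le_one (h.one_sub_mul_mem hη).1.le (h.one_sub_mul_mem hη).2 (by linarith)⟩)
    (fun z hz => h.exists_mul_rpow_le_sqrt_quad_of_peak hz h0 h1)
  refine ⟨C, hC, fun η hη => ?_⟩
  have := hle η hη
  rw [← Real.rpow_mul (h.one_sub_mul_mem hη).1.le] at this
  convert this using 1
  · unfold mass
    rw [mul_inv, mul_comm, ← div_eq_mul_inv]
  · ring_nf

theorem exists_mass_le_of_deriv_ne_zero (hlam : 1 < lam)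
    (hflat : ∀ z ∈ peaks a r μ, deriv r z ≠ 0) :
    ∃ C, 0 < C ∧ ∀ η ∈ Ico (1 / (2 * μ)) (1 / μ), mass lam a r η ≤ C := by
  obtain ⟨C, hC, hle⟩ := h.exists_integral_quad_rpow_le (φ := fun _ => 1)
    (k := 1) (s := lam⁻¹) (by positivity) (by positivity)
    (by rw [one_mul]; exact inv_lt_one_of_one_lt₀ hlam)
    (fun η hη => ⟨one_pos, le_rfl⟩)
    (fun z hz => h.exists_mul_rpow_le_sqrt_quad_of_deriv_ne_zero hz (hflat z hz))
  refine ⟨C, hC, fun η hη => ?_⟩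
  have := hle η hη
  simp only [Real.one_rpow, mul_one] at this
  convert this using 1
  unfold mass
  rw [mul_inv, mul_comm, ← div_eq_mul_inv]

theorem continuousOn_mass : ContinuousOn (mass lam a r) (Ico 0 (1 / μ)) := by
  obtain ⟨e, he, hq⟩ := h.exists_quad_pos
  refine (contDiffOn_mass h.smooth_a h.smooth_r isOpen_Ioo
    (fun α η hη => hq α η hη)).continuousOn.mono fun η hη => ⟨by linarith [hη.1], hη.2⟩

theorem hasDerivAt_clock {η : ℝ} (h0 : 0 ≤ η) (h1 : η < 1 / μ) :
    HasDerivAt (clock lam a r) (mass lam a r η ^ (2 * lam)) η := by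
  have hμ := h.pos
  obtain ⟨e, he, hq⟩ := h.exists_quad_pos
  exact GenHunterSaxton.hasDerivAt_clock h.smooth_a h.smooth_r isOpen_Ioo ordConnected_Ioo
    (⟨by linarith, by positivity⟩ : (0 : ℝ) ∈ Ioo (-e) (1 / μ)) (fun α η hη => hq α η hη)
    ⟨by linarith, h1⟩

theorem intervalIntegrable_mass_rpow (hlam : lam < 0 ∨ 1 < lam) :
    IntervalIntegrable (fun η => mass lam a r η ^ (2 * lam)) volume 0 (1 / μ) := by
  have hμ := h.pos
  have h12 : 1 / (2 * μ) < 1 / μ := by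
    rw [div_lt_div_iff₀ (by positivity) hμ]; linarith
  have h02 : 0 < 1 / (2 * μ) := by positivity
  have hc : ContinuousOn (fun η => mass lam a r η ^ (2 * lam)) (Ico 0 (1 / μ)) :=
    h.continuousOn_mass.rpow_const fun η hη => Or.inl (h.mass_pos hη.1 hη.2).ne'
  rcases hlam with hlam | hlam
  · refine ContinuousOn.intervalIntegrable ?_
    rw [uIcc_of_le (by positivity)]
    refine (h.continuous_mass hlam).continuousOn.rpow_const fun η hη => Or.inl ?_
    rcases hη.2.eq_or_lt with e | hlt
    · rw [e]; exact (h.mass_pos_max hlam).ne'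
    · exact (h.mass_pos hη.1 hlt).ne'
  · refine IntervalIntegrable.trans (b := 1 / (2 * μ)) ?_ ?_
    · refine ContinuousOn.intervalIntegrable ?_
      rw [uIcc_of_le h02.le]
      exact hc.mono fun η hη => ⟨hη.1, hη.2.trans_lt h12⟩
    -- `(1 + lam) / 4` is the midpoint of `1 / 2` and `lam / 2`. One needs `δ < lam / 2` for the
    -- bound on `mass` and `δ > 1 / 2` for integrability of `(1 - μ η) ^ (-2 (1 - δ))`; both are
    -- possible precisely because `lam > 1`.
    · obtain ⟨C, hC, hle⟩ := h.exists_mass_le hlam (δ := min 1 ((1 + lam) / 4))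
        (le_min zero_le_one (by linarith)) (min_le_left _ _)
        ((min_le_right _ _).trans_lt (by linarith))
      set δ := min 1 ((1 + lam) / 4) with hδ
      have hδ2 : 1 / 2 < δ := lt_min (by norm_num) (by linarith)
      have hI : IntervalIntegrable (fun η => C ^ (2 * lam) * μ ^ (-(2 * (1 - δ))) *
          |η - 1 / μ| ^ (-(2 * (1 - δ)))) volume (1 / (2 * μ)) (1 / μ) :=
        (intervalIntegrable_abs_sub_rpow (by linarith) _ _ _).const_mul _
      rw [intervalIntegrable_iff_integrableOn_Ico_of_le h12.le] at hI ⊢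
      refine hI.mono' ((hc.mono (Ico_subset_Ico_left h02.le)).aestronglyMeasurable
        measurableSet_Ico) ?_
      rw [ae_restrict_iff' measurableSet_Ico]
      refine Eventually.of_forall fun η hη => ?_
      have hm := h.mass_pos (lam := lam) (h02.le.trans hη.1) hη.2
      have hε := (h.one_sub_mul_mem hη).1
      rw [Real.norm_of_nonneg (by positivity)]
      have e1 : |η - 1 / μ| = (1 - μ * η) / μ := by
        rw [abs_of_neg (by linarith [hη.2])]; field_simp; ring
      calc mass lam a r η ^ (2 * lam)
          ≤ (C * (1 - μ * η) ^ (-((1 - δ) / lam))) ^ (2 * lam) := by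
            have := hle η hη
            gcongr
        _ = C ^ (2 * lam) * (1 - μ * η) ^ (-(2 * (1 - δ))) := by
          rw [Real.mul_rpow hC.le (by positivity), ← Real.rpow_mul hε.le]
          congr 2
          field_simp
        _ = _ := by
          rw [e1, Real.div_rpow hε.le hμ.le]
          field_simp

theorem continuousOn_clock (hlam : lam < 0 ∨ 1 < lam) :
    ContinuousOn (clock lam a r) (Icc 0 (1 / μ)) := by
  have hμ := h.pos
  have := intervalIntegral.continuousOn_primitive_interval'
    (h.intervalIntegrable_mass_rpow hlam) (a := 0) left_mem_uIcc
  rwa [uIcc_of_le (by positivity)] at this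

theorem strictMonoOn_clock (hlam : lam < 0 ∨ 1 < lam) :
    StrictMonoOn (clock lam a r) (Icc 0 (1 / μ)) := by
  refine strictMonoOn_of_deriv_pos (convex_Icc _ _) (h.continuousOn_clock hlam) fun η hη => ?_
  rw [interior_Icc] at hη
  rw [(h.hasDerivAt_clock hη.1.le hη.2).deriv]
  exact Real.rpow_pos_of_pos (h.mass_pos hη.1.le hη.2) _

theorem clock_max_pos (hlam : lam < 0 ∨ 1 < lam) : 0 < clock lam a r (1 / μ) := by
  have hμ := h.pos
  have hp : 0 < 1 / μ := by positivity
  have := h.strictMonoOn_clock hlam ⟨le_rfl, hp.le⟩ ⟨hp.le, le_rfl⟩ hp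
  simpa using this

/-- Limits as `η → 1 / μ` are limits as physical time tends to the blowup time. -/
theorem tendsto_of_clock {X : Type*} (hlam : lam < 0 ∨ 1 < lam) {N F : ℝ → X} {l : Filter X}
    (hF : Tendsto F (𝓝[<] (1 / μ)) l)
    (hN : ∀ t ∈ Ioo 0 (clock lam a r (1 / μ)), ∃ η ∈ Ioo 0 (1 / μ),
      clock lam a r η = t ∧ N t = F η) :
    Tendsto N (𝓝[<] (clock lam a r (1 / μ))) l := by
  have hμ := h.pos
  have hp : 0 < 1 / μ := by positivity
  intro s hs
  obtain ⟨η₀, hη₀, hsub⟩ := (mem_nhdsLT_iff_exists_Ioo_subset' hp).1 (hF hs)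
  set η₁ := max η₀ 0 with hη₁
  have h1 : η₁ ∈ Icc 0 (1 / μ) := ⟨le_max_right _ _, max_le (le_of_lt hη₀) hp.le⟩
  have h1lt : η₁ < 1 / μ := max_lt hη₀ hp
  have hmono := h.strictMonoOn_clock hlam
  have hlt := hmono h1 ⟨hp.le, le_rfl⟩ h1lt
  rw [mem_map]
  filter_upwards [Ioo_mem_nhdsLT hlt] with t ht
  have h0t : 0 < t := by
    refine lt_of_le_of_lt ?_ ht.1
    have := hmono.monotoneOn ⟨le_rfl, hp.le⟩ h1 h1.1
    simpa using this
  obtain ⟨η, hη, hηt, hNF⟩ := hN t ⟨h0t, ht.2⟩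
  show N t ∈ s
  rw [hNF]
  refine hsub ⟨lt_of_le_of_lt (le_max_left η₀ 0) ?_, hη.2⟩
  by_contra! hle
  have := hmono.monotoneOn ⟨hη.1.le, hη.2.le⟩ h1 hle
  rw [hηt] at this
  exact absurd ht.1 (not_lt.2 this)

end IsProfile

/-! ### Moments of `u_x` and their blowup. -/

/-- `u_x` along the flow, up to the additive constant `b`. -/
noncomputable def strain (lam : ℝ) (a r : ℝ → ℝ) (b α η : ℝ) : ℝ :=
  mass lam a r η ^ (-(2 * lam)) * (logSlope a r α η / lam + b)

/-- The additive constant for which `strain` has mean zero with respect to `jac`. -/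
noncomputable def strainShift (lam : ℝ) (a r : ℝ → ℝ) (η : ℝ) : ℝ :=
  -∫ α in (0 : ℝ)..1, logSlope a r α η / lam * jac lam a r α η

/-- The integral of `|u_x| ^ p` over a period, as a function of `η`. -/
noncomputable def moment (lam : ℝ) (a r : ℝ → ℝ) (p η : ℝ) : ℝ :=
  ∫ α in (0 : ℝ)..1, |strain lam a r (strainShift lam a r η) α η| ^ p * jac lam a r α η

theorem moment_eq {lam : ℝ} {a r : ℝ → ℝ} {p η : ℝ} (hm : 0 < mass lam a r η) :
    moment lam a r p η = mass lam a r η ^ (-(2 * lam * p + 1)) *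
      ∫ α in (0 : ℝ)..1, |logSlope a r α η / lam + strainShift lam a r η| ^ p *
        quad a r α η ^ (-(2 * lam)⁻¹) := by
  unfold moment
  rw [← intervalIntegral.integral_const_mul]
  congr 1
  ext α
  unfold strain jac
  rw [abs_mul, abs_of_pos (Real.rpow_pos_of_pos hm _), Real.mul_rpow (by positivity) (abs_nonneg _),
    ← Real.rpow_mul hm.le, neg_add, Real.rpow_add hm, Real.rpow_neg_one]
  ring_nf

theorem integral_abs_div_add_rpow {lam : ℝ} (hlam : lam ≠ 0) (f w : ℝ → ℝ) (p b : ℝ) :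
    ∫ α in (0 : ℝ)..1, |f α / lam + b| ^ p * w α =
      |lam| ^ (-p) * ∫ α in (0 : ℝ)..1, |f α + lam * b| ^ p * w α := by
  rw [← intervalIntegral.integral_const_mul]
  congr 1
  ext α
  have : f α / lam + b = (f α + lam * b) / lam := by field_simp
  rw [this, abs_div, Real.div_rpow (abs_nonneg _) (abs_nonneg _), Real.rpow_neg (abs_nonneg _)]
  ring

namespace IsProfile

variable {a r : ℝ → ℝ} {lam μ : ℝ} (h : IsProfile a r μ)
include h

/-- The weight `quad ^ θ` comes from `jac`, so `θ = -(2 * lam)⁻¹`, and `2 θ` contributes `-lam⁻¹` to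
the exponent. The unknown shift is absorbed by the uniformity in `b` of
`exists_le_integral_abs_logSlope`. -/
theorem exists_le_moment {z : ℝ} (hz : z ∈ peaks a r μ) {k p : ℝ} (hk : 0 < k)
    (hlam : lam ≠ 0) (hp : 0 ≤ p)
    (hup : ∃ B, 0 < B ∧ ∀ᶠ x in 𝓝 z, μ - a x ≤ B * |x - z| ^ k ∧ |r x| ≤ B * |x - z| ^ k)
    (hlow : ∃ c, 0 < c ∧ ∀ᶠ x in 𝓝 z, ∀ η ∈ Ico (1 / (2 * μ)) (1 / μ),
      c * |x - z| ^ k ≤ √(quad a r x η)) :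
    ∃ c, 0 < c ∧ ∀ᶠ η in 𝓝[<] (1 / μ),
      mass lam a r η ^ (-(2 * lam * p + 1)) * (c * (1 - μ * η) ^ (-p - lam⁻¹ + 1 / k)) ≤
        moment lam a r p η := by
  have hμ := h.pos
  obtain ⟨c, hc, hev⟩ := h.exists_le_integral_abs_logSlope hz (p := p) (θ := -(2 * lam)⁻¹) hk hp
    hup hlow
  have hl : 0 < |lam| := abs_pos.2 hlam
  refine ⟨|lam| ^ (-p) * c, by positivity, ?_⟩
  filter_upwards [hev, Ico_mem_nhdsLT_one_div hμ] with η hη hη'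
  have hm := h.mass_pos (lam := lam) (le_trans (by positivity) hη'.1) hη'.2
  rw [moment_eq hm, integral_abs_div_add_rpow hlam (fun α => logSlope a r α η)]
  have := hη (lam * strainShift lam a r η)
  have e : -p + 2 * -(2 * lam)⁻¹ + 1 / k = -p - lam⁻¹ + 1 / k := by
    rw [mul_inv]; ring
  rw [e] at this
  refine mul_le_mul_of_nonneg_left ?_ (Real.rpow_pos_of_pos hm _).le
  rw [mul_assoc]
  exact mul_le_mul_of_nonneg_left this (by positivity)

/-- The flat case `k = 2`: by Taylor expansion both `μ - a` and `r` are quadratically small. -/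
theorem eventually_le_of_deriv_eq_zero {z : ℝ} (hz : z ∈ peaks a r μ) (hz' : deriv r z = 0) :
    ∃ B, 0 < B ∧ ∀ᶠ x in 𝓝 z,
      μ - a x ≤ B * |x - z| ^ (2 : ℝ) ∧ |r x| ≤ B * |x - z| ^ (2 : ℝ) := by
  obtain ⟨b, B, -, hB, hev⟩ := h.eventually_sub_bounds hz
  refine ⟨B + |deriv (deriv r) z / 2| + 1, by positivity, ?_⟩
  filter_upwards [hev, eventually_abs_sub_le_of_deriv_eq_zero h.smooth_r hz' one_pos] with x h1 h2
  rw [hz.2.1, sub_zero] at h2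
  have e : |x - z| ^ (2 : ℝ) = (x - z) ^ 2 := by
    rw [Real.rpow_two, sq_abs]
  rw [e]
  have hsq := sq_nonneg (x - z)
  constructor
  · nlinarith [h1.2, abs_nonneg (deriv (deriv r) z / 2)]
  · have h3 : |r x| ≤ |r x - deriv (deriv r) z / 2 * (x - z) ^ 2| +
        |deriv (deriv r) z / 2 * (x - z) ^ 2| := by
      have := abs_add_le (r x - deriv (deriv r) z / 2 * (x - z) ^ 2)
        (deriv (deriv r) z / 2 * (x - z) ^ 2)
      simpa using this
    rw [abs_mul, abs_of_nonneg hsq] at h3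
    nlinarith

theorem eventually_le_of_peak {z : ℝ} (hz : z ∈ peaks a r μ) :
    ∃ B, 0 < B ∧ ∀ᶠ x in 𝓝 z,
      μ - a x ≤ B * |x - z| ^ (1 : ℝ) ∧ |r x| ≤ B * |x - z| ^ (1 : ℝ) := by
  obtain ⟨b, B, -, hB, hev⟩ := h.eventually_sub_bounds hz
  have hd : HasDerivAt r (deriv r z) z := (h.smooth_r.differentiable (by simp) z).hasDerivAt
  refine ⟨B + |deriv r z| + 1, by positivity, ?_⟩
  filter_upwards [hev, (hasDerivAt_iff_isLittleO.1 hd).bound one_pos,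
    Metric.ball_mem_nhds z one_pos] with x h1 h2 h3
  rw [hz.2.1, sub_zero, smul_eq_mul, Real.norm_eq_abs, Real.norm_eq_abs] at h2
  rw [Metric.mem_ball, Real.dist_eq] at h3
  rw [Real.rpow_one]
  have hx0 := abs_nonneg (x - z)
  constructor
  · have : (x - z) ^ 2 ≤ |x - z| := by rw [← sq_abs]; nlinarith
    nlinarith [h1.2, mul_nonneg (abs_nonneg (deriv r z)) hx0]
  · have h4 : |r x| ≤ |r x - (x - z) * deriv r z| + |(x - z) * deriv r z| := by
      have := abs_add_le (r x - (x - z) * deriv r z) ((x - z) * deriv r z)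
      simpa using this
    rw [abs_mul (x - z)] at h4
    nlinarith

theorem sqrt_quad_lower_of_peak {z : ℝ} (hz : z ∈ peaks a r μ) :
    ∃ c, 0 < c ∧ ∀ᶠ x in 𝓝 z, ∀ η ∈ Ico (1 / (2 * μ)) (1 / μ),
      c * |x - z| ^ (2 : ℝ) ≤ √(quad a r x η) := by
  simpa using h.exists_mul_rpow_le_sqrt_quad_of_peak hz zero_le_one le_rfl

theorem tendsto_mass_rpow (hlam : lam < 0) (e : ℝ) :
    Tendsto (fun η => mass lam a r η ^ e) (𝓝[<] (1 / μ)) (𝓝 (mass lam a r (1 / μ) ^ e)) :=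
  (((h.continuous_mass hlam).tendsto _).mono_left nhdsWithin_le_nhds).rpow_const
    (Or.inl (h.mass_pos_max hlam).ne')

/-- `L^p` blowup for negative `lam`, when `r` is flat at some peak. -/
theorem tendsto_moment_atTop_of_neg (hlam : lam < 0) {p : ℝ} (hp : 1 < p) (hlp : lam ≤ -2 / p)
    (hflat : ∃ z ∈ peaks a r μ, deriv r z = 0) :
    Tendsto (moment lam a r p) (𝓝[<] (1 / μ)) atTop := by
  obtain ⟨z, hz, hz'⟩ := hflat
  obtain ⟨c, hc, hev⟩ := h.exists_le_moment hz two_pos hlam.ne (zero_le_one.trans hp.le)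
    (h.eventually_le_of_deriv_eq_zero hz hz') (h.sqrt_quad_lower_of_peak hz)
  refine tendsto_atTop_mono' _ hev ?_
  -- The hypothesis `lam ≤ -2 / p` is used as `-1 / lam ≤ p / 2`; the exponent is then at most `(1 -
  -- p) / 2`.
  have he : -p - lam⁻¹ + 1 / 2 < 0 := by
    have h1 : -lam⁻¹ ≤ p / 2 := by
      rw [le_div_iff₀ (by linarith)] at hlp
      rw [← inv_neg, inv_le_comm₀ (by linarith) (by linarith), inv_div, div_le_iff₀ (by linarith)]
      linarith
    linarith
  refine Tendsto.pos_mul_atTop (Real.rpow_pos_of_pos (h.mass_pos_max hlam) _)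
    (h.tendsto_mass_rpow hlam _) (Tendsto.const_mul_atTop hc ?_)
  exact (tendsto_rpow_nhdsGT_zero_atTop he).comp (tendsto_one_sub_mul h.pos)

/-- `mass` enters the moment with the negative power `-(2 * lam * p + 1)`, so growth of `mass`
counts against blowup. The last hypothesis says that the resulting power of `1 - μ η` is still
negative. -/
theorem tendsto_moment_atTop_of_mass_le (hlam : 1 < lam) {p q k : ℝ} (hp : 1 < p) {z : ℝ}
    (hz : z ∈ peaks a r μ) (hk : 0 < k)
    (hup : ∃ B, 0 < B ∧ ∀ᶠ x in 𝓝 z, μ - a x ≤ B * |x - z| ^ k ∧ |r x| ≤ B * |x - z| ^ k)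
    (hlow : ∃ c, 0 < c ∧ ∀ᶠ x in 𝓝 z, ∀ η ∈ Ico (1 / (2 * μ)) (1 / μ),
      c * |x - z| ^ k ≤ √(quad a r x η))
    (hmass : ∃ C, 0 < C ∧ ∀ η ∈ Ico (1 / (2 * μ)) (1 / μ),
      mass lam a r η ≤ C * (1 - μ * η) ^ (-q))
    (he : q * (2 * lam * p + 1) - p - lam⁻¹ + 1 / k < 0) :
    Tendsto (moment lam a r p) (𝓝[<] (1 / μ)) atTop := by
  have hμ := h.pos
  obtain ⟨c, hc, hev⟩ := h.exists_le_moment hz hk (by linarith : lam ≠ 0)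
    (zero_le_one.trans hp.le) hup hlow
  obtain ⟨C, hC, hm⟩ := hmass
  have hlim : Tendsto (fun η => C ^ (-(2 * lam * p + 1)) * c *
      (1 - μ * η) ^ (q * (2 * lam * p + 1) - p - lam⁻¹ + 1 / k)) (𝓝[<] (1 / μ)) atTop :=
    Tendsto.const_mul_atTop (by positivity)
      ((tendsto_rpow_nhdsGT_zero_atTop he).comp (tendsto_one_sub_mul h.pos))
  refine tendsto_atTop_mono' _ ?_ hlim
  filter_upwards [hev, Ico_mem_nhdsLT_one_div hμ] with η hη hη'
  refine le_trans ?_ hη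
  have hmp := h.mass_pos (lam := lam) (le_trans (by positivity) hη'.1) hη'.2
  have hε := (h.one_sub_mul_mem hη').1
  calc _ = (C * (1 - μ * η) ^ (-q)) ^ (-(2 * lam * p + 1)) *
        (c * (1 - μ * η) ^ (-p - lam⁻¹ + 1 / k)) := by
        rw [Real.mul_rpow hC.le (by positivity), ← Real.rpow_mul hε.le,
          show q * (2 * lam * p + 1) - p - lam⁻¹ + 1 / k =
            -q * -(2 * lam * p + 1) + (-p - lam⁻¹ + 1 / k) by ring, Real.rpow_add hε]
        ring
    _ ≤ _ := by
      have : (C * (1 - μ * η) ^ (-q)) ^ (-(2 * lam * p + 1)) ≤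
          mass lam a r η ^ (-(2 * lam * p + 1)) :=
        Real.rpow_le_rpow_of_nonpos hmp (hm η hη') (by nlinarith)
      gcongr

/-- `L^p` blowup for `lam > 1`. -/
theorem tendsto_moment_atTop_of_one_lt (hlam : 1 < lam) {p : ℝ} (hp : 1 < p) :
    Tendsto (moment lam a r p) (𝓝[<] (1 / μ)) atTop := by
  have hl0 : 0 < lam := by linarith
  have hinv : lam⁻¹ < 1 := inv_lt_one_of_one_lt₀ hlam
  have hinv0 : 0 < lam⁻¹ := by positivity
  by_cases hflat : ∃ z ∈ peaks a r μ, deriv r z = 0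
  · obtain ⟨z, hz, hz'⟩ := hflat
    -- For `lam > 2` one may take `δ = 1`, and `mass` is bounded. Otherwise `δ` must stay below `lam
    -- / 2`.
    rcases lt_or_ge 2 lam with h2 | h2
    · refine h.tendsto_moment_atTop_of_mass_le (q := (1 - 1) / lam) hlam hp hz two_pos
        (h.eventually_le_of_deriv_eq_zero hz hz') (h.sqrt_quad_lower_of_peak hz)
        (h.exists_mass_le hlam zero_le_one le_rfl (by linarith)) ?_
      rw [sub_self, zero_div, zero_mul]
      linarith
    -- `x` is the gap `lam / 2 - δ`. At `x = 0` the exponent would be `p (1 - lam) < 0`; this `x` is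
    -- small enough to spend at most half of it.
    · set x := p * (lam - 1) / (2 * (2 * p + 1)) with hx
      have hx0 : 0 < x := by
        have : 0 < lam - 1 := by linarith
        positivity
      have hx1 : x ≤ lam / 2 := by
        rw [hx, div_le_div_iff₀ (by positivity) two_pos]
        nlinarith
      refine h.tendsto_moment_atTop_of_mass_le (q := (1 - (lam / 2 - x)) / lam) hlam hp hz two_pos
        (h.eventually_le_of_deriv_eq_zero hz hz') (h.sqrt_quad_lower_of_peak hz)
        (h.exists_mass_le hlam (by linarith) (by linarith) (by linarith)) ?_
      have e : (1 - (lam / 2 - x)) / lam * (2 * lam * p + 1) - p - lam⁻¹ + 1 / 2 =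
          p * (1 - lam) + x * (2 * p + lam⁻¹) := by
        field_simp; ring
      rw [e]
      have h3 : x * (2 * p + lam⁻¹) ≤ x * (2 * p + 1) := by gcongr
      have h4 : x * (2 * p + 1) = p * (lam - 1) / 2 := by
        rw [hx]; field_simp
      nlinarith
  · push Not at hflat
    obtain ⟨z, hz⟩ := h.nonempty_peaks
    -- With no flat peak, `k = 1` and the linear bound at every peak keeps `mass` bounded, since `1
    -- / lam < 1`.
    refine h.tendsto_moment_atTop_of_mass_le (q := 0) hlam hp hz one_pos
      (h.eventually_le_of_peak hz)
      (by simpa using h.exists_mul_rpow_le_sqrt_quad_of_deriv_ne_zero hz (hflat z hz))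
      (by simpa using h.exists_mass_le_of_deriv_ne_zero hlam hflat) ?_
    rw [zero_mul]
    linarith

/-- Pointwise blowup for negative `lam`. -/
theorem eventually_exists_le_abs_strain (hlam : lam < 0) (R : ℝ) :
    ∀ᶠ η in 𝓝[<] (1 / μ), ∀ b, ∃ α, R ≤ |strain lam a r b α η| := by
  have hμ := h.pos
  obtain ⟨z, hz⟩ := h.nonempty_peaks
  obtain ⟨y, hy, hyp⟩ := h.exists_notMem_peaks
  have ha := h.smooth_a.continuous
  have hr := h.smooth_r.continuous
  have hycont : Tendsto (fun η => logSlope a r y η) (𝓝[<] (1 / μ))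
      (𝓝 (logSlope a r y (1 / μ))) := by
    refine Tendsto.mono_left ?_ nhdsWithin_le_nhds
    unfold logSlope
    refine Tendsto.div (Continuous.tendsto (by fun_prop) _)
      (Continuous.tendsto (by unfold quad; fun_prop) _) (h.quad_pos_max hy hyp).ne'
  have hzlim : Tendsto (fun η => μ * (1 - μ * η) ^ (-1 : ℝ)) (𝓝[<] (1 / μ)) atTop :=
    Tendsto.const_mul_atTop hμ
      ((tendsto_rpow_nhdsGT_zero_atTop (by norm_num)).comp (tendsto_one_sub_mul hμ))
  -- The strain at the peak `z` is compared with that at a label `y` which is not a peak. In the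
  -- difference the constant `b` cancels, and the slope at `z` is exactly `μ / (1 - μ η)`.
  have hdiff := hzlim.atTop_add hycont.neg
  have hlim := Tendsto.pos_mul_atTop (Real.rpow_pos_of_pos (h.mass_pos_max hlam) (-(2 * lam)))
    (h.tendsto_mass_rpow hlam (-(2 * lam))) (hdiff.const_mul_atTop (abs_pos.2 (inv_ne_zero hlam.ne)))
  filter_upwards [hlim.eventually_ge_atTop (2 * R), Ico_mem_nhdsLT_one_div hμ] with η h1 hη b
  have hε := (h.one_sub_mul_mem hη).1
  have hm := h.mass_pos (lam := lam) (le_trans (by positivity) hη.1) hη.2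
  have hzv : logSlope a r z η = μ * (1 - μ * η) ^ (-1 : ℝ) := by
    unfold logSlope quad
    rw [hz.2.1, hz.2.2, Real.rpow_neg_one, mul_comm η μ]
    field_simp
    ring
  by_contra! hcon
  have hz1 := hcon z
  have hy1 := hcon y
  have e : strain lam a r b z η - strain lam a r b y η =
      mass lam a r η ^ (-(2 * lam)) *
        (lam⁻¹ * (μ * (1 - μ * η) ^ (-1 : ℝ) + -logSlope a r y η)) := by
    unfold strain
    rw [hzv]
    ring
  have h2 : 2 * R ≤ |strain lam a r b z η - strain lam a r b y η| := by
    rw [e, abs_mul, abs_mul, abs_of_pos (Real.rpow_pos_of_pos hm _)]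
    refine h1.trans ?_
    gcongr
    exact le_abs_self _
  linarith [abs_sub (strain lam a r b z η) (strain lam a r b y η)]

end IsProfile

/-! ### Convergence of the moments by dominated convergence. -/

theorem tendsto_quad (a r : ℝ → ℝ) (μ x : ℝ) :
    Tendsto (fun η => quad a r x η) (𝓝[<] (1 / μ)) (𝓝 (quad a r x (1 / μ))) := by
  refine Tendsto.mono_left (Continuous.tendsto ?_ _) nhdsWithin_le_nhds
  unfold quad; fun_prop

namespace IsProfile

variable {a r : ℝ → ℝ} {lam μ : ℝ} (h : IsProfile a r μ)
include h

/-- Since `√quad ≥ c |x - z| ^ 2`, a negative power `quad ^ τ` is dominated by `|x - z| ^ (4 τ)`,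
integrable for `τ > -1 / 4`. For `τ ≥ 0` a constant suffices. -/
theorem exists_integrable_bound_quad_rpow {τ : ℝ} (hτ : -(1 / 4) < τ) :
    ∃ D : ℝ → ℝ, IntervalIntegrable D volume 0 1 ∧ ∀ x ∈ Icc (0 : ℝ) 1, x ∉ peaks a r μ →
      ∀ η ∈ Ico (1 / (2 * μ)) (1 / μ), quad a r x η ^ τ ≤ D x := by
  have hμ := h.pos
  rcases lt_or_ge τ 0 with h0 | h0
  · obtain ⟨C, hC, hle⟩ := h.exists_quad_rpow_le (φ := fun _ => 1) (k := 2) (s := -(2 * τ))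
      zero_le_two (by linarith) (fun _ _ => ⟨one_pos, le_rfl⟩)
      (fun z hz => by simpa using h.sqrt_quad_lower_of_peak hz)
    refine ⟨fun x => C * ∑ z ∈ h.finite_peaks.toFinset, |x - z| ^ (-(2 * -(2 * τ))), ?_, ?_⟩
    · have := IntervalIntegrable.sum (μ := volume) (a := 0) (b := 1) h.finite_peaks.toFinset
        (f := fun z x => |x - z| ^ (-(2 * -(2 * τ))))
        (fun z _ => intervalIntegrable_abs_sub_rpow (by linarith) z 0 1)
      refine IntervalIntegrable.const_mul ?_ C
      simpa [Finset.sum_fn] using this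
    · intro x hx hxp η hη
      have := hle x hx hxp η hη
      simp only [Real.one_rpow, mul_one] at this
      convert this using 2
      ring
  · obtain ⟨M, hM, ha, hr⟩ := h.exists_bound
    refine ⟨fun _ => ((1 + 1 / μ * M) ^ 2 + (1 / μ * M) ^ 2) ^ τ, intervalIntegrable_const, ?_⟩
    intro x hx hxp η hη
    have hη0 : 0 ≤ η := le_trans (by positivity) hη.1
    have h1 : |1 - η * a x| ≤ 1 + 1 / μ * M := by
      calc |1 - η * a x| ≤ |1| + |η * a x| := abs_sub _ _
        _ = 1 + η * |a x| := by rw [abs_one, abs_mul, abs_of_nonneg hη0]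
        _ ≤ 1 + 1 / μ * M := by gcongr; exacts [hη.2.le, ha x]
    have h2 : |η * r x| ≤ 1 / μ * M := by
      rw [abs_mul, abs_of_nonneg hη0]
      gcongr; exacts [hη.2.le, hr x]
    refine Real.rpow_le_rpow (quad_nonneg _ _ _ _) ?_ h0
    unfold quad
    rw [← sq_abs (1 - η * a x), ← sq_abs (η * r x)]
    gcongr

/-- Each power of the slope costs half a power of `quad`. -/
theorem exists_abs_logSlope_rpow_mul_le : ∃ M, 0 < M ∧ ∀ x η q θ : ℝ, 0 ≤ q → 0 ≤ η → η < 1 / μ →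
    |logSlope a r x η| ^ q * quad a r x η ^ θ ≤ M ^ q * quad a r x η ^ (θ - q / 2) := by
  obtain ⟨M, hM, ha, hr⟩ := h.exists_bound
  refine ⟨2 * M, by positivity, fun x η q θ hq h0 h1 => ?_⟩
  have hQ := h.quad_pos x h0 h1
  have h2 : |logSlope a r x η| ≤ 2 * M * quad a r x η ^ (-(1 / 2) : ℝ) := by
    rw [Real.rpow_neg hQ.le, ← Real.sqrt_eq_rpow, ← div_eq_mul_inv, le_div_iff₀ (Real.sqrt_pos.2 hQ)]
    exact abs_logSlope_mul_sqrt_le ha hr x η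
  calc _ ≤ (2 * M * quad a r x η ^ (-(1 / 2) : ℝ)) ^ q * quad a r x η ^ θ := by gcongr
    _ = _ := by
      rw [Real.mul_rpow (by positivity) (by positivity), ← Real.rpow_mul hQ.le, mul_assoc,
        ← Real.rpow_add hQ]
      ring_nf

theorem tendsto_logSlope {x : ℝ} (hx : x ∈ Icc (0 : ℝ) 1) (hxp : x ∉ peaks a r μ) :
    Tendsto (fun η => logSlope a r x η) (𝓝[<] (1 / μ)) (𝓝 (logSlope a r x (1 / μ))) := by
  refine Tendsto.div ?_ (tendsto_quad a r μ x) (h.quad_pos_max hx hxp).ne'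
  exact (Continuous.tendsto (by fun_prop) _).mono_left nhdsWithin_le_nhds

theorem tendsto_integral_of_le {f g : ℝ → ℝ → ℝ} {D : ℝ → ℝ}
    (hf : ∀ η ∈ Ico (1 / (2 * μ)) (1 / μ), Continuous (f η))
    (hD : IntervalIntegrable D volume 0 1)
    (hle : ∀ᶠ η in 𝓝[<] (1 / μ), ∀ x ∈ Icc (0 : ℝ) 1, x ∉ peaks a r μ → |f η x| ≤ D x)
    (hlim : ∀ x ∈ Icc (0 : ℝ) 1, x ∉ peaks a r μ →
      Tendsto (fun η => f η x) (𝓝[<] (1 / μ)) (𝓝 (g (1 / μ) x))) :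
    Tendsto (fun η => ∫ x in (0 : ℝ)..1, f η x) (𝓝[<] (1 / μ))
      (𝓝 (∫ x in (0 : ℝ)..1, g (1 / μ) x)) := by
  refine intervalIntegral.tendsto_integral_filter_of_dominated_convergence D ?_ ?_ hD ?_
  · filter_upwards [Ico_mem_nhdsLT_one_div h.pos] with η hη
    exact (hf η hη).aestronglyMeasurable
  · filter_upwards [hle] with η hη
    filter_upwards [h.ae_notMem_peaks] with x hx hx'
    rw [uIoc_of_le zero_le_one] at hx'
    exact hη x (Ioc_subset_Icc_self hx') hx
  · filter_upwards [h.ae_notMem_peaks] with x hx hx'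
    rw [uIoc_of_le zero_le_one] at hx'
    exact hlim x (Ioc_subset_Icc_self hx') hx

/-- The shift is a mean of the slope, so the case `q = 1` of the slope estimate supplies a majorant.
-/
theorem tendsto_strainShift (hlam : lam < 0) (hτ : -(1 / 4) < -(2 * lam)⁻¹ - 1 / 2) :
    ∃ b, Tendsto (strainShift lam a r) (𝓝[<] (1 / μ)) (𝓝 b) := by
  have hμ := h.pos
  obtain ⟨D, hD, hDle⟩ := h.exists_integrable_bound_quad_rpow hτ
  obtain ⟨M, hM, hMle⟩ := h.exists_abs_logSlope_rpow_mul_le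
  have key := h.tendsto_integral_of_le
    (f := fun η x => logSlope a r x η / lam * quad a r x η ^ (-(2 * lam)⁻¹))
    (g := fun η x => logSlope a r x η / lam * quad a r x η ^ (-(2 * lam)⁻¹))
    (D := fun x => |lam|⁻¹ * M * D x)
    (fun η hη => ((h.continuous_logSlope (le_trans (by positivity) hη.1) hη.2).div_const _).mul
      (h.continuous_quad_rpow (le_trans (by positivity) hη.1) hη.2 _))
    (hD.const_mul _) ?_ ?_
  · refine ⟨_, (((h.tendsto_mass_rpow hlam (-1)).mul key).neg).congr fun η => ?_⟩
    unfold strainShift jac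
    rw [← intervalIntegral.integral_const_mul]
    congr 2
    ext x
    rw [Real.rpow_neg_one]
    ring
  · filter_upwards [Ico_mem_nhdsLT_one_div hμ] with η hη x hx hxp
    have h1 := hMle x η 1 (-(2 * lam)⁻¹) zero_le_one (le_trans (by positivity) hη.1) hη.2
    rw [Real.rpow_one, Real.rpow_one] at h1
    rw [abs_mul, abs_div, abs_of_nonneg (Real.rpow_nonneg (quad_nonneg _ _ _ _) _)]
    calc |logSlope a r x η| / |lam| * quad a r x η ^ (-(2 * lam)⁻¹)
        = |lam|⁻¹ * (|logSlope a r x η| * quad a r x η ^ (-(2 * lam)⁻¹)) := by ring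
      _ ≤ |lam|⁻¹ * (M * D x) := by
        have := hDle x hx hxp η hη
        have h2 := h1.trans (mul_le_mul_of_nonneg_left this hM.le)
        exact mul_le_mul_of_nonneg_left h2 (by positivity)
      _ = _ := by ring
  · intro x hx hxp
    exact ((h.tendsto_logSlope hx hxp).div_const _).mul
      ((tendsto_quad a r μ x).rpow_const (Or.inl (h.quad_pos_max hx hxp).ne'))

/-- Convergence of the `L^p` norms, for `lam` negative and small. -/
theorem exists_tendsto_moment {p : ℝ} (hp : 1 ≤ p) (hlp : -2 / (2 * p - 1) < lam)
    (hlam : lam < 0) : ∃ L, Tendsto (moment lam a r p) (𝓝[<] (1 / μ)) (𝓝 L) := by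
  have hμ := h.pos
  -- The hypothesis `lam > -2 / (2 p - 1)` is equivalent, for negative `lam`, to `-(2 lam)⁻¹ > (2 p
  -- - 1) / 4`: exactly integrability of the majorant of `|logSlope| ^ p * quad ^ (-(2 lam)⁻¹)`.
  have hθp : -(1 / 4) < -(2 * lam)⁻¹ - p / 2 := by
    have h1 : (2 * p - 1) / 4 < -(2 * lam)⁻¹ := by
      rw [div_lt_iff₀ (by linarith)] at hlp
      rw [← inv_neg, lt_inv_comm₀ (by linarith) (by linarith), inv_div,
        lt_div_iff₀ (by linarith)]
      nlinarith
    linarith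
  obtain ⟨b, hb⟩ := h.tendsto_strainShift hlam (by linarith)
  obtain ⟨D₁, hD₁, hDle₁⟩ := h.exists_integrable_bound_quad_rpow hθp
  obtain ⟨D₀, hD₀, hDle₀⟩ := h.exists_integrable_bound_quad_rpow
    (τ := -(2 * lam)⁻¹) (by linarith)
  obtain ⟨M, hM, hMle⟩ := h.exists_abs_logSlope_rpow_mul_le
  have hp0 : 0 ≤ p := by linarith
  have hbev : ∀ᶠ η in 𝓝[<] (1 / μ), |strainShift lam a r η| ≤ |b| + 1 :=
    (hb.abs).eventually_le_const (by linarith)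
  have key := h.tendsto_integral_of_le
    (f := fun η x => |logSlope a r x η / lam + strainShift lam a r η| ^ p *
      quad a r x η ^ (-(2 * lam)⁻¹))
    (g := fun η x => |logSlope a r x η / lam + b| ^ p * quad a r x η ^ (-(2 * lam)⁻¹))
    (D := fun x => 2 ^ p * ((|lam|⁻¹) ^ p * M ^ p * D₁ x + (|b| + 1) ^ p * D₀ x))
    (fun η hη => ((((h.continuous_logSlope (le_trans (by positivity) hη.1) hη.2).div_const
      _).add continuous_const).abs.rpow_const fun _ => Or.inr hp0).mul
      (h.continuous_quad_rpow (le_trans (by positivity) hη.1) hη.2 _))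
    (((hD₁.const_mul _).add (hD₀.const_mul _)).const_mul _) ?_ ?_
  · refine ⟨_, ((h.tendsto_mass_rpow hlam (-(2 * lam * p + 1))).mul key).congr' ?_⟩
    filter_upwards [Ico_mem_nhdsLT_one_div hμ] with η hη
    exact (moment_eq (h.mass_pos (le_trans (by positivity) hη.1) hη.2)).symm
  · filter_upwards [Ico_mem_nhdsLT_one_div hμ, hbev] with η hη hbη x hx hxp
    have hQ := Real.rpow_nonneg (quad_nonneg a r x η) (-(2 * lam)⁻¹)
    have h1 := hMle x η p (-(2 * lam)⁻¹) hp0 (le_trans (by positivity) hη.1) hη.2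
    have h2 : |logSlope a r x η / lam + strainShift lam a r η| ^ p ≤
        2 ^ p * ((|logSlope a r x η / lam|) ^ p + (|b| + 1) ^ p) := by
      set A := |logSlope a r x η / lam|
      have hA : 0 ≤ A := abs_nonneg _
      calc _ ≤ (2 * max A (|b| + 1)) ^ p := by
            refine Real.rpow_le_rpow (abs_nonneg _) ((abs_add_le _ _).trans ?_) hp0
            linarith [le_max_left A (|b| + 1), le_max_right A (|b| + 1)]
        _ = 2 ^ p * (max A (|b| + 1)) ^ p := Real.mul_rpow zero_le_two (by positivity)
        _ ≤ _ := by
          gcongr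
          rcases max_cases A (|b| + 1) with ⟨e, -⟩ | ⟨e, -⟩ <;> rw [e]
          · exact le_add_of_nonneg_right (by positivity)
          · exact le_add_of_nonneg_left (by positivity)
    rw [abs_mul, abs_of_nonneg hQ, abs_of_nonneg (by positivity)]
    calc _ ≤ 2 ^ p * ((|logSlope a r x η / lam|) ^ p + (|b| + 1) ^ p) *
          quad a r x η ^ (-(2 * lam)⁻¹) := by gcongr
      _ = 2 ^ p * ((|lam|⁻¹) ^ p * (|logSlope a r x η| ^ p * quad a r x η ^ (-(2 * lam)⁻¹)) +
          (|b| + 1) ^ p * quad a r x η ^ (-(2 * lam)⁻¹)) := by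
        rw [abs_div, div_eq_mul_inv, Real.mul_rpow (abs_nonneg _) (by positivity)]
        ring
      _ ≤ 2 ^ p * ((|lam|⁻¹) ^ p * (M ^ p * D₁ x) + (|b| + 1) ^ p * D₀ x) := by
        have h3 := hDle₁ x hx hxp η hη
        have h4 := hDle₀ x hx hxp η hη
        have h5 := h1.trans (mul_le_mul_of_nonneg_left h3 (by positivity))
        gcongr
      _ = _ := by ring
  · intro x hx hxp
    exact ((((h.tendsto_logSlope hx hxp).div_const _).add hb).abs.rpow_const (Or.inr hp0)).mul
      ((tendsto_quad a r μ x).rpow_const (Or.inl (h.quad_pos_max hx hxp).ne'))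

end IsProfile

/-! ### Characteristics: flow of a periodic vector field and its Jacobian. -/

section Flow

variable {U V : ℝ → ℝ → ℝ}

/-- The average of `V(·, s)` between `x` and `y`. -/
noncomputable def segmentAverage (V : ℝ → ℝ → ℝ) (x y s : ℝ) : ℝ :=
  ∫ θ in (0 : ℝ)..1, V (x + θ * (y - x)) s

theorem continuous_segmentAverage (hV : Continuous fun z : ℝ × ℝ => V z.1 z.2) :
    Continuous fun w : ℝ × ℝ × ℝ => segmentAverage V w.1 w.2.1 w.2.2 := by
  refine intervalIntegral.continuous_parametric_intervalIntegral_of_continuous' (μ := volume)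
    (f := fun (w : ℝ × ℝ × ℝ) θ => V (w.1 + θ * (w.2.1 - w.1)) w.2.2) ?_ 0 1
  exact hV.comp (g := fun z : ℝ × ℝ => V z.1 z.2)
    (f := fun q : (ℝ × ℝ × ℝ) × ℝ => (q.1.1 + q.2 * (q.1.2.1 - q.1.1), q.1.2.2)) (by fun_prop)

theorem segmentAverage_self (x s : ℝ) : segmentAverage V x x s = V x s := by
  simp [segmentAverage]

theorem abs_segmentAverage_le {K : ℝ} (hK : ∀ x t, |V x t| ≤ K) (x y s : ℝ) :
    |segmentAverage V x y s| ≤ K := by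
  have := intervalIntegral.norm_integral_le_of_norm_le_const (a := 0) (b := 1) (C := K)
    (f := fun θ => V (x + θ * (y - x)) s) (fun θ _ => hK _ _)
  simpa [segmentAverage] using this

theorem sub_eq_mul_segmentAverage (hV : Continuous fun z : ℝ × ℝ => V z.1 z.2)
    (hUV : ∀ x t, HasDerivAt (fun y => U y t) (V x t) x) (x y s : ℝ) :
    U y s - U x s = (y - x) * segmentAverage V x y s := by
  have hd : ∀ θ : ℝ, HasDerivAt (fun θ => U (x + θ * (y - x)) s)
      ((y - x) * V (x + θ * (y - x)) s) θ := fun θ => by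
    have h1 : HasDerivAt (fun θ : ℝ => x + θ * (y - x)) (y - x) θ := by
      simpa using ((hasDerivAt_id θ).mul_const (y - x)).const_add x
    have := (hUV (x + θ * (y - x)) s).comp θ h1
    simpa [Function.comp_def, mul_comm] using this
  have hc : Continuous fun θ : ℝ => (y - x) * V (x + θ * (y - x)) s :=
    continuous_const.mul (hV.comp (g := fun z : ℝ × ℝ => V z.1 z.2)
      (f := fun θ : ℝ => (x + θ * (y - x), s)) (by fun_prop))
  have := intervalIntegral.integral_eq_sub_of_hasDerivAt (a := 0) (b := 1) (fun θ _ => hd θ)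
    (hc.intervalIntegrable _ _)
  rw [intervalIntegral.integral_const_mul] at this
  simpa [segmentAverage] using this.symm

/-- The distance between two solutions of a scalar differential equation. -/
theorem solution_sub_eq (hV : Continuous fun z : ℝ × ℝ => V z.1 z.2)
    (hUV : ∀ x t, HasDerivAt (fun y => U y t) (V x t) x) {T : ℝ} {x y : ℝ → ℝ}
    (hx : Continuous x) (hy : Continuous y)
    (hx' : ∀ t ∈ Ioo 0 T, HasDerivAt x (U (x t) t) t)
    (hy' : ∀ t ∈ Ioo 0 T, HasDerivAt y (U (y t) t) t) :
    ∀ t ∈ Icc 0 T, y t - x t =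
      (y 0 - x 0) * Real.exp (∫ s in (0 : ℝ)..t, segmentAverage V (x s) (y s) s) := by
  have hc : Continuous fun s => segmentAverage V (x s) (y s) s :=
    (continuous_segmentAverage hV).comp (g := fun w : ℝ × ℝ × ℝ => segmentAverage V w.1 w.2.1 w.2.2)
      (f := fun s => (x s, y s, s)) (by fun_prop)
  have hD : ∀ t, HasDerivAt (fun t => ∫ s in (0 : ℝ)..t, segmentAverage V (x s) (y s) s)
      (segmentAverage V (x t) (y t) t) t := fun t => hc.integral_hasStrictDerivAt 0 t |>.hasDerivAt
  have hDc : Continuous fun t => ∫ s in (0 : ℝ)..t, segmentAverage V (x s) (y s) s :=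
    continuous_iff_continuousAt.2 fun t => (hD t).continuousAt
  have key := eqOn_of_hasDerivAt_eq (T := T)
    (f := fun t => (y t - x t) * Real.exp (-∫ s in (0 : ℝ)..t, segmentAverage V (x s) (y s) s))
    (g := fun _ => y 0 - x 0) (f' := fun _ => 0)
    (((hy.sub hx).mul (Real.continuous_exp.comp hDc.neg)).continuousOn) continuousOn_const
    (fun t ht => by
      refine (((hy' t ht).sub (hx' t ht)).mul (hD t).neg.exp).congr_deriv ?_
      rw [sub_eq_mul_segmentAverage hV hUV]
      simp only [Pi.sub_apply, Pi.neg_apply]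
      ring) (fun t _ => hasDerivAt_const t _) (by simp)
  intro t ht
  rw [← key t ht, mul_assoc, ← Real.exp_add]
  simp

/-- The flow of a bounded periodic scalar vector field which is continuously differentiable in
space, with its spatial derivative. -/
theorem exists_flow (hU : Continuous fun z : ℝ × ℝ => U z.1 z.2)
    (hV : Continuous fun z : ℝ × ℝ => V z.1 z.2)
    (hUV : ∀ x t, HasDerivAt (fun y => U y t) (V x t) x)
    (hper : ∀ t, Function.Periodic (fun x => U x t) 1) {K L : ℝ} (hK : ∀ x t, |V x t| ≤ K)
    (hL : ∀ x t, |U x t| ≤ L) {T : ℝ} (hT : 0 < T) :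
    ∃ γ : ℝ → ℝ → ℝ, (∀ α, γ α 0 = α) ∧ (∀ α, Continuous (γ α)) ∧
      (∀ α, ∀ t ∈ Ioo 0 T, HasDerivAt (γ α) (U (γ α t) t) t) ∧
      (∀ α, ∀ t ∈ Icc 0 T, γ (α + 1) t = γ α t + 1) ∧
      ∀ α, ∀ t ∈ Icc 0 T,
        HasDerivAt (fun β => γ β t) (Real.exp (∫ s in (0 : ℝ)..t, V (γ α s) s)) α := by
  have hK0 : 0 ≤ K := (abs_nonneg _).trans (hK 0 0)
  have hL0 : 0 ≤ L := (abs_nonneg _).trans (hL 0 0)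
  have hex : ∀ α : ℝ, ∃ x : ℝ → ℝ, x 0 = α ∧ Continuous x ∧
      ∀ t ∈ Ioo 0 T, HasDerivAt x (U (x t) t) t := by
    intro α
    have hpl : IsPicardLindelof (fun t x => U x t) (tmin := 0) (tmax := T)
        (⟨0, le_rfl, hT.le⟩ : Icc 0 T) α (L * T).toNNReal 0 L.toNNReal K.toNNReal := by
      refine ⟨fun t _ => ?_, fun x _ => ?_, fun t _ x _ => ?_, ?_⟩
      · refine (lipschitzWith_of_nnnorm_deriv_le (fun x => (hUV x t).differentiableAt)
          fun x => ?_).lipschitzOnWith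
        rw [(hUV x t).deriv, ← NNReal.coe_le_coe, coe_nnnorm, Real.coe_toNNReal _ hK0]
        exact hK x t
      · exact (hU.comp (g := fun z : ℝ × ℝ => U z.1 z.2) (f := fun t : ℝ => (x, t))
          (by fun_prop)).continuousOn
      · rw [Real.coe_toNNReal _ hL0]
        exact hL x t
      · rw [Real.coe_toNNReal _ hL0, Real.coe_toNNReal _ (by positivity)]
        simp [hT.le]
    obtain ⟨x, hx0, hx⟩ := hpl.exists_eq_forall_mem_Icc_hasDerivWithinAt₀
    have hxc : ContinuousOn x (Icc 0 T) := fun t ht => (hx t ht).continuousWithinAt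
    -- Freezing the trajectory outside `[0, T]` makes it continuous on the whole line.
    refine ⟨fun t => x (max 0 (min t T)), by simpa [hT.le] using hx0, ?_, fun t ht => ?_⟩
    · exact hxc.comp_continuous (by fun_prop) fun t =>
        ⟨le_max_left _ _, max_le hT.le (min_le_right _ _)⟩
    · have hd := (hx t ⟨ht.1.le, ht.2.le⟩).hasDerivAt (Icc_mem_nhds ht.1 ht.2)
      have e : max 0 (min t T) = t := by
        rw [min_eq_left ht.2.le, max_eq_right ht.1.le]
      simp only [e]
      refine hd.congr_of_eventuallyEq ?_
      filter_upwards [Ioo_mem_nhds ht.1 ht.2] with s hs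
      rw [min_eq_left hs.2.le, max_eq_right hs.1.le]
  choose γ h0 hc hd using hex
  have hsub := fun α β => solution_sub_eq hV hUV (hc α) (hc β) (hd α) (hd β)
  refine ⟨γ, h0, hc, hd, fun α t ht => ?_, fun α t ht => ?_⟩
  -- The translate of one trajectory by a period and the trajectory of the translated label start at
  -- the same point.
  · have := solution_sub_eq hV hUV (T := T) (x := fun t => γ α t + 1) ((hc α).add continuous_const)
      (hc (α + 1))
      (fun s hs => by
        have := (hper s (γ α s))
        simp only at this
        rw [this]
        exact (hd α s hs).add_const 1)
      (hd (α + 1)) t ht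
    simp only [h0, sub_self, zero_mul] at this
    linarith
  -- Lipschitz dependence on the label comes first; it lets the segment averages in
  -- `solution_sub_eq` converge to `V` on the trajectory, which identifies the difference quotient's
  -- limit.
  · have hnear : ∀ s ∈ Icc 0 T, Tendsto (fun β => γ β s) (𝓝 α) (𝓝 (γ α s)) := by
      intro s hs
      rw [tendsto_iff_norm_sub_tendsto_zero]
      refine squeeze_zero (g := fun β => |β - α| * Real.exp (K * s)) (fun _ => norm_nonneg _)
        (fun β => ?_) ?_
      · rw [hsub α β s hs, h0, h0, Real.norm_eq_abs, abs_mul, Real.abs_exp]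
        gcongr
        refine (le_abs_self _).trans ?_
        have := intervalIntegral.norm_integral_le_of_norm_le_const (a := 0) (b := s) (C := K)
          (f := fun s => segmentAverage V (γ α s) (γ β s) s)
          (fun θ _ => abs_segmentAverage_le hK _ _ _)
        rwa [sub_zero, abs_of_nonneg hs.1] at this
      · have : Continuous fun β : ℝ => |β - α| * Real.exp (K * s) := by fun_prop
        simpa using this.tendsto α
    rw [hasDerivAt_iff_tendsto_slope]
    have hlim : Tendsto (fun β => ∫ s in (0 : ℝ)..t, segmentAverage V (γ α s) (γ β s) s) (𝓝 α)
        (𝓝 (∫ s in (0 : ℝ)..t, V (γ α s) s)) := by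
      refine intervalIntegral.tendsto_integral_filter_of_dominated_convergence (fun _ => K)
        (Eventually.of_forall fun β => ?_) (Eventually.of_forall fun β =>
          Eventually.of_forall fun s _ => abs_segmentAverage_le hK _ _ _)
        intervalIntegrable_const (Eventually.of_forall fun s hs => ?_)
      · refine Continuous.aestronglyMeasurable ?_
        exact (continuous_segmentAverage hV).comp
          (g := fun w : ℝ × ℝ × ℝ => segmentAverage V w.1 w.2.1 w.2.2)
          (f := fun s => (γ α s, γ β s, s)) ((hc α).prodMk ((hc β).prodMk continuous_id))
      · rw [uIoc_of_le ht.1] at hs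
        rw [← segmentAverage_self (V := V) (γ α s) s]
        have h1 := (continuous_segmentAverage hV).tendsto (γ α s, γ α s, s)
        refine h1.comp (f := fun β => (γ α s, γ β s, s)) ?_
        exact tendsto_const_nhds.prodMk_nhds
          ((hnear s ⟨hs.1.le, hs.2.trans ht.2⟩).prodMk_nhds tendsto_const_nhds)
    refine ((Real.continuous_exp.tendsto _).comp (hlim.mono_left nhdsWithin_le_nhds)).congr' ?_
    filter_upwards [self_mem_nhdsWithin] with β hβ
    have hβ' : β - α ≠ 0 := sub_ne_zero.2 hβ
    rw [slope_def_field, hsub α β t ht, h0, h0]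
    simp [hβ']

end Flow

/-! ### The Ermakov equation and its superposition principle. -/

section Ermakov

/-- The nonlinear superposition principle for the Ermakov equation `ψ'' = k ψ + R ψ⁻³`, in terms of
a positive solution `w` of `w'' = k w` and of `τ = ∫ w⁻²`. -/
theorem ermakov_superposition {T μ a R : ℝ} {k w w₁ ψ ψ₁ τ : ℝ → ℝ}
    (hw : ContinuousOn w (Icc 0 T)) (hw₁ : ContinuousOn w₁ (Icc 0 T))
    (hψ : ContinuousOn ψ (Icc 0 T)) (hψ₁ : ContinuousOn ψ₁ (Icc 0 T))
    (hτ : ContinuousOn τ (Icc 0 T))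
    (hwpos : ∀ t ∈ Icc 0 T, 0 < w t) (hψpos : ∀ t ∈ Icc 0 T, 0 < ψ t)
    (dw : ∀ t ∈ Ioo 0 T, HasDerivAt w (w₁ t) t)
    (dw₁ : ∀ t ∈ Ioo 0 T, HasDerivAt w₁ (k t * w t) t)
    (dψ : ∀ t ∈ Ioo 0 T, HasDerivAt ψ (ψ₁ t) t)
    (dψ₁ : ∀ t ∈ Ioo 0 T, HasDerivAt ψ₁ (k t * ψ t + R / ψ t ^ 3) t)
    (dτ : ∀ t ∈ Ioo 0 T, HasDerivAt τ (1 / w t ^ 2) t)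
    (w0 : w 0 = 1) (w₁0 : w₁ 0 = -μ) (ψ0 : ψ 0 = 1) (ψ₁0 : ψ₁ 0 = -a) (τ0 : τ 0 = 0) :
    ∀ t ∈ Icc 0 T,
      ψ t * (w t * ψ₁ t - w₁ t * ψ t) = w t * (μ - a + ((μ - a) ^ 2 + R) * τ t) ∧
      ψ t ^ 2 = w t ^ 2 * (1 + 2 * (μ - a) * τ t + ((μ - a) ^ 2 + R) * τ t ^ 2) := by
  have hw0 : ∀ t ∈ Icc 0 T, w t ≠ 0 := fun t ht => (hwpos t ht).ne'
  have hψ0 : ∀ t ∈ Icc 0 T, ψ t ≠ 0 := fun t ht => (hψpos t ht).ne'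
  have hW : ContinuousOn (fun t => w t * ψ₁ t - w₁ t * ψ t) (Icc 0 T) :=
    (hw.mul hψ₁).sub (hw₁.mul hψ)
  -- In the derivative of the Wronskian the common coefficient `k` cancels.
  have dW : ∀ t ∈ Ioo 0 T, HasDerivAt (fun t => w t * ψ₁ t - w₁ t * ψ t) (R * w t / ψ t ^ 3) t := by
    intro t ht
    have h0 := hψ0 t (Ioo_subset_Icc_self ht)
    refine (((dw t ht).mul (dψ₁ t ht)).sub ((dw₁ t ht).mul (dψ t ht))).congr_deriv ?_
    field_simp
    ring
  -- This is the Ermakov–Lewis invariant.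
  have hE : ∀ t ∈ Icc 0 T, (w t * ψ₁ t - w₁ t * ψ t) ^ 2 + R * (w t ^ 2 / ψ t ^ 2) =
      (μ - a) ^ 2 + R := by
    refine eqOn_of_hasDerivAt_eq (f' := fun _ => 0)
      ((hW.pow 2).add (continuousOn_const.mul ((hw.pow 2).div (hψ.pow 2)
        fun t ht => pow_ne_zero 2 (hψ0 t ht)))) continuousOn_const (fun t ht => ?_)
      (fun t _ => hasDerivAt_const t _) (by rw [w0, w₁0, ψ0, ψ₁0]; ring)
    have h0 := hψ0 t (Ioo_subset_Icc_self ht)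
    refine (((dW t ht).pow 2).add ((((dw t ht).pow 2).div ((dψ t ht).pow 2)
      (pow_ne_zero 2 h0)).const_mul R)).congr_deriv ?_
    simp only [Pi.pow_apply, Nat.cast_ofNat, Nat.add_one_sub_one, pow_one]
    field_simp
    ring
  -- Half the `τ`-derivative of `ψ² / w²` is `ψ W / w`, with `W` the Wronskian. Its own
  -- `τ`-derivative is the invariant, so it is affine in `τ`, and `ψ² / w²` is quadratic.
  have hr : ∀ t ∈ Icc 0 T, ψ t * (w t * ψ₁ t - w₁ t * ψ t) / w t =
      μ - a + ((μ - a) ^ 2 + R) * τ t := by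
    refine eqOn_of_hasDerivAt_eq (f' := fun t => ((μ - a) ^ 2 + R) * (1 / w t ^ 2))
      ((hψ.mul hW).div hw hw0) (continuousOn_const.add (continuousOn_const.mul hτ))
      (fun t ht => ?_) (fun t ht => ((dτ t ht).const_mul _).const_add _)
      (by rw [w0, w₁0, ψ0, ψ₁0, τ0]; ring)
    have h0 := hψ0 t (Ioo_subset_Icc_self ht)
    have h1 := hw0 t (Ioo_subset_Icc_self ht)
    refine ((((dψ t ht).mul (dW t ht)).div (dw t ht)) h1).congr_deriv ?_
    rw [← hE t (Ioo_subset_Icc_self ht), Pi.mul_apply]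
    field_simp
    ring
  have hq : ∀ t ∈ Icc 0 T, ψ t ^ 2 / w t ^ 2 =
      1 + 2 * (μ - a) * τ t + ((μ - a) ^ 2 + R) * τ t ^ 2 := by
    refine eqOn_of_hasDerivAt_eq
      (f' := fun t => 2 * (μ - a + ((μ - a) ^ 2 + R) * τ t) * (1 / w t ^ 2))
      ((hψ.pow 2).div (hw.pow 2) fun t ht => pow_ne_zero 2 (hw0 t ht))
      ((continuousOn_const.add (continuousOn_const.mul hτ)).add
        (continuousOn_const.mul (hτ.pow 2)))
      (fun t ht => ?_) (fun t ht => ?_) (by rw [w0, ψ0, τ0]; ring)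
    · have h0 := hψ0 t (Ioo_subset_Icc_self ht)
      have h1 := hw0 t (Ioo_subset_Icc_self ht)
      refine (((dψ t ht).pow 2).div ((dw t ht).pow 2) (pow_ne_zero 2 h1)).congr_deriv ?_
      rw [← hr t (Ioo_subset_Icc_self ht)]
      simp only [Pi.pow_apply, Nat.cast_ofNat, Nat.add_one_sub_one, pow_one]
      field_simp
    · refine ((((dτ t ht).const_mul (2 * (μ - a))).const_add 1).add
        (((dτ t ht).pow 2).const_mul _)).congr_deriv ?_
      simp only [Nat.cast_ofNat, Nat.add_one_sub_one, pow_one]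
      ring
  intro t ht
  have h1 := hw0 t ht
  constructor
  · rw [← hr t ht]; field_simp
  · rw [← hq t ht]; field_simp

/-- The superposition principle in the coordinate `η = τ / (1 + μ τ)`. -/
theorem ermakov_superposition' {a r : ℝ → ℝ} {μ α w w₁ ψ ψ₁ τ : ℝ} (hw : 0 < w) (hψ : 0 < ψ)
    (hτ : 0 ≤ τ) (hμ : 0 < μ)
    (h1 : ψ * (w * ψ₁ - w₁ * ψ) = w * (μ - a α + ((μ - a α) ^ 2 + r α ^ 2) * τ))
    (h2 : ψ ^ 2 = w ^ 2 * (1 + 2 * (μ - a α) * τ + ((μ - a α) ^ 2 + r α ^ 2) * τ ^ 2)) :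
    ψ ^ 2 = (w * (1 + μ * τ)) ^ 2 * quad a r α (τ / (1 + μ * τ)) ∧
      ψ₁ / ψ = w₁ / w + μ / (w ^ 2 * (1 + μ * τ)) -
        logSlope a r α (τ / (1 + μ * τ)) / (w * (1 + μ * τ)) ^ 2 := by
  have hy : 0 < 1 + μ * τ := by positivity
  have h3 : ψ ^ 2 = (w * (1 + μ * τ)) ^ 2 * quad a r α (τ / (1 + μ * τ)) := by
    rw [h2]; unfold quad; field_simp; ring
  refine ⟨h3, ?_⟩
  have hQ : quad a r α (τ / (1 + μ * τ)) = ψ ^ 2 / (w * (1 + μ * τ)) ^ 2 := by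
    rw [h3]; field_simp
  have e : logSlope a r α (τ / (1 + μ * τ)) / (w * (1 + μ * τ)) ^ 2 =
      (a α * (1 - τ / (1 + μ * τ) * a α) - τ / (1 + μ * τ) * r α ^ 2) / ψ ^ 2 := by
    unfold logSlope
    rw [hQ]; field_simp
  have h4 : ψ₁ / ψ = w₁ / w + (μ - a α + ((μ - a α) ^ 2 + r α ^ 2) * τ) / ψ ^ 2 := by
    have : μ - a α + ((μ - a α) ^ 2 + r α ^ 2) * τ = ψ * (w * ψ₁ - w₁ * ψ) / w := by
      rw [h1]; field_simp
    rw [this]; field_simp; ring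
  have h5 : μ / (w ^ 2 * (1 + μ * τ)) =
      μ * (1 + 2 * (μ - a α) * τ + ((μ - a α) ^ 2 + r α ^ 2) * τ ^ 2) / (1 + μ * τ) / ψ ^ 2 := by
    have hq : 1 + 2 * (μ - a α) * τ + ((μ - a α) ^ 2 + r α ^ 2) * τ ^ 2 ≠ 0 := by
      intro h0
      rw [h0, mul_zero] at h2
      exact (pow_pos hψ 2).ne' h2
    generalize 1 + 2 * (μ - a α) * τ + ((μ - a α) ^ 2 + r α ^ 2) * τ ^ 2 = q at h2 hq ⊢
    rw [h2]; field_simp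
  rw [e, h4, h5]
  field_simp
  ring

end Ermakov

/-! ### Smooth functions on the half-open space-time strip. -/

section Regularity

/-- Smooth functions on the space-time strip over `[0, T)`. -/
def SmoothOnStrip (T : ℝ) (F : ℝ → ℝ → ℝ) : Prop :=
  ContDiffOn ℝ ∞ (fun z : ℝ × ℝ => F z.1 z.2) (univ ×ˢ Ico 0 T)

namespace SmoothOnStrip

variable {T : ℝ} {F : ℝ → ℝ → ℝ} (hF : SmoothOnStrip T F)
include hF

theorem hasDerivAt_dx {t : ℝ} (ht : t ∈ Ico 0 T) (x : ℝ) :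
    HasDerivAt (fun y => F y t) (dx F x t) x := by
  have : ContDiff ℝ ∞ fun y => F y t := by
    rw [← contDiffOn_univ]
    exact ContDiffOn.comp (g := fun z : ℝ × ℝ => F z.1 z.2) hF (f := fun y : ℝ => (y, t))
      (by fun_prop) fun y _ => ⟨mem_univ _, ht⟩
  exact (this.differentiable (by simp) x).hasDerivAt

theorem dx_eq_fderivWithin {z : ℝ × ℝ} (hz : z ∈ univ ×ˢ Ico 0 T) :
    dx F z.1 z.2 = fderivWithin ℝ (fun z : ℝ × ℝ => F z.1 z.2) (univ ×ˢ Ico 0 T) z (1, 0) := by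
  have h1 : HasFDerivWithinAt (fun z : ℝ × ℝ => F z.1 z.2) _ (univ ×ˢ Ico 0 T) z :=
    (hF.differentiableOn (by simp) z hz).hasFDerivWithinAt
  have h2 : HasDerivWithinAt (fun y : ℝ => (y, z.2)) (1, 0) univ z.1 :=
    ((hasDerivAt_id z.1).prodMk (hasDerivAt_const z.1 z.2)).hasDerivWithinAt
  have h3 := (HasFDerivWithinAt.comp_hasDerivWithinAt z.1 h1 h2
    (show MapsTo (fun y : ℝ => (y, z.2)) univ (univ ×ˢ Ico 0 T) from
      fun y _ => ⟨mem_univ _, hz.2⟩)).hasDerivAt univ_mem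
  exact h3.deriv

/-- The strip is not open at `t = 0`, hence the passage through the derivative within the strip,
which is unique there. -/
theorem dx_smooth : SmoothOnStrip T (dx F) := by
  have hu : UniqueDiffOn ℝ ((univ : Set ℝ) ×ˢ Ico 0 T) :=
    uniqueDiffOn_univ.prod (uniqueDiffOn_Ico 0 T)
  have h1 := ContDiffOn.fderivWithin hF hu (m := ∞) (by simp)
  exact (h1.clm_apply contDiffOn_const).congr fun z hz => hF.dx_eq_fderivWithin hz

theorem hasFDerivAt {x t : ℝ} (ht : t ∈ Ioo 0 T) :
    HasFDerivAt (fun z : ℝ × ℝ => F z.1 z.2)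
      (dx F x t • ContinuousLinearMap.fst ℝ ℝ ℝ + dt F x t • ContinuousLinearMap.snd ℝ ℝ ℝ)
      (x, t) := by
  have hn : (univ : Set ℝ) ×ˢ Ico 0 T ∈ 𝓝 (x, t) :=
    prod_mem_nhds univ_mem (Ico_mem_nhds ht.1 ht.2)
  have h1 := ((hF.contDiffAt hn).differentiableAt (by simp)).hasFDerivAt
  have e1 : fderiv ℝ (fun z : ℝ × ℝ => F z.1 z.2) (x, t) (1, 0) = dx F x t := by
    have h2 : HasDerivAt (fun y : ℝ => (y, t)) (1, 0) x :=
      (hasDerivAt_id x).prodMk (hasDerivAt_const x t)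
    exact (HasFDerivAt.comp_hasDerivAt x h1 h2).deriv.symm
  have e2 : fderiv ℝ (fun z : ℝ × ℝ => F z.1 z.2) (x, t) (0, 1) = dt F x t := by
    have h2 : HasDerivAt (fun s : ℝ => (x, s)) (0, 1) t :=
      (hasDerivAt_const t x).prodMk (hasDerivAt_id t)
    exact (HasFDerivAt.comp_hasDerivAt t h1 h2).deriv.symm
  refine h1.congr_fderiv ?_
  ext
  · simp [e1]
  · simp [e2]

theorem hasDerivAt_comp {γ : ℝ → ℝ} {γ' t : ℝ} (ht : t ∈ Ioo 0 T) (hγ : HasDerivAt γ γ' t) :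
    HasDerivAt (fun s => F (γ s) s) (dt F (γ t) t + γ' * dx F (γ t) t) t := by
  have h2 : HasDerivAt (fun s : ℝ => (γ s, s)) (γ', 1) t := hγ.prodMk (hasDerivAt_id t)
  refine (HasFDerivAt.comp_hasDerivAt (f := fun s : ℝ => (γ s, s)) t (hF.hasFDerivAt ht)
    h2).congr_deriv ?_
  simp
  ring

/-- Clamping time to `[0, T₁]` yields globally continuous functions, as `exists_flow` requires,
without changing anything for times in that interval. -/
theorem continuous_clamp {T₁ : ℝ} (h0 : 0 ≤ T₁) (h1 : T₁ < T) :
    Continuous fun z : ℝ × ℝ => F z.1 (max 0 (min z.2 T₁)) :=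
  hF.continuousOn.comp_continuous (f := fun z : ℝ × ℝ => (z.1, max 0 (min z.2 T₁))) (by fun_prop)
    fun _ => ⟨mem_univ _, le_max_left _ _, (max_le h0 (min_le_right _ _)).trans_lt h1⟩

theorem exists_bound {T₁ : ℝ} (h0 : 0 ≤ T₁) (h1 : T₁ < T)
    (hper : ∀ t ∈ Ico 0 T, Function.Periodic (fun x => F x t) 1) :
    ∃ C, ∀ x t, |F x (max 0 (min t T₁))| ≤ C := by
  have hc := hF.continuousOn.mono (Set.prod_mono (subset_univ (Icc (0 : ℝ) 1))
    (fun t ht => ⟨ht.1, ht.2.trans_lt h1⟩ : Icc 0 T₁ ⊆ Ico 0 T))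
  obtain ⟨C, hC⟩ := (isCompact_Icc.prod isCompact_Icc).exists_bound_of_continuousOn hc
  refine ⟨C, fun x t => ?_⟩
  have hm : max 0 (min t T₁) ∈ Icc 0 T₁ := ⟨le_max_left _ _, max_le h0 (min_le_right _ _)⟩
  obtain ⟨y, hy, hxy⟩ := (hper _ ⟨hm.1, hm.2.trans_lt h1⟩).exists_mem_Ico₀ one_pos x
  rw [hxy]
  exact hC (y, _) ⟨⟨hy.1, hy.2.le⟩, hm⟩

end SmoothOnStrip

theorem dx_periodic {F : ℝ → ℝ → ℝ} {t : ℝ} (h : Function.Periodic (fun x => F x t) 1) :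
    Function.Periodic (fun x => dx F x t) 1 := by
  intro x
  have e : (fun y => F y t) = fun y => F (y + 1) t := funext fun y => (h y).symm
  have := deriv_comp_add_const (fun y => F y t) 1 x
  rw [← e] at this
  exact this.symm

end Regularity

/-! ### Every smooth solution follows the explicit formulas. -/

/-- Along a trajectory, a power of the Jacobian solves an Ermakov equation. -/
theorem ermakov_of_trajectory {lam kap T c : ℝ} {I v P : ℝ → ℝ} (hv : Continuous v)
    (hP : Continuous P)
    (dv : ∀ t ∈ Ioo 0 T, HasDerivAt v (lam * v t ^ 2 + kap * P t ^ 2 + I t) t)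
    (dP : ∀ t ∈ Ioo 0 T, HasDerivAt P (2 * lam * P t * v t) t)
    (hc : c = -(lam * kap) * P 0 ^ 2) :
    ∃ ψ : ℝ → ℝ, (∀ t, ψ t = Real.exp (-lam * ∫ s in (0 : ℝ)..t, v s)) ∧ Continuous ψ ∧
      (∀ t, 0 < ψ t) ∧ ψ 0 = 1 ∧ (∀ t, HasDerivAt ψ (-lam * v t * ψ t) t) ∧
      ∀ t ∈ Ioo 0 T, HasDerivAt (fun t => -lam * v t * ψ t)
        (-lam * I t * ψ t + c / ψ t ^ 3) t := by
  have dG : ∀ t, HasDerivAt (fun t => ∫ s in (0 : ℝ)..t, v s) (v t) t := fun t =>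
    (hv.integral_hasStrictDerivAt 0 t).hasDerivAt
  have dψ : ∀ t, HasDerivAt (fun t => Real.exp (-lam * ∫ s in (0 : ℝ)..t, v s))
      (-lam * v t * Real.exp (-lam * ∫ s in (0 : ℝ)..t, v s)) t := fun t => by
    refine ((dG t).const_mul (-lam)).exp.congr_deriv ?_
    ring
  have hψc : Continuous fun t => Real.exp (-lam * ∫ s in (0 : ℝ)..t, v s) :=
    continuous_iff_continuousAt.2 fun t => (dψ t).continuousAt
  refine ⟨_, fun t => rfl, hψc, fun t => Real.exp_pos _, by simp, dψ, fun t ht => ?_⟩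
  -- The transport equation makes `P ψ²` constant, which turns `kap P² ψ` into a multiple of `ψ⁻³`.
  have hPψ : ∀ t ∈ Icc 0 T, P t * Real.exp (-lam * ∫ s in (0 : ℝ)..t, v s) ^ 2 = P 0 := by
    refine eqOn_of_hasDerivAt_eq (f' := fun _ => 0) (hP.mul (hψc.pow 2)).continuousOn
      continuousOn_const (fun t ht => ?_) (fun t _ => hasDerivAt_const t _) (by simp)
    refine ((dP t ht).mul ((dψ t).pow 2)).congr_deriv ?_
    simp only [Pi.pow_apply, Nat.cast_ofNat, Nat.add_one_sub_one, pow_one]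
    ring
  refine ((((dv t ht).const_mul (-lam))).mul (dψ t)).congr_deriv ?_
  have h1 := Real.exp_pos (-lam * ∫ s in (0 : ℝ)..t, v s)
  rw [hc, ← hPψ t (Ioo_subset_Icc_self ht)]
  field_simp
  ring

theorem continuous_jac {a r : ℝ → ℝ} {lam μ : ℝ} (h : IsProfile a r μ) {η : ℝ} (h0 : 0 ≤ η)
    (h1 : η < 1 / μ) : Continuous fun α => jac lam a r α η :=
  (h.continuous_quad_rpow h0 h1 _).div_const _

theorem integral_jac {a r : ℝ → ℝ} {lam μ : ℝ} (h : IsProfile a r μ) {η : ℝ} (h0 : 0 ≤ η)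
    (h1 : η < 1 / μ) : ∫ α in (0 : ℝ)..1, jac lam a r α η = 1 := by
  unfold jac
  rw [intervalIntegral.integral_div]
  exact div_self (h.mass_pos h0 h1).ne'

theorem eq_strainShift {a r : ℝ → ℝ} {lam μ b : ℝ} (h : IsProfile a r μ) {η : ℝ} (h0 : 0 ≤ η)
    (h1 : η < 1 / μ) (hb : ∫ α in (0 : ℝ)..1, strain lam a r b α η * jac lam a r α η = 0) :
    b = strainShift lam a r η := by
  have hm := Real.rpow_pos_of_pos (h.mass_pos (lam := lam) h0 h1) (-(2 * lam))
  have e : ∀ α, strain lam a r b α η * jac lam a r α η = mass lam a r η ^ (-(2 * lam)) *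
      (logSlope a r α η / lam * jac lam a r α η + b * jac lam a r α η) := fun α => by
    unfold strain; ring
  have hc := continuous_jac (lam := lam) h h0 h1
  simp only [e] at hb
  have hadd : ∫ α in (0 : ℝ)..1,
      (logSlope a r α η / lam * jac lam a r α η + b * jac lam a r α η) =
      (∫ α in (0 : ℝ)..1, logSlope a r α η / lam * jac lam a r α η) +
        ∫ α in (0 : ℝ)..1, b * jac lam a r α η :=
    intervalIntegral.integral_add
      ((((h.continuous_logSlope h0 h1).div_const _).mul hc).intervalIntegrable _ _)
      ((continuous_const.mul hc).intervalIntegrable _ _)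
  rw [intervalIntegral.integral_const_mul, hadd, intervalIntegral.integral_const_mul,
    integral_jac h h0 h1, mul_one] at hb
  have := (mul_eq_zero.1 hb).resolve_left hm.ne'
  unfold strainShift
  linarith

/-- Every smooth solution is given by the explicit formula along its characteristics. -/
theorem IsSmoothSolution.representation {lam kap T T₁ μ : ℝ} {u₀ ρ₀ a r : ℝ → ℝ}
    {u ρ : ℝ → ℝ → ℝ} (hlam : lam ≠ 0) (h : IsProfile a r μ) (ha : ∀ x, a x = lam * deriv u₀ x)
    (hr : ∀ x, r x ^ 2 = -(lam * kap) * ρ₀ x ^ 2)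
    (hsol : IsSmoothSolution lam kap u₀ ρ₀ T u ρ) (hT₁ : T₁ ∈ Ioo 0 T) :
    ∃ η ∈ Ioo 0 (1 / μ), clock lam a r η = T₁ ∧
      (∀ α, ∃ x, dx u x T₁ = strain lam a r (strainShift lam a r η) α η) ∧
      ∀ φ : ℝ → ℝ, Continuous φ → ∫ x in (0 : ℝ)..1, φ (dx u x T₁) =
        ∫ α in (0 : ℝ)..1, φ (strain lam a r (strainShift lam a r η) α η) * jac lam a r α η := by
  have hμ := h.pos
  have hu : SmoothOnStrip T u := hsol.smooth_u
  have hρ : SmoothOnStrip T ρ := hsol.smooth_rho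
  have hux := hu.dx_smooth
  have hclamp : ∀ t ∈ Icc 0 T₁, max 0 (min t T₁) = t := fun t ht => by
    rw [min_eq_left ht.2, max_eq_right ht.1]
  have hclampm : ∀ t, max 0 (min t T₁) ∈ Ico 0 T := fun t =>
    ⟨le_max_left _ _, (max_le hT₁.1.le (min_le_right _ _)).trans_lt hT₁.2⟩
  have hIoo : ∀ t ∈ Ioo 0 T₁, t ∈ Ioo 0 T := fun t ht => ⟨ht.1, ht.2.trans hT₁.2⟩
  have hnhds : ∀ t ∈ Ioo 0 T₁, ∀ᶠ s in 𝓝 t, max 0 (min s T₁) = s := fun t ht => by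
    filter_upwards [Ioo_mem_nhds ht.1 ht.2] with s hs
    exact hclamp s (Ioo_subset_Icc_self hs)
  obtain ⟨L, hL⟩ := hu.exists_bound hT₁.1.le hT₁.2 hsol.periodic_u
  obtain ⟨K, hK⟩ := hux.exists_bound hT₁.1.le hT₁.2 fun t ht => dx_periodic (hsol.periodic_u t ht)
  obtain ⟨γ, γ0, γc, γd, γper, γα⟩ := exists_flow (U := fun x t => u x (max 0 (min t T₁)))
    (V := fun x t => dx u x (max 0 (min t T₁))) (hu.continuous_clamp hT₁.1.le hT₁.2)
    (hux.continuous_clamp hT₁.1.le hT₁.2) (fun x t => hu.hasDerivAt_dx (hclampm t) x)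
    (fun t => hsol.periodic_u _ (hclampm t)) hK hL hT₁.1
  have γd' : ∀ α, ∀ t ∈ Ioo 0 T₁, HasDerivAt (γ α) (u (γ α t) t) t := fun α t ht => by
    have := γd α t ht
    simpa only [hclamp t (Ioo_subset_Icc_self ht)] using this
  set v : ℝ → ℝ → ℝ := fun α t => dx u (γ α t) (max 0 (min t T₁)) with hvdef
  set P : ℝ → ℝ → ℝ := fun α t => ρ (γ α t) (max 0 (min t T₁)) with hPdef
  have hvc : ∀ α, Continuous (v α) := fun α =>
    (hux.continuous_clamp hT₁.1.le hT₁.2).comp (f := fun t => (γ α t, t))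
      ((γc α).prodMk continuous_id)
  have hPc : ∀ α, Continuous (P α) := fun α =>
    (hρ.continuous_clamp hT₁.1.le hT₁.2).comp (f := fun t => (γ α t, t))
      ((γc α).prodMk continuous_id)
  have dv : ∀ α, ∀ t ∈ Ioo 0 T₁, HasDerivAt (v α)
      (lam * v α t ^ 2 + kap * P α t ^ 2 + nonlocalTerm lam kap u ρ t) t := fun α t ht => by
    have h1 := hux.hasDerivAt_comp (hIoo t ht) (γd' α t ht)
    have h2 := hsol.momentum t (hIoo t ht) (γ α t)
    have h3 : HasDerivAt (v α) _ t := h1.congr_of_eventuallyEq <| by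
      filter_upwards [hnhds t ht] with s hs
      simp only [hvdef, hs]
    refine h3.congr_deriv ?_
    simp only [hvdef, hPdef, hclamp t (Ioo_subset_Icc_self ht)]
    linarith
  have dP : ∀ α, ∀ t ∈ Ioo 0 T₁, HasDerivAt (P α) (2 * lam * P α t * v α t) t := fun α t ht => by
    have h1 := hρ.hasDerivAt_comp (hIoo t ht) (γd' α t ht)
    have h2 := hsol.transport t (hIoo t ht) (γ α t)
    have h3 : HasDerivAt (P α) _ t := h1.congr_of_eventuallyEq <| by
      filter_upwards [hnhds t ht] with s hs
      simp only [hPdef, hs]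
    refine h3.congr_deriv ?_
    simp only [hvdef, hPdef, hclamp t (Ioo_subset_Icc_self ht)]
    linarith
  have hP0 : ∀ α, P α 0 = ρ₀ α := fun α => by
    simp only [hPdef, γ0, hclamp 0 ⟨le_rfl, hT₁.1.le⟩, hsol.initial_rho]
  have hv0 : ∀ α, v α 0 = deriv u₀ α := fun α => by
    simp only [hvdef, γ0, hclamp 0 ⟨le_rfl, hT₁.1.le⟩, dx]
    congr 1
    exact funext hsol.initial_u
  have herm := fun α => ermakov_of_trajectory (hvc α) (hPc α) (dv α) (dP α)
    (c := r α ^ 2) (by rw [hr, hP0])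
  choose ψ hψexp hψc hψpos hψ0 dψ dψ₁ using herm
  -- A peak serves as reference label: `r z = 0` makes its equation linear, and `a z = μ` fixes the
  -- initial slope `-μ`.
  obtain ⟨z, hz⟩ := h.nonempty_peaks
  set τ : ℝ → ℝ := fun t => ∫ s in (0 : ℝ)..t, 1 / ψ z s ^ 2 with hτdef
  have hτic : Continuous fun s => 1 / ψ z s ^ 2 :=
    continuous_const.div ((hψc z).pow 2) fun s => pow_ne_zero 2 (hψpos z s).ne'
  have dτ : ∀ t, HasDerivAt τ (1 / ψ z t ^ 2) t := fun t =>
    (hτic.integral_hasStrictDerivAt 0 t).hasDerivAt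
  have hτc : Continuous τ := continuous_iff_continuousAt.2 fun t => (dτ t).continuousAt
  have hτ0 : ∀ t ∈ Icc 0 T₁, 0 ≤ τ t := fun t ht =>
    intervalIntegral.integral_nonneg ht.1 fun s _ => by positivity
  have hsup : ∀ α, ∀ t ∈ Icc 0 T₁, _ := fun α t ht => by
    have h1 := ermakov_superposition (T := T₁) (μ := μ) (a := a α) (R := r α ^ 2)
      (k := fun t => -lam * nonlocalTerm lam kap u ρ t)
      (w := ψ z) (w₁ := fun t => -lam * v z t * ψ z t) (ψ := ψ α)
      (ψ₁ := fun t => -lam * v α t * ψ α t) (τ := τ)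
      (hψc z).continuousOn ((continuous_const.mul (hvc z)).mul (hψc z)).continuousOn
      (hψc α).continuousOn ((continuous_const.mul (hvc α)).mul (hψc α)).continuousOn
      hτc.continuousOn (fun t _ => hψpos z t) (fun t _ => hψpos α t) (fun t _ => dψ z t)
      (fun t ht => by
        have := dψ₁ z t ht
        rwa [hz.2.1, zero_pow two_ne_zero, zero_div, add_zero] at this)
      (fun t _ => dψ α t) (dψ₁ α) (fun t _ => dτ t) (hψ0 z)
      (by rw [hψ0, hv0, ← hz.2.2, ha]; ring) (hψ0 α)
      (by rw [hψ0, hv0, ha]; ring) (by simp [hτdef]) t ht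
    exact ermakov_superposition' (hψpos z t) (hψpos α t) (hτ0 t ht) hμ h1.1 h1.2
  -- This is the linear solution with initial data `1` and `0`; its inverse square is the derivative
  -- of `η`.
  set y : ℝ → ℝ := fun t => ψ z t * (1 + μ * τ t) with hydef
  set η : ℝ → ℝ := fun t => τ t / (1 + μ * τ t) with hηdef
  have hden : ∀ t ∈ Icc 0 T₁, 0 < 1 + μ * τ t := fun t ht => by
    have := hτ0 t ht
    positivity
  have hy : ∀ t ∈ Icc 0 T₁, 0 < y t := fun t ht => mul_pos (hψpos z t) (hden t ht)
  have hη0 : ∀ t ∈ Icc 0 T₁, 0 ≤ η t := fun t ht => div_nonneg (hτ0 t ht) (hden t ht).le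
  have hη1 : ∀ t ∈ Icc 0 T₁, η t < 1 / μ := fun t ht => by
    simp only [hηdef]
    rw [div_lt_div_iff₀ (hden t ht) hμ]
    linarith
  have hg : ∀ t ∈ Icc 0 T₁, ∀ α, Real.exp (∫ s in (0 : ℝ)..t, v α s) =
      (y t ^ 2) ^ (-(2 * lam)⁻¹) * quad a r α (η t) ^ (-(2 * lam)⁻¹) := fun t ht α => by
    rw [← Real.mul_rpow (sq_nonneg _) (quad_nonneg _ _ _ _), ← (hsup α t ht).1, hψexp,
      ← Real.exp_nat_mul, ← Real.exp_mul]
    congr 1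
    push_cast
    field_simp
  have hgc : ∀ t ∈ Icc 0 T₁, Continuous fun α => Real.exp (∫ s in (0 : ℝ)..t, v α s) :=
    fun t ht => by
      simp only [hg t ht]
      exact continuous_const.mul (h.continuous_quad_rpow (hη0 t ht) (hη1 t ht) _)
  -- The flow maps a period onto an interval of length one, so the Jacobian has integral one. This
  -- determines `y`, and with it the influence of the nonlocal term.
  have hy2 : ∀ t ∈ Icc 0 T₁, y t ^ 2 = mass lam a r (η t) ^ (2 * lam) := fun t ht => by
    have hm := h.mass_pos (lam := lam) (hη0 t ht) (hη1 t ht)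
    have h1 := intervalIntegral.integral_eq_sub_of_hasDerivAt (a := 0) (b := 1)
      (fun α _ => γα α t ht) ((hgc t ht).intervalIntegrable _ _)
    have h2 := γper 0 t ht
    rw [zero_add] at h2
    rw [h2, add_sub_cancel_left] at h1
    have h3 : (y t ^ 2) ^ (-(2 * lam)⁻¹) * mass lam a r (η t) = 1 := by
      rw [← h1]
      unfold mass
      rw [← intervalIntegral.integral_const_mul]
      congr 1
      ext α
      exact (hg t ht α).symm
    have h4 : (y t ^ 2) ^ (-(2 * lam)⁻¹) = (mass lam a r (η t))⁻¹ := eq_inv_of_mul_eq_one_left h3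
    have h5 : y t ^ 2 = ((y t ^ 2) ^ (-(2 * lam)⁻¹)) ^ (-(2 * lam)) := by
      rw [← Real.rpow_mul (sq_nonneg _)]
      have : -(2 * lam)⁻¹ * -(2 * lam) = 1 := by field_simp
      rw [this, Real.rpow_one]
    rw [h5, h4, Real.inv_rpow hm.le, Real.rpow_neg hm.le, inv_inv]
  have hηc : ContinuousOn η (Icc 0 T₁) :=
    hτc.continuousOn.div (continuous_const.add (continuous_const.mul hτc)).continuousOn
      fun t ht => (hden t ht).ne'
  -- Here `η' = 1 / y²` meets `clock' = mass ^ (2 * lam) = y²`, so the composite has derivative one.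
  have hclock : ∀ t ∈ Icc 0 T₁, clock lam a r (η t) = t := by
    refine eqOn_of_hasDerivAt_eq (f' := fun _ => 1) (fun t ht => ?_) continuousOn_id
      (fun t ht => ?_) (fun t _ => hasDerivAt_id t) (by simp [hηdef, hτdef])
    · exact (h.hasDerivAt_clock (hη0 t ht) (hη1 t ht)).continuousAt.comp_continuousWithinAt
        (hηc t ht)
    · have ht' := Ioo_subset_Icc_self ht
      have d1 : HasDerivAt η _ t := (dτ t).div (((dτ t).const_mul μ).const_add 1) (hden t ht').ne'
      refine ((h.hasDerivAt_clock (hη0 t ht') (hη1 t ht')).comp t d1).congr_deriv ?_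
      rw [← hy2 t ht']
      have := hψpos z t
      have := hden t ht'
      simp only [hydef]
      field_simp
      ring
  have hT₁' : T₁ ∈ Icc 0 T₁ := ⟨hT₁.1.le, le_rfl⟩
  have hm := h.mass_pos (lam := lam) (hη0 T₁ hT₁') (hη1 T₁ hT₁')
  have hjac : ∀ α, Real.exp (∫ s in (0 : ℝ)..T₁, v α s) = jac lam a r α (η T₁) := fun α => by
    rw [hg T₁ hT₁' α, hy2 T₁ hT₁', ← Real.rpow_mul hm.le]
    have : 2 * lam * -(2 * lam)⁻¹ = -1 := by field_simp
    rw [this, Real.rpow_neg_one, jac, div_eq_inv_mul]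
  -- Only the existence of a constant common to all labels is needed: it is identified below from
  -- the mean of `u_x` being zero.
  have hstrain : ∃ b, ∀ α, dx u (γ α T₁) T₁ = strain lam a r b α (η T₁) := by
    refine ⟨-(-lam * v z T₁ * ψ z T₁ / ψ z T₁ + μ / (ψ z T₁ ^ 2 * (1 + μ * τ T₁))) / lam *
      mass lam a r (η T₁) ^ (2 * lam), fun α => ?_⟩
    have h1 := (hsup α T₁ hT₁').2
    have h2 : v α T₁ = dx u (γ α T₁) T₁ := by simp only [hvdef, hclamp T₁ hT₁']
    rw [← h2]
    have h3 : -lam * v α T₁ * ψ α T₁ / ψ α T₁ = -lam * v α T₁ := by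
      have := (hψpos α T₁).ne'
      field_simp
    rw [h3] at h1
    have h4 : v α T₁ = (-lam * v α T₁) / -lam := by field_simp
    rw [h4, h1]
    unfold strain
    have h5 : mass lam a r (η T₁) ^ (-(2 * lam)) = (y T₁ ^ 2)⁻¹ := by
      rw [Real.rpow_neg hm.le, hy2 T₁ hT₁']
    rw [h5, ← hy2 T₁ hT₁']
    have h6 := (hy T₁ hT₁').ne'
    simp only [hydef, hηdef] at h6 ⊢
    generalize logSlope a r α (τ T₁ / (1 + μ * τ T₁)) = j
    generalize -lam * v z T₁ * ψ z T₁ / ψ z T₁ + μ / (ψ z T₁ ^ 2 * (1 + μ * τ T₁)) = B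
    generalize ψ z T₁ * (1 + μ * τ T₁) = Y at h6 ⊢
    field_simp
    ring
  obtain ⟨b, hb⟩ := hstrain
  have hcov : ∀ φ : ℝ → ℝ, Continuous φ → ∫ x in (0 : ℝ)..1, φ (dx u x T₁) =
      ∫ α in (0 : ℝ)..1, φ (strain lam a r b α (η T₁)) * jac lam a r α (η T₁) := by
    intro φ hφ
    have hT₁'' : T₁ ∈ Ico 0 T := ⟨hT₁.1.le, hT₁.2⟩
    have hdxc : Continuous fun x => dx u x T₁ :=
      hux.continuousOn.comp_continuous (f := fun x : ℝ => (x, T₁)) (by fun_prop)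
        fun x => ⟨mem_univ _, hT₁''⟩
    have hp : Function.Periodic (fun x => φ (dx u x T₁)) 1 := fun x =>
      congrArg φ (dx_periodic (hsol.periodic_u T₁ hT₁'') x)
    have h1 := intervalIntegral.integral_comp_mul_deriv (a := 0) (b := 1)
      (f := fun α => γ α T₁) (g := fun x => φ (dx u x T₁))
      (fun α _ => γα α T₁ hT₁') (hgc T₁ hT₁').continuousOn (hφ.comp hdxc)
    have h2 := γper 0 T₁ hT₁'
    rw [zero_add] at h2
    have h3 : ∫ x in (0 : ℝ)..1, φ (dx u x T₁) =
        ∫ x in γ 0 T₁..γ 1 T₁, φ (dx u x T₁) := by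
      rw [h2]
      simpa using hp.intervalIntegral_add_eq 0 (γ 0 T₁)
    rw [h3, ← h1]
    congr 1
    ext α
    simp only [Function.comp_apply, hb]
    congr 1
    exact hjac α
  have hb0 : b = strainShift lam a r (η T₁) := by
    refine eq_strainShift h (hη0 T₁ hT₁') (hη1 T₁ hT₁') ?_
    have h1 := hcov id continuous_id
    simp only [id] at h1
    rw [← h1]
    have hT₁'' : T₁ ∈ Ico 0 T := ⟨hT₁.1.le, hT₁.2⟩
    have hdxc : Continuous fun x => dx u x T₁ :=
      hux.continuousOn.comp_continuous (f := fun x : ℝ => (x, T₁)) (by fun_prop)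
        fun x => ⟨mem_univ _, hT₁''⟩
    rw [intervalIntegral.integral_eq_sub_of_hasDerivAt
      (fun x _ => hu.hasDerivAt_dx hT₁'' x) (hdxc.intervalIntegrable _ _)]
    have := hsol.periodic_u T₁ hT₁'' 0
    simp only [zero_add] at this
    rw [this, sub_self]
  rw [hb0] at hb hcov
  refine ⟨η T₁, ⟨(hη0 T₁ hT₁').lt_of_ne fun h0 => ?_, hη1 T₁ hT₁'⟩, hclock T₁ hT₁',
    fun α => ⟨γ α T₁, hb α⟩, hcov⟩
  have := hclock T₁ hT₁'
  rw [← h0, clock_zero] at this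
  exact hT₁.1.ne this

/-! ### Construction of a solution: the formulas in label coordinates. -/

/-- Smooth functions of `(α, η)` with `α` arbitrary and `η` in `U`. -/
def SmoothOver (U : Set ℝ) (f : ℝ → ℝ → ℝ) : Prop :=
  ContDiffOn ℝ ∞ (fun z : ℝ × ℝ => f z.1 z.2) (univ ×ˢ U)

namespace SmoothOver

variable {U : Set ℝ} {f : ℝ → ℝ → ℝ}

theorem swap (hf : SmoothOver U f) :
    ContDiffOn ℝ ∞ (fun z : ℝ × ℝ => f z.2 z.1) (U ×ˢ univ) :=
  ContDiffOn.comp (g := fun z : ℝ × ℝ => f z.1 z.2) (f := fun z : ℝ × ℝ => (z.2, z.1)) hf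
    (by fun_prop) fun z hz => ⟨mem_univ _, hz.1⟩

theorem continuous_left (hf : SmoothOver U f) {η : ℝ} (hη : η ∈ U) : Continuous fun α => f α η :=
  hf.continuousOn.comp_continuous (f := fun α : ℝ => (α, η)) (by fun_prop)
    fun _ => ⟨mem_univ _, hη⟩

/-- Rescaling to the fixed interval `[0, 1]` reduces a variable endpoint to smooth dependence of the
integrand. -/
theorem primitive (hU : IsOpen U) (hf : SmoothOver U f) :
    SmoothOver U fun α η => ∫ s in (0 : ℝ)..α, f s η := by
  have h1 : ContDiffOn ℝ ∞ (fun z : ℝ × ℝ => ∫ θ in (0 : ℝ)..1, f (z.1 * θ) z.2)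
      (univ ×ˢ U) := by
    refine contDiffOn_intervalIntegral (f := fun (z : ℝ × ℝ) θ => f (z.1 * θ) z.2)
      (isOpen_univ.prod hU) 0 1 ?_
    exact ContDiffOn.comp (g := fun z : ℝ × ℝ => f z.1 z.2)
      (f := fun w : (ℝ × ℝ) × ℝ => (w.1.1 * w.2, w.1.2)) hf (by fun_prop)
      fun w hw => ⟨mem_univ _, hw.1.2⟩
  refine (contDiff_fst.contDiffOn.mul h1).congr fun z _ => ?_
  have := intervalIntegral.smul_integral_comp_mul_left (a := 0) (b := 1) (fun s => f s z.2) z.1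
  simpa using this.symm

theorem hasDerivAt_integral (hU : IsOpen U) (hf : SmoothOver U f) {f' : ℝ → ℝ} {η : ℝ}
    (hη : η ∈ U) (hf' : ∀ α, HasDerivAt (fun η => f α η) (f' α) η) (a b : ℝ) :
    HasDerivAt (fun η => ∫ α in a..b, f α η) (∫ α in a..b, f' α) η := by
  have h1 := hf.swap.of_le (m := 1) (by exact_mod_cast le_top)
  have h2 := (hasFDerivAt_intervalIntegral_of_contDiffOn (f := fun η α => f α η) hU a b h1
    hη).hasDerivAt
  refine h2.congr_deriv ?_
  have hUo : IsOpen (U ×ˢ (univ : Set ℝ)) := hU.prod isOpen_univ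
  have hc : Continuous fun t : ℝ => (fderiv ℝ (fun z : ℝ × ℝ => f z.2 z.1) (η, t)).comp
        (ContinuousLinearMap.inl ℝ ℝ ℝ) :=
    ((h1.continuousOn_fderiv_of_isOpen hUo le_rfl).clm_comp
      continuousOn_const).comp_continuous (f := fun t : ℝ => (η, t)) (by fun_prop)
      fun t => ⟨hη, mem_univ _⟩
  rw [ContinuousLinearMap.intervalIntegral_apply (hc.intervalIntegrable _ _)]
  congr 1
  ext t
  have h3 : HasFDerivAt (fun z : ℝ × ℝ => f z.2 z.1) _ (η, t) :=
    ((h1.differentiableOn one_ne_zero).differentiableAt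
      (hUo.mem_nhds ⟨hη, mem_univ _⟩)).hasFDerivAt
  have h4 : HasDerivAt (fun η : ℝ => (η, t)) (1, 0) η :=
    (hasDerivAt_id η).prodMk (hasDerivAt_const η t)
  exact (HasFDerivAt.comp_hasDerivAt (f := fun η : ℝ => (η, t)) η h3 h4).unique (hf' t)

theorem of_right {m : ℝ → ℝ} (hm : ContDiffOn ℝ ∞ m U) : SmoothOver U fun _ η => m η :=
  ContDiffOn.comp (g := m) (f := fun z : ℝ × ℝ => z.2) hm (by fun_prop) fun _ hz => hz.2

theorem of_left {m : ℝ → ℝ} (hm : ContDiff ℝ ∞ m) : SmoothOver U fun α _ => m α :=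
  (hm.comp contDiff_fst).contDiffOn

end SmoothOver

/-- Minus the logarithmic derivative of `mass`. -/
noncomputable def massShift (lam : ℝ) (a r : ℝ → ℝ) (η : ℝ) : ℝ :=
  -(deriv (mass lam a r) η / mass lam a r η)

/-- The `η`-derivative of `jac`. -/
noncomputable def jacDeriv (lam : ℝ) (a r : ℝ → ℝ) (α η : ℝ) : ℝ :=
  jac lam a r α η * (logSlope a r α η / lam + massShift lam a r η)

/-- The flow in the coordinates `(α, η)`, moving the origin with constant `η`-velocity `c`. -/
noncomputable def flowMap (lam : ℝ) (a r : ℝ → ℝ) (c α η : ℝ) : ℝ :=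
  c * η + ∫ s in (0 : ℝ)..α, jac lam a r s η

/-- The `η`-derivative of `flowMap`. -/
noncomputable def flowDeriv (lam : ℝ) (a r : ℝ → ℝ) (c α η : ℝ) : ℝ :=
  c + ∫ s in (0 : ℝ)..α, jacDeriv lam a r s η

/-- The velocity in the coordinates `(α, η)`. -/
noncomputable def velocity (lam : ℝ) (a r : ℝ → ℝ) (c α η : ℝ) : ℝ :=
  flowDeriv lam a r c α η * mass lam a r η ^ (-(2 * lam))

/-- Smooth periodic `a`, `r` and an interval around `0` over which `quad` is positive. -/
structure IsChart (a r : ℝ → ℝ) (U : Set ℝ) : Prop where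
  smooth_a : ContDiff ℝ ∞ a
  smooth_r : ContDiff ℝ ∞ r
  periodic_a : Function.Periodic a 1
  periodic_r : Function.Periodic r 1
  isOpen : IsOpen U
  ordConnected : U.OrdConnected
  zero_mem : 0 ∈ U
  quad_pos : ∀ α, ∀ η ∈ U, 0 < quad a r α η

namespace IsChart

variable {a r : ℝ → ℝ} {U : Set ℝ} {lam : ℝ} (C : IsChart a r U)
include C

theorem mass_pos {η : ℝ} (hη : η ∈ U) : 0 < mass lam a r η :=
  mass_pos_of_quad_pos C.smooth_a.continuous C.smooth_r.continuous fun α => C.quad_pos α η hη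

theorem jac_pos (α : ℝ) {η : ℝ} (hη : η ∈ U) : 0 < jac lam a r α η :=
  div_pos (Real.rpow_pos_of_pos (C.quad_pos α η hη) _) (C.mass_pos hη)

theorem smooth_mass : ContDiffOn ℝ ∞ (mass lam a r) U :=
  contDiffOn_mass C.smooth_a C.smooth_r C.isOpen C.quad_pos

theorem smooth_mass_rpow (p : ℝ) : ContDiffOn ℝ ∞ (fun η => mass lam a r η ^ p) U :=
  C.smooth_mass.rpow_const_of_ne fun _ hη => (C.mass_pos hη).ne'

theorem hasDerivAt_mass {η : ℝ} (hη : η ∈ U) :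
    HasDerivAt (mass lam a r) (deriv (mass lam a r) η) η :=
  ((C.smooth_mass.differentiableOn (by simp)).differentiableAt
    (C.isOpen.mem_nhds hη)).hasDerivAt

theorem smooth_massShift : ContDiffOn ℝ ∞ (massShift lam a r) U :=
  ((((contDiffOn_infty_iff_deriv_of_isOpen C.isOpen).1 C.smooth_mass).2).div C.smooth_mass
    fun _ hη => (C.mass_pos hη).ne').neg

theorem hasDerivAt_massShift {η : ℝ} (hη : η ∈ U) :
    HasDerivAt (massShift lam a r) (deriv (massShift lam a r) η) η :=
  ((C.smooth_massShift.differentiableOn (by simp)).differentiableAt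
    (C.isOpen.mem_nhds hη)).hasDerivAt

theorem smooth_quad : SmoothOver U (quad a r) :=
  (contDiff_quad C.smooth_a C.smooth_r).contDiffOn

theorem smooth_jac : SmoothOver U (jac lam a r) :=
  (C.smooth_quad.rpow_const_of_ne fun z hz => (C.quad_pos z.1 z.2 hz.2).ne').div
    (SmoothOver.of_right C.smooth_mass) fun _ hz => (C.mass_pos hz.2).ne'

theorem smooth_logSlope : SmoothOver U (logSlope a r) := by
  have ha := C.smooth_a
  have hr := C.smooth_r
  refine ContDiffOn.div (ContDiff.contDiffOn ?_) C.smooth_quad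
    fun z hz => (C.quad_pos z.1 z.2 hz.2).ne'
  fun_prop

theorem smooth_jacDeriv : SmoothOver U (jacDeriv lam a r) :=
  C.smooth_jac.mul ((C.smooth_logSlope.div_const _).add (SmoothOver.of_right C.smooth_massShift))

theorem smooth_strain : SmoothOver U fun α η => strain lam a r (massShift lam a r η) α η :=
  (SmoothOver.of_right (C.smooth_mass_rpow _)).mul
    ((C.smooth_logSlope.div_const _).add (SmoothOver.of_right C.smooth_massShift))

theorem smooth_flowMap (c : ℝ) : SmoothOver U (flowMap lam a r c) :=
  ContDiffOn.add (contDiffOn_const.mul contDiff_snd.contDiffOn) (C.smooth_jac.primitive C.isOpen)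

theorem smooth_velocity (c : ℝ) : SmoothOver U (velocity lam a r c) :=
  ContDiffOn.mul (contDiffOn_const.add (C.smooth_jacDeriv.primitive C.isOpen))
    (SmoothOver.of_right (C.smooth_mass_rpow _))

theorem hasDerivAt_clock {η : ℝ} (hη : η ∈ U) :
    HasDerivAt (clock lam a r) (mass lam a r η ^ (2 * lam)) η :=
  GenHunterSaxton.hasDerivAt_clock C.smooth_a C.smooth_r C.isOpen C.ordConnected C.zero_mem
    C.quad_pos hη

theorem smooth_clock : ContDiffOn ℝ ∞ (clock lam a r) U := by
  rw [contDiffOn_infty_iff_deriv_of_isOpen C.isOpen]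
  refine ⟨fun η hη => (C.hasDerivAt_clock hη).differentiableAt.differentiableWithinAt, ?_⟩
  exact (C.smooth_mass_rpow (2 * lam)).congr fun η hη => (C.hasDerivAt_clock hη).deriv

theorem injOn_clock : InjOn (clock lam a r) U := by
  have hconv : Convex ℝ U := C.ordConnected.convex
  refine (strictMonoOn_of_deriv_pos hconv C.smooth_clock.continuousOn fun η hη => ?_).injOn
  have hη' := interior_subset hη
  rw [(C.hasDerivAt_clock hη').deriv]
  exact Real.rpow_pos_of_pos (C.mass_pos hη') _

theorem integral_jac {η : ℝ} (hη : η ∈ U) : ∫ α in (0 : ℝ)..1, jac lam a r α η = 1 := by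
  unfold jac
  rw [intervalIntegral.integral_div]
  exact div_self (C.mass_pos hη).ne'

theorem hasDerivAt_jac (hlam : lam ≠ 0) (α : ℝ) {η : ℝ} (hη : η ∈ U) :
    HasDerivAt (fun η => jac lam a r α η) (jacDeriv lam a r α η) η := by
  have hQ := C.quad_pos α η hη
  have hm := C.mass_pos (lam := lam) hη
  have d1 : HasDerivAt (fun η => quad a r α η) (-2 * (a α * (1 - η * a α) - η * r α ^ 2)) η := by
    unfold quad
    refine (((((hasDerivAt_id η).mul_const (a α)).const_sub 1).pow 2).add
      (((hasDerivAt_id η).mul_const (r α)).pow 2)).congr_deriv ?_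
    simp
    ring
  refine ((d1.rpow_const (p := -(2 * lam)⁻¹) (Or.inl hQ.ne')).div (C.hasDerivAt_mass hη)
    hm.ne').congr_deriv ?_
  unfold jacDeriv jac massShift logSlope
  rw [Real.rpow_sub_one hQ.ne']
  field_simp
  ring

/-- This is the derivative of the normalization that `jac` has mean one; it is what makes `velocity`
periodic. -/
theorem integral_jacDeriv (hlam : lam ≠ 0) {η : ℝ} (hη : η ∈ U) :
    ∫ α in (0 : ℝ)..1, jacDeriv lam a r α η = 0 := by
  have h1 := C.smooth_jac.hasDerivAt_integral C.isOpen hη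
    (fun α => C.hasDerivAt_jac hlam α hη) 0 1
  have h2 : HasDerivAt (fun η => ∫ α in (0 : ℝ)..1, jac lam a r α η) 0 η :=
    (hasDerivAt_const η (1 : ℝ)).congr_of_eventuallyEq <| by
      filter_upwards [C.isOpen.mem_nhds hη] with s hs
      exact C.integral_jac hs
  exact h1.unique h2

theorem hasDerivAt_flowMap_left (c α : ℝ) {η : ℝ} (hη : η ∈ U) :
    HasDerivAt (fun α => flowMap lam a r c α η) (jac lam a r α η) α :=
  (((C.smooth_jac.continuous_left hη).integral_hasStrictDerivAt 0 α).hasDerivAt).const_add _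

theorem hasDerivAt_flowMap_right (hlam : lam ≠ 0) (c α : ℝ) {η : ℝ} (hη : η ∈ U) :
    HasDerivAt (fun η => flowMap lam a r c α η) (flowDeriv lam a r c α η) η := by
  have h1 := C.smooth_jac.hasDerivAt_integral C.isOpen hη
    (fun α => C.hasDerivAt_jac hlam α hη) 0 α
  have h2 := ((hasDerivAt_id η).const_mul c).add h1
  simpa using! h2

theorem jac_periodic (η : ℝ) : Function.Periodic (fun α => jac lam a r α η) 1 := fun α => by
  have := quad_periodic C.periodic_a C.periodic_r η α
  simp only at this
  simp only [jac, this]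

theorem jacDeriv_periodic (η : ℝ) : Function.Periodic (fun α => jacDeriv lam a r α η) 1 :=
  fun α => by
  have h1 := C.jac_periodic (lam := lam) η α
  have h2 := logSlope_periodic C.periodic_a C.periodic_r η α
  simp only at h1 h2
  simp only [jacDeriv, h1, h2]

theorem flowMap_add_one (c α : ℝ) {η : ℝ} (hη : η ∈ U) :
    flowMap lam a r c (α + 1) η = flowMap lam a r c α η + 1 := by
  have hc := C.smooth_jac (lam := lam).continuous_left hη
  have h1 := (C.jac_periodic (lam := lam) η).intervalIntegral_add_eq 0 α
  rw [zero_add, C.integral_jac hη] at h1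
  unfold flowMap
  rw [← intervalIntegral.integral_add_adjacent_intervals (hc.intervalIntegrable 0 α)
    (hc.intervalIntegrable α (α + 1)), ← h1]
  ring

theorem velocity_add_one (hlam : lam ≠ 0) (c α : ℝ) {η : ℝ} (hη : η ∈ U) :
    velocity lam a r c (α + 1) η = velocity lam a r c α η := by
  have hc := C.smooth_jacDeriv (lam := lam).continuous_left hη
  have h1 := (C.jacDeriv_periodic (lam := lam) η).intervalIntegral_add_eq 0 α
  rw [zero_add, C.integral_jacDeriv hlam hη] at h1
  unfold velocity flowDeriv
  rw [← intervalIntegral.integral_add_adjacent_intervals (hc.intervalIntegrable 0 α)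
    (hc.intervalIntegrable α (α + 1)), ← h1]
  ring

/-- By the chain rule the factor `jac` belongs to the change of variables, so the other factor is
`u_x`. -/
theorem hasDerivAt_velocity_left (c α : ℝ) {η : ℝ} (hη : η ∈ U) :
    HasDerivAt (fun α => velocity lam a r c α η)
      (jac lam a r α η * strain lam a r (massShift lam a r η) α η) α := by
  have h1 := (((C.smooth_jacDeriv (lam := lam).continuous_left
    hη).integral_hasStrictDerivAt 0 α).hasDerivAt).const_add c
  refine (h1.mul_const _).congr_deriv ?_
  unfold strain jacDeriv
  ring

/-- The `η`-derivative of the strain. -/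
theorem hasDerivAt_strain (hlam : lam ≠ 0) (α : ℝ) {η : ℝ} (hη : η ∈ U) :
    HasDerivAt (fun η => strain lam a r (massShift lam a r η) α η)
      (mass lam a r η ^ (-(2 * lam)) * (lam * massShift lam a r η ^ 2 +
        deriv (massShift lam a r) η + lam * (logSlope a r α η / lam + massShift lam a r η) ^ 2 -
          r α ^ 2 / lam / quad a r α η ^ 2)) η := by
  have hQ := C.quad_pos α η hη
  have hm := C.mass_pos (lam := lam) hη
  have d1 : HasDerivAt (fun η => quad a r α η) (-2 * (a α * (1 - η * a α) - η * r α ^ 2)) η := by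
    unfold quad
    refine (((((hasDerivAt_id η).mul_const (a α)).const_sub 1).pow 2).add
      (((hasDerivAt_id η).mul_const (r α)).pow 2)).congr_deriv ?_
    simp
    ring
  have d2 : HasDerivAt (fun η => a α * (1 - η * a α) - η * r α ^ 2) (-(a α ^ 2 + r α ^ 2)) η := by
    refine (((((hasDerivAt_id η).mul_const (a α)).const_sub 1).const_mul (a α)).sub
      ((hasDerivAt_id η).mul_const (r α ^ 2))).congr_deriv ?_
    ring
  -- With `N` the numerator of `logSlope`, the identity `N² + r² = (a² + r²) quad` gives this
  -- Riccati-type equation.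
  have d3 : HasDerivAt (fun η => logSlope a r α η)
      (logSlope a r α η ^ 2 - r α ^ 2 / quad a r α η ^ 2) η := by
    refine (d2.div d1 hQ.ne').congr_deriv ?_
    unfold logSlope
    field_simp
    unfold quad
    ring
  have d4 : HasDerivAt (fun η => mass lam a r η ^ (-(2 * lam)))
      (2 * lam * massShift lam a r η * mass lam a r η ^ (-(2 * lam))) η := by
    refine ((C.hasDerivAt_mass hη).rpow_const (Or.inl hm.ne')).congr_deriv ?_
    unfold massShift
    rw [Real.rpow_sub_one hm.ne']
    field_simp
  refine (d4.mul ((d3.div_const lam).add (C.hasDerivAt_massShift hη))).congr_deriv ?_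
  simp only [Pi.add_apply]
  field_simp
  ring

theorem integral_strain_mul_jac (hlam : lam ≠ 0) {η : ℝ} (hη : η ∈ U) :
    ∫ α in (0 : ℝ)..1, strain lam a r (massShift lam a r η) α η * jac lam a r α η = 0 := by
  have e : ∀ α, strain lam a r (massShift lam a r η) α η * jac lam a r α η =
      mass lam a r η ^ (-(2 * lam)) * jacDeriv lam a r α η := fun α => by
    unfold strain jacDeriv; ring
  simp only [e]
  rw [intervalIntegral.integral_const_mul, C.integral_jacDeriv hlam hη, mul_zero]

end IsChart

/-! ### Inverting the label coordinates. -/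

/-- The space-time point with coordinates `(α, η)`. -/
noncomputable def eulerPoint (lam : ℝ) (a r : ℝ → ℝ) (c : ℝ) (z : ℝ × ℝ) : ℝ × ℝ :=
  (flowMap lam a r c z.1 z.2, clock lam a r z.2)

/-- `g` is a smooth inverse of the coordinates `eulerPoint` over `U`. -/
structure IsEulerInverse (lam : ℝ) (a r : ℝ → ℝ) (U : Set ℝ) (c : ℝ) (g : ℝ × ℝ → ℝ × ℝ) :
    Prop where
  isOpen_image : IsOpen (eulerPoint lam a r c '' (univ ×ˢ U))
  smooth : ContDiffOn ℝ ∞ g (eulerPoint lam a r c '' (univ ×ˢ U))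
  left_inv : ∀ z ∈ univ ×ˢ U, g (eulerPoint lam a r c z) = z

namespace IsChart

variable {a r : ℝ → ℝ} {U : Set ℝ} {lam : ℝ} (C : IsChart a r U)
include C

theorem smooth_eulerPoint (c : ℝ) : ContDiffOn ℝ ∞ (eulerPoint lam a r c) (univ ×ˢ U) :=
  (C.smooth_flowMap c).prodMk (SmoothOver.of_right C.smooth_clock)

theorem strictMono_flowMap (c : ℝ) {η : ℝ} (hη : η ∈ U) :
    StrictMono fun α => flowMap lam a r c α η :=
  strictMono_of_deriv_pos fun α => by
    rw [(C.hasDerivAt_flowMap_left c α hη).deriv]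
    exact C.jac_pos α hη

theorem injOn_eulerPoint (c : ℝ) : InjOn (eulerPoint lam a r c) (univ ×ˢ U) := by
  rintro ⟨α, η⟩ h1 ⟨β, θ⟩ h2 h
  obtain ⟨e1, e2⟩ := Prod.mk.inj h
  have e := C.injOn_clock h1.2 h2.2 e2
  subst e
  have := (C.strictMono_flowMap c h1.2).injective e1
  simpa using this

theorem hasDerivAt_eulerPoint_left (c α : ℝ) {η : ℝ} (hη : η ∈ U) :
    HasDerivAt (fun α => eulerPoint lam a r c (α, η)) (jac lam a r α η, 0) α :=
  (C.hasDerivAt_flowMap_left c α hη).prodMk (hasDerivAt_const α (clock lam a r η))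

theorem hasDerivAt_eulerPoint_right (hlam : lam ≠ 0) (c α : ℝ) {η : ℝ} (hη : η ∈ U) :
    HasDerivAt (fun η => eulerPoint lam a r c (α, η))
      (flowDeriv lam a r c α η, mass lam a r η ^ (2 * lam)) η :=
  (C.hasDerivAt_flowMap_right hlam c α hη).prodMk (C.hasDerivAt_clock hη)

/-- `clock` depends on `η` alone, so the differential is triangular, with the positive diagonal
entries `jac` and `mass ^ (2 * lam)`. -/
theorem exists_equiv_hasFDerivAt (hlam : lam ≠ 0) (c : ℝ) {z : ℝ × ℝ} (hz : z ∈ univ ×ˢ U) :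
    ∃ e : (ℝ × ℝ) ≃L[ℝ] ℝ × ℝ,
      HasFDerivAt (eulerPoint lam a r c) (e : (ℝ × ℝ) →L[ℝ] ℝ × ℝ) z := by
  obtain ⟨α, η⟩ := z
  have hd : HasFDerivAt (eulerPoint lam a r c) _ (α, η) :=
    (((C.smooth_eulerPoint c).differentiableOn (by simp)).differentiableAt
      ((isOpen_univ.prod C.isOpen).mem_nhds hz)).hasFDerivAt
  set Λ := fderiv ℝ (eulerPoint lam a r c) (α, η) with hΛ
  have h1 : HasDerivAt (fun s : ℝ => (s, η)) (1, 0) α :=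
    (hasDerivAt_id α).prodMk (hasDerivAt_const α η)
  have h2 : HasDerivAt (fun s : ℝ => (α, s)) (0, 1) η :=
    (hasDerivAt_const η α).prodMk (hasDerivAt_id η)
  have e1 := (HasFDerivAt.comp_hasDerivAt (f := fun s : ℝ => (s, η)) α hd h1).unique
    (C.hasDerivAt_eulerPoint_left c α hz.2)
  have e2 := (HasFDerivAt.comp_hasDerivAt (f := fun s : ℝ => (α, s)) η hd h2).unique
    (C.hasDerivAt_eulerPoint_right hlam c α hz.2)
  have hj := C.jac_pos (lam := lam) α hz.2
  have hm := Real.rpow_pos_of_pos (C.mass_pos (lam := lam) hz.2) (2 * lam)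
  have hinj : Function.Injective Λ.toLinearMap := by
    refine (injective_iff_map_eq_zero _).2 fun w hw => ?_
    obtain ⟨p, q⟩ := w
    have : (p, q) = p • ((1, 0) : ℝ × ℝ) + q • ((0, 1) : ℝ × ℝ) := by simp
    rw [this, map_add, map_smul, map_smul] at hw
    simp only [ContinuousLinearMap.coe_coe, e1, e2, Prod.smul_mk, Prod.mk_add_mk, smul_eq_mul,
      Prod.mk_eq_zero, mul_zero, zero_add] at hw
    have hq : q = 0 := by simpa [hm.ne'] using hw.2
    have hp : p = 0 := by simpa [hj.ne', hq] using hw.1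
    simp [hp, hq]
  refine ⟨(LinearEquiv.ofInjectiveEndo Λ.toLinearMap hinj).toContinuousLinearEquiv, ?_⟩
  have he : ((LinearEquiv.ofInjectiveEndo Λ.toLinearMap hinj).toContinuousLinearEquiv :
      (ℝ × ℝ) →L[ℝ] ℝ × ℝ) = Λ := by ext <;> rfl
  rw [he]
  exact hd

theorem exists_eulerInverse (hlam : lam ≠ 0) (c : ℝ) : ∃ g, IsEulerInverse lam a r U c g := by
  obtain ⟨h1, g, h2, h3⟩ := exists_contDiffOn_inverse (isOpen_univ.prod C.isOpen)
    (C.smooth_eulerPoint c) (C.injOn_eulerPoint c) fun z hz =>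
      C.exists_equiv_hasFDerivAt (lam := lam) hlam c hz
  exact ⟨g, h1, h2, h3⟩

/-- The displacement from the label is periodic and continuous, hence bounded. -/
theorem surjective_flowMap (c : ℝ) {η : ℝ} (hη : η ∈ U) :
    Function.Surjective fun α => flowMap lam a r c α η := by
  have hcont : Continuous fun α => flowMap lam a r c α η := (C.smooth_flowMap c).continuous_left hη
  have hper : Function.Periodic (fun α => flowMap lam a r c α η - α) 1 := fun α => by
    simp only [C.flowMap_add_one c α hη]; ring
  obtain ⟨B, hB⟩ := exists_bound_of_periodic (hcont.sub continuous_id) hper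
  have hB' : ∀ α, |flowMap lam a r c α η - α| ≤ B := hB.2
  refine hcont.surjective (tendsto_atTop_mono (fun α => ?_) (tendsto_atTop_add_const_right _ (-B)
    tendsto_id)) (tendsto_atBot_mono (fun α => ?_) (tendsto_atBot_add_const_right _ B tendsto_id))
  · have := (abs_le.1 (hB' α)).1; simp only [id]; linarith
  · have := (abs_le.1 (hB' α)).2; simp only [id]; linarith

end IsChart

namespace IsEulerInverse

variable {a r : ℝ → ℝ} {U : Set ℝ} {lam c : ℝ} {g : ℝ × ℝ → ℝ × ℝ}
  (G : IsEulerInverse lam a r U c g)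
include G

theorem smooth_pullback {f : ℝ → ℝ → ℝ} (hf : SmoothOver U f) :
    ContDiffOn ℝ ∞ (fun z => f (g z).1 (g z).2) (eulerPoint lam a r c '' (univ ×ˢ U)) := by
  refine ContDiffOn.comp (g := fun z : ℝ × ℝ => f z.1 z.2) hf G.smooth ?_
  rintro _ ⟨z, hz, rfl⟩
  rw [G.left_inv z hz]
  exact hz

/-- Space and time derivatives of a function given in the coordinates `(α, η)`. -/
theorem hasDerivAt_pullback (C : IsChart a r U) (hlam : lam ≠ 0) {f : ℝ → ℝ → ℝ} (hf : SmoothOver U f)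
    {α η f₁ f₂ x t : ℝ} (hη : η ∈ U) (h₁ : HasDerivAt (fun α => f α η) f₁ α)
    (h₂ : HasDerivAt (fun η => f α η) f₂ η) (hx : flowMap lam a r c α η = x)
    (ht : clock lam a r η = t) :
    HasDerivAt (fun y => f (g (y, t)).1 (g (y, t)).2) (f₁ / jac lam a r α η) x ∧
    HasDerivAt (fun s => f (g (x, s)).1 (g (x, s)).2)
      (f₂ * mass lam a r η ^ (-(2 * lam)) - velocity lam a r c α η * (f₁ / jac lam a r α η)) t := by
  subst hx ht
  have hz : (α, η) ∈ (univ : Set ℝ) ×ˢ U := ⟨mem_univ _, hη⟩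
  have hd : HasFDerivAt (fun z => f (g z).1 (g z).2) _ (eulerPoint lam a r c (α, η)) :=
    (((G.smooth_pullback hf).differentiableOn (by simp)).differentiableAt
      (G.isOpen_image.mem_nhds (mem_image_of_mem _ hz))).hasFDerivAt
  set Λ := fderiv ℝ (fun z => f (g z).1 (g z).2) (eulerPoint lam a r c (α, η))
  have e1 : Λ (jac lam a r α η, 0) = f₁ := by
    refine (hd.comp_hasDerivAt α (C.hasDerivAt_eulerPoint_left c α hη)).unique
      (h₁.congr_of_eventuallyEq (Eventually.of_forall fun β => ?_))
    simp only [Function.comp_apply]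
    rw [G.left_inv (β, η) ⟨mem_univ _, hη⟩]
  have e2 : Λ (flowDeriv lam a r c α η, mass lam a r η ^ (2 * lam)) = f₂ := by
    refine (hd.comp_hasDerivAt η (C.hasDerivAt_eulerPoint_right hlam c α hη)).unique
      (h₂.congr_of_eventuallyEq ?_)
    filter_upwards [C.isOpen.mem_nhds hη] with s hs
    simp only [Function.comp_apply]
    rw [G.left_inv (α, s) ⟨mem_univ _, hs⟩]
  have hj := C.jac_pos (lam := lam) α hη
  have hm := C.mass_pos (lam := lam) hη
  have hm' := Real.rpow_pos_of_pos hm (2 * lam)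
  -- The differential is known on the two coordinate directions; solving the triangular system gives
  -- its values on the space and time directions.
  have e3 : Λ (1, 0) = f₁ / jac lam a r α η := by
    have : ((jac lam a r α η, 0) : ℝ × ℝ) = jac lam a r α η • ((1, 0) : ℝ × ℝ) := by simp
    rw [this, map_smul, smul_eq_mul] at e1
    rw [eq_div_iff hj.ne', mul_comm, e1]
  have e4 : Λ (0, 1) =
      f₂ * mass lam a r η ^ (-(2 * lam)) - velocity lam a r c α η * (f₁ / jac lam a r α η) := by
    have : ((flowDeriv lam a r c α η, mass lam a r η ^ (2 * lam)) : ℝ × ℝ) =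
      flowDeriv lam a r c α η • ((1, 0) : ℝ × ℝ) +
        mass lam a r η ^ (2 * lam) • ((0, 1) : ℝ × ℝ) := by simp
    rw [this, map_add, map_smul, map_smul, smul_eq_mul, smul_eq_mul, e3] at e2
    unfold velocity
    rw [Real.rpow_neg hm.le]
    field_simp
    rw [← e2]
    field_simp
    ring
  constructor
  · rw [← e3]
    exact HasFDerivAt.comp_hasDerivAt (f := fun y : ℝ => (y, clock lam a r η)) _ hd
      ((hasDerivAt_id _).prodMk (hasDerivAt_const _ _))
  · rw [← e4]
    exact HasFDerivAt.comp_hasDerivAt (f := fun s : ℝ => (flowMap lam a r c α η, s)) _ hd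
      ((hasDerivAt_const _ _).prodMk (hasDerivAt_id _))

end IsEulerInverse

/-! ### The constructed functions satisfy the system. -/

/-- The `η`-derivative of the strain. -/
noncomputable def strainDeriv (lam : ℝ) (a r : ℝ → ℝ) (α η : ℝ) : ℝ :=
  mass lam a r η ^ (-(2 * lam)) * (lam * massShift lam a r η ^ 2 +
    deriv (massShift lam a r) η + lam * (logSlope a r α η / lam + massShift lam a r η) ^ 2 -
      r α ^ 2 / lam / quad a r α η ^ 2)

/-- The nonlocal term in terms of `η`. -/
noncomputable def pressure (lam : ℝ) (a r : ℝ → ℝ) (η : ℝ) : ℝ :=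
  (mass lam a r η ^ (-(2 * lam))) ^ 2 *
    (lam * massShift lam a r η ^ 2 + deriv (massShift lam a r) η)

/-- The density in the coordinates `(α, η)`. -/
noncomputable def density (lam : ℝ) (a r ρ₀ : ℝ → ℝ) (α η : ℝ) : ℝ :=
  ρ₀ α * jac lam a r α η ^ (2 * lam)

namespace IsChart

variable {a r ρ₀ : ℝ → ℝ} {U : Set ℝ} {lam kap : ℝ} (C : IsChart a r U)
include C

/-- This is the momentum equation along characteristics, the factor `mass ^ (-(2 * lam))` converting
`η`-derivatives to time derivatives. `pressure` collects the terms independent of the label. -/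
theorem strainDeriv_eq (hlam : lam ≠ 0) (hr : ∀ x, r x ^ 2 = -(lam * kap) * ρ₀ x ^ 2) (α : ℝ)
    {η : ℝ} (hη : η ∈ U) :
    strainDeriv lam a r α η * mass lam a r η ^ (-(2 * lam)) = pressure lam a r η +
      lam * strain lam a r (massShift lam a r η) α η ^ 2 + kap * density lam a r ρ₀ α η ^ 2 := by
  have hQ := C.quad_pos α η hη
  have hm := C.mass_pos (lam := lam) hη
  have e0 : -(2 * lam)⁻¹ * (2 * lam) = -1 := by field_simp
  have e1 : jac lam a r α η ^ (2 * lam) =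
      (quad a r α η)⁻¹ * mass lam a r η ^ (-(2 * lam)) := by
    unfold jac
    rw [Real.div_rpow (Real.rpow_nonneg hQ.le _) hm.le, ← Real.rpow_mul hQ.le, e0,
      Real.rpow_neg hm.le, Real.rpow_neg_one, div_eq_mul_inv]
  have e2 : kap * ρ₀ α ^ 2 = -(r α ^ 2 / lam) := by
    rw [hr]; field_simp
  have e3 : kap * density lam a r ρ₀ α η ^ 2 = -(r α ^ 2 / lam) * ((quad a r α η)⁻¹) ^ 2 *
      (mass lam a r η ^ (-(2 * lam))) ^ 2 := by
    rw [← e2]; unfold density; rw [e1]; ring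
  rw [e3]
  unfold strainDeriv pressure strain
  field_simp
  ring

theorem smooth_density (hρ : ContDiff ℝ ∞ ρ₀) : SmoothOver U (density lam a r ρ₀) :=
  ContDiffOn.mul (SmoothOver.of_left hρ)
    (C.smooth_jac.rpow_const_of_ne fun z hz => (C.jac_pos z.1 hz.2).ne')

theorem hasDerivAt_density_right (hlam : lam ≠ 0) (α : ℝ) {η : ℝ} (hη : η ∈ U) :
    HasDerivAt (fun η => density lam a r ρ₀ α η)
      (2 * lam * density lam a r ρ₀ α η * (logSlope a r α η / lam + massShift lam a r η)) η := by
  have hj := C.jac_pos (lam := lam) α hη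
  refine (((C.hasDerivAt_jac hlam α hη).rpow_const (p := 2 * lam)
    (Or.inl hj.ne')).const_mul (ρ₀ α)).congr_deriv ?_
  unfold density jacDeriv
  rw [Real.rpow_sub_one hj.ne']
  field_simp

/-- The mean of `u_x` vanishes for every `η`; differentiating this constraint and inserting the
momentum equation leaves `pressure` as the only unknown. The coefficient `1 + lam` is `lam` from the
equation plus one from the derivative of `jac`. -/
theorem pressure_eq (hlam : lam ≠ 0) (hr : ∀ x, r x ^ 2 = -(lam * kap) * ρ₀ x ^ 2)
    (hρ : ContDiff ℝ ∞ ρ₀) {η : ℝ} (hη : η ∈ U) :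
    pressure lam a r η =
      -kap * (∫ α in (0 : ℝ)..1, density lam a r ρ₀ α η ^ 2 * jac lam a r α η) -
        (1 + lam) * ∫ α in (0 : ℝ)..1,
          strain lam a r (massShift lam a r η) α η ^ 2 * jac lam a r α η := by
  have hm := C.mass_pos (lam := lam) hη
  have hcj := C.smooth_jac (lam := lam).continuous_left hη
  have hcs := C.smooth_strain (lam := lam).continuous_left hη
  have hcd := (C.smooth_density (lam := lam) hρ).continuous_left hη
  have h1 := (SmoothOver.hasDerivAt_integral
    (f := fun α η => strain lam a r (massShift lam a r η) α η * jac lam a r α η) C.isOpen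
    (ContDiffOn.mul C.smooth_strain C.smooth_jac) hη
    (fun α => (C.hasDerivAt_strain hlam α hη).mul (C.hasDerivAt_jac hlam α hη)) 0 1)
  have h2 : HasDerivAt (fun η => ∫ α in (0 : ℝ)..1,
      strain lam a r (massShift lam a r η) α η * jac lam a r α η) 0 η :=
    (hasDerivAt_const η (0 : ℝ)).congr_of_eventuallyEq <| by
      filter_upwards [C.isOpen.mem_nhds hη] with s hs
      exact C.integral_strain_mul_jac hlam hs
  have h3 := h1.unique h2
  have e : ∀ α, mass lam a r η ^ (-(2 * lam)) * (strainDeriv lam a r α η * jac lam a r α η +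
      strain lam a r (massShift lam a r η) α η * jacDeriv lam a r α η) =
      pressure lam a r η * jac lam a r α η + kap * (density lam a r ρ₀ α η ^ 2 * jac lam a r α η)
        + (1 + lam) * (strain lam a r (massShift lam a r η) α η ^ 2 * jac lam a r α η) := by
    intro α
    have e1 := C.strainDeriv_eq hlam hr α hη
    have e2 : mass lam a r η ^ (-(2 * lam)) * jacDeriv lam a r α η =
        strain lam a r (massShift lam a r η) α η * jac lam a r α η := by
      unfold jacDeriv strain; ring
    linear_combination jac lam a r α η * e1 + strain lam a r (massShift lam a r η) α η * e2
  have h4 : ∫ α in (0 : ℝ)..1, mass lam a r η ^ (-(2 * lam)) * (strainDeriv lam a r α η *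
      jac lam a r α η + strain lam a r (massShift lam a r η) α η * jacDeriv lam a r α η) = 0 := by
    rw [intervalIntegral.integral_const_mul]
    exact mul_eq_zero_of_right _ h3
  simp only [e] at h4
  rw [intervalIntegral.integral_add, intervalIntegral.integral_add,
    intervalIntegral.integral_const_mul, intervalIntegral.integral_const_mul,
    intervalIntegral.integral_const_mul, C.integral_jac hη] at h4
  · linarith
  all_goals exact Continuous.intervalIntegrable (by fun_prop) _ _

/-- Integrals of periodic functions over a period, in the coordinate `α`. -/
theorem integral_eq_integral_jac (c : ℝ) {φ : ℝ → ℝ} (hφ : Continuous φ)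
    (hper : Function.Periodic φ 1) {η : ℝ} (hη : η ∈ U) :
    ∫ x in (0 : ℝ)..1, φ x =
      ∫ α in (0 : ℝ)..1, φ (flowMap lam a r c α η) * jac lam a r α η := by
  have h1 := intervalIntegral.integral_comp_mul_deriv (a := 0) (b := 1) (g := φ)
    (fun α _ => C.hasDerivAt_flowMap_left (lam := lam) c α hη)
    (C.smooth_jac.continuous_left hη).continuousOn hφ
  have h2 := C.flowMap_add_one (lam := lam) c 0 hη
  rw [zero_add] at h2
  simp only [Function.comp_apply] at h1
  rw [h1, h2, ← hper.intervalIntegral_add_eq 0, zero_add]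

end IsChart

section initial

variable {a r u₀ : ℝ → ℝ} {lam : ℝ}

theorem mass_right_zero (lam : ℝ) (a r : ℝ → ℝ) : mass lam a r 0 = 1 := by
  simp [mass]

theorem jac_right_zero (lam : ℝ) (a r : ℝ → ℝ) (α : ℝ) : jac lam a r α 0 = 1 := by
  simp [jac, mass_right_zero]

theorem logSlope_right_zero (a r : ℝ → ℝ) (α : ℝ) : logSlope a r α 0 = a α := by
  simp [logSlope]

theorem flowMap_right_zero (lam : ℝ) (a r : ℝ → ℝ) (c α : ℝ) : flowMap lam a r c α 0 = α := by
  simp [flowMap, jac_right_zero]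

/-- The system determines `u` only up to a moving translation; the constant `u₀ 0` as velocity of
the origin selects the initial value itself rather than a shift of it. -/
theorem IsChart.velocity_right_zero {U : Set ℝ} (C : IsChart a r U) (hlam : lam ≠ 0)
    (ha : ∀ x, a x = lam * deriv u₀ x) (hu : ContDiff ℝ ∞ u₀) (hper : Function.Periodic u₀ 1)
    (α : ℝ) : velocity lam a r (u₀ 0) α 0 = u₀ α := by
  have hd : ∀ x, HasDerivAt u₀ (deriv u₀ x) x := fun x =>
    (hu.differentiable (by simp)).differentiableAt.hasDerivAt
  have hc : Continuous (deriv u₀) := hu.continuous_deriv (by simp)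
  have hint : ∀ x, ∫ s in (0 : ℝ)..x, deriv u₀ s = u₀ x - u₀ 0 := fun x =>
    intervalIntegral.integral_eq_sub_of_hasDerivAt (fun s _ => hd s) (hc.intervalIntegrable _ _)
  have hj : ∀ s, jacDeriv lam a r s 0 = deriv u₀ s + massShift lam a r 0 := fun s => by
    rw [jacDeriv, jac_right_zero, logSlope_right_zero, ha]
    field_simp
  have h1 := C.integral_jacDeriv hlam C.zero_mem
  simp only [hj] at h1
  rw [intervalIntegral.integral_add (hc.intervalIntegrable _ _)
    (continuous_const.intervalIntegrable _ _), hint] at h1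
  have h2 : u₀ 1 = u₀ 0 := by simpa using hper 0
  have h3 : massShift lam a r 0 = 0 := by simpa [h2] using h1
  simp only [h3, add_zero] at hj
  simp [velocity, flowDeriv, hj, hint, mass_right_zero]

end initial

namespace IsEulerInverse

variable {a r u₀ ρ₀ : ℝ → ℝ} {U : Set ℝ} {lam kap c : ℝ} {g : ℝ × ℝ → ℝ × ℝ}
  (G : IsEulerInverse lam a r U c g)
include G

theorem pullback_apply (f : ℝ → ℝ → ℝ) (α : ℝ) {η : ℝ} (hη : η ∈ U) :
    f (g (flowMap lam a r c α η, clock lam a r η)).1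
      (g (flowMap lam a r c α η, clock lam a r η)).2 = f α η := by
  have := G.left_inv (α, η) ⟨mem_univ _, hη⟩
  unfold eulerPoint at this
  rw [this]

theorem periodic_pullback (C : IsChart a r U) {f : ℝ → ℝ → ℝ} {η : ℝ} (hη : η ∈ U)
    (hf : ∀ α, f (α + 1) η = f α η) :
    Function.Periodic (fun x => f (g (x, clock lam a r η)).1 (g (x, clock lam a r η)).2) 1 := by
  intro x
  obtain ⟨α, rfl⟩ := C.surjective_flowMap (lam := lam) c hη x
  simp only
  rw [← C.flowMap_add_one c α hη, G.pullback_apply f _ hη, G.pullback_apply f _ hη, hf]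

theorem dx_velocity (C : IsChart a r U) (hlam : lam ≠ 0) (α : ℝ) {η : ℝ} (hη : η ∈ U) :
    dx (fun x t => velocity lam a r c (g (x, t)).1 (g (x, t)).2) (flowMap lam a r c α η)
      (clock lam a r η) = strain lam a r (massShift lam a r η) α η := by
  have hU := C.isOpen.mem_nhds hη
  have h2 : DifferentiableAt ℝ (fun η => velocity lam a r c α η) η :=
    DifferentiableAt.fun_comp' (f := fun η : ℝ => (α, η)) (g := fun z : ℝ × ℝ =>
      velocity lam a r c z.1 z.2) η (((C.smooth_velocity c).differentiableOn
        (by simp)).differentiableAt ((isOpen_univ.prod C.isOpen).mem_nhds ⟨mem_univ _, hη⟩))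
      (by fun_prop)
  have h1 := (G.hasDerivAt_pullback C hlam (C.smooth_velocity c) hη
    (C.hasDerivAt_velocity_left c α hη) h2.hasDerivAt rfl rfl).1
  refine h1.deriv.trans ?_
  have hj := C.jac_pos (lam := lam) α hη
  field_simp

theorem integral_sq_pullback (C : IsChart a r U) {f : ℝ → ℝ → ℝ} (hf : SmoothOver U f) {η : ℝ}
    (hη : η ∈ U) (hper : ∀ α, f (α + 1) η = f α η) :
    ∫ x in (0 : ℝ)..1, f (g (x, clock lam a r η)).1 (g (x, clock lam a r η)).2 ^ 2 =
      ∫ α in (0 : ℝ)..1, f α η ^ 2 * jac lam a r α η := by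
  have hc : Continuous fun x => f (g (x, clock lam a r η)).1 (g (x, clock lam a r η)).2 := by
    refine (G.smooth_pullback hf).continuousOn.comp_continuous
      (f := fun x : ℝ => (x, clock lam a r η)) (by fun_prop) fun x => ?_
    obtain ⟨α, rfl⟩ := C.surjective_flowMap (lam := lam) c hη x
    exact ⟨(α, η), ⟨mem_univ _, hη⟩, rfl⟩
  have h1 := C.integral_eq_integral_jac (lam := lam) c
    (φ := fun x => f (g (x, clock lam a r η)).1 (g (x, clock lam a r η)).2 ^ 2) (hc.pow 2)
    (fun x => congrArg (· ^ 2) (G.periodic_pullback C hη hper x)) hη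
  rw [h1]
  simp only [G.pullback_apply f _ hη]

theorem isSmoothSolution (C : IsChart a r U) (hlam : lam ≠ 0) (hc : c = u₀ 0)
    (ha : ∀ x, a x = lam * deriv u₀ x) (hr : ∀ x, r x ^ 2 = -(lam * kap) * ρ₀ x ^ 2)
    (hu : ContDiff ℝ ∞ u₀) (hρ : ContDiff ℝ ∞ ρ₀) (hu' : Function.Periodic u₀ 1)
    (hρ' : Function.Periodic ρ₀ 1) {T : ℝ} (hT : ∀ t ∈ Ico 0 T, ∃ η ∈ U, clock lam a r η = t) :
    IsSmoothSolution lam kap u₀ ρ₀ T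
      (fun x t => velocity lam a r c (g (x, t)).1 (g (x, t)).2)
      (fun x t => density lam a r ρ₀ (g (x, t)).1 (g (x, t)).2) := by
  have hsub : univ ×ˢ Ico 0 T ⊆ eulerPoint lam a r c '' (univ ×ˢ U) := by
    rintro ⟨x, t⟩ ⟨-, ht⟩
    obtain ⟨η, hη, rfl⟩ := hT t ht
    obtain ⟨α, rfl⟩ := C.surjective_flowMap (lam := lam) c hη x
    exact ⟨(α, η), ⟨mem_univ _, hη⟩, rfl⟩
  have hsd := C.smooth_density (lam := lam) hρ
  have hdens : ∀ η, ∀ α, density lam a r ρ₀ (α + 1) η = density lam a r ρ₀ α η := fun η α => by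
    have := C.jac_periodic (lam := lam) η α
    simp only at this
    simp only [density, this, hρ' α]
  have hstr : ∀ η, ∀ α, strain lam a r (massShift lam a r η) (α + 1) η =
      strain lam a r (massShift lam a r η) α η := fun η α => by
    have := logSlope_periodic C.periodic_a C.periodic_r η α
    simp only at this
    simp only [strain, this]
  have hdl : ∀ α, ∀ η ∈ U, DifferentiableAt ℝ (fun α => density lam a r ρ₀ α η) α :=
    fun α η hη => DifferentiableAt.fun_comp' (f := fun α : ℝ => (α, η)) (g := fun z : ℝ × ℝ =>
      density lam a r ρ₀ z.1 z.2) α ((hsd.differentiableOn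
        (by simp)).differentiableAt ((isOpen_univ.prod C.isOpen).mem_nhds ⟨mem_univ _, hη⟩))
      (by fun_prop)
  have hsl : ∀ α, ∀ η ∈ U,
      DifferentiableAt ℝ (fun α => strain lam a r (massShift lam a r η) α η) α :=
    fun α η hη => DifferentiableAt.fun_comp' (f := fun α : ℝ => (α, η)) (g := fun z : ℝ × ℝ =>
      strain lam a r (massShift lam a r z.2) z.1 z.2) α
        ((C.smooth_strain.differentiableOn (by simp)).differentiableAt
          ((isOpen_univ.prod C.isOpen).mem_nhds ⟨mem_univ _, hη⟩)) (by fun_prop)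
  refine ⟨(G.smooth_pullback (C.smooth_velocity c)).mono hsub, (G.smooth_pullback hsd).mono hsub,
    fun t ht => ?_, fun t ht => ?_, fun t ht x => ?_, fun t ht x => ?_, fun x => ?_, fun x => ?_⟩
  · obtain ⟨η, hη, rfl⟩ := hT t ht
    exact G.periodic_pullback C hη fun α => C.velocity_add_one hlam c α hη
  · obtain ⟨η, hη, rfl⟩ := hT t ht
    exact G.periodic_pullback C hη fun α => hdens η α
  · obtain ⟨η, hη, rfl⟩ := hT t (Ioo_subset_Ico_self ht)
    obtain ⟨α, rfl⟩ := C.surjective_flowMap (lam := lam) c hη x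
    have hW := G.isOpen_image.mem_nhds
      (mem_image_of_mem (eulerPoint lam a r c) (⟨mem_univ α, hη⟩ : (α, η) ∈ univ ×ˢ U))
    -- The formula for `u_x` must hold on a space-time neighbourhood, since it is differentiated
    -- again in both variables.
    have key : ∀ᶠ z : ℝ × ℝ in 𝓝 (flowMap lam a r c α η, clock lam a r η),
        dx (fun x t => velocity lam a r c (g (x, t)).1 (g (x, t)).2) z.1 z.2 =
          strain lam a r (massShift lam a r (g z).2) (g z).1 (g z).2 := by
      filter_upwards [hW]
      rintro _ ⟨w, hw, rfl⟩
      rw [G.left_inv w hw]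
      exact G.dx_velocity C hlam w.1 hw.2
    obtain ⟨d1, d2⟩ := G.hasDerivAt_pullback C hlam C.smooth_strain hη
      (hsl α η hη).hasDerivAt (C.hasDerivAt_strain hlam α hη) rfl rfl
    have e1 : dx (dx fun x t => velocity lam a r c (g (x, t)).1 (g (x, t)).2)
        (flowMap lam a r c α η) (clock lam a r η) = _ :=
      (d1.congr_of_eventuallyEq (Tendsto.eventually
        (f := fun y : ℝ => (y, clock lam a r η)) (Continuous.tendsto (by fun_prop) _) key)).deriv
    have e2 : dt (dx fun x t => velocity lam a r c (g (x, t)).1 (g (x, t)).2)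
        (flowMap lam a r c α η) (clock lam a r η) = _ :=
      (d2.congr_of_eventuallyEq (Tendsto.eventually
        (f := fun s : ℝ => (flowMap lam a r c α η, s))
          (Continuous.tendsto (by fun_prop) _) key)).deriv
    have e3 : nonlocalTerm lam kap (fun x t => velocity lam a r c (g (x, t)).1 (g (x, t)).2)
        (fun x t => density lam a r ρ₀ (g (x, t)).1 (g (x, t)).2) (clock lam a r η) =
          pressure lam a r η := by
      have e4 : ∀ x, dx (fun x t => velocity lam a r c (g (x, t)).1 (g (x, t)).2) x
          (clock lam a r η) = strain lam a r (massShift lam a r (g (x, clock lam a r η)).2)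
            (g (x, clock lam a r η)).1 (g (x, clock lam a r η)).2 := by
        intro x
        obtain ⟨β, rfl⟩ := C.surjective_flowMap (lam := lam) c hη x
        simp only
        rw [G.dx_velocity C hlam β hη,
          G.pullback_apply (fun α η => strain lam a r (massShift lam a r η) α η) β hη]
      rw [C.pressure_eq hlam hr hρ hη, nonlocalTerm]
      simp only [e4]
      rw [G.integral_sq_pullback C hsd hη (hdens η),
        G.integral_sq_pullback C C.smooth_strain hη (hstr η)]
    simp only
    rw [e1, e2, e3, G.dx_velocity C hlam α hη, G.pullback_apply (velocity lam a r c) α hη,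
      G.pullback_apply (density lam a r ρ₀) α hη]
    have e5 := C.strainDeriv_eq hlam hr α hη
    unfold strainDeriv at e5
    linear_combination e5
  · obtain ⟨η, hη, rfl⟩ := hT t (Ioo_subset_Ico_self ht)
    obtain ⟨α, rfl⟩ := C.surjective_flowMap (lam := lam) c hη x
    obtain ⟨d1, d2⟩ := G.hasDerivAt_pullback C hlam hsd hη
      (hdl α η hη).hasDerivAt (C.hasDerivAt_density_right hlam α hη) rfl rfl
    simp only
    rw [dt, dx, d1.deriv, d2.deriv, G.dx_velocity C hlam α hη,
      G.pullback_apply (velocity lam a r c) α hη, G.pullback_apply (density lam a r ρ₀) α hη]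
    unfold strain
    ring
  · have := G.pullback_apply (velocity lam a r c) x C.zero_mem
    rw [flowMap_right_zero, clock_zero] at this
    rw [this, hc, C.velocity_right_zero hlam ha hu hu']
  · have := G.pullback_apply (density lam a r ρ₀) x C.zero_mem
    rw [flowMap_right_zero, clock_zero] at this
    rw [this, density, jac_right_zero, Real.one_rpow, mul_one]

end IsEulerInverse

theorem IsProfile.exists_isSmoothSolution {a r u₀ ρ₀ : ℝ → ℝ} {lam kap μ : ℝ}
    (h : IsProfile a r μ) (hlam : lam < 0 ∨ 1 < lam)
    (ha : ∀ x, a x = lam * deriv u₀ x) (hr : ∀ x, r x ^ 2 = -(lam * kap) * ρ₀ x ^ 2)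
    (hu : ContDiff ℝ ∞ u₀) (hρ : ContDiff ℝ ∞ ρ₀) (hu' : Function.Periodic u₀ 1)
    (hρ' : Function.Periodic ρ₀ 1) :
    ∃ u ρ : ℝ → ℝ → ℝ, IsSmoothSolution lam kap u₀ ρ₀ (clock lam a r (1 / μ)) u ρ := by
  have hlam0 : lam ≠ 0 := by rcases hlam with h | h <;> linarith
  obtain ⟨e, he, hq⟩ := h.exists_quad_pos
  have hμ : 0 < 1 / μ := one_div_pos.2 h.pos
  -- The chart reaches below `η = 0`, so its image is a neighbourhood of the initial line.
  have C : IsChart a r (Ioo (-e) (1 / μ)) := ⟨h.smooth_a, h.smooth_r, h.periodic_a, h.periodic_r,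
    isOpen_Ioo, ordConnected_Ioo, ⟨by linarith, hμ⟩, hq⟩
  obtain ⟨g, G⟩ := C.exists_eulerInverse (lam := lam) hlam0 (u₀ 0)
  refine ⟨_, _, G.isSmoothSolution C hlam0 rfl ha hr hu hρ hu' hρ' fun t ht => ?_⟩
  obtain ⟨η, hη, rfl⟩ := intermediate_value_Icc hμ.le (h.continuousOn_clock hlam)
    (⟨by simpa using ht.1, ht.2.le⟩ : t ∈ Icc (clock lam a r 0) (clock lam a r (1 / μ)))
  refine ⟨η, ⟨by linarith [hη.1], lt_of_le_of_ne hη.2 ?_⟩, rfl⟩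
  rintro rfl
  exact lt_irrefl _ ht.2

/-! ### Lebesgue norms of continuous functions on a period. -/

section Norms

theorem memLp_restrict_Icc {f : ℝ → ℝ} (hf : Continuous f) (q : ENNReal) :
    MemLp f q (volume.restrict (Icc (0 : ℝ) 1)) := by
  obtain ⟨B, hB⟩ := isCompact_Icc.exists_bound_of_continuousOn (s := Icc (0 : ℝ) 1) hf.continuousOn
  exact MemLp.of_bound hf.aestronglyMeasurable B
    ((ae_restrict_iff' measurableSet_Icc).2 (Eventually.of_forall hB))

theorem eLpNorm_restrict_Icc {f : ℝ → ℝ} (hf : Continuous f) {p : ℝ} (hp : 0 < p) :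
    eLpNorm f (ENNReal.ofReal p) (volume.restrict (Icc (0 : ℝ) 1)) =
      ENNReal.ofReal ((∫ x in (0 : ℝ)..1, |f x| ^ p) ^ p⁻¹) := by
  rw [(memLp_restrict_Icc hf _).eLpNorm_eq_integral_rpow_norm (by simpa using hp) (by simp),
    ENNReal.toReal_ofReal hp.le, intervalIntegral.integral_of_le zero_le_one,
    integral_Icc_eq_integral_Ioc]
  simp only [Real.norm_eq_abs]

/-- An almost everywhere bound holds on a dense set and passes to limits by continuity; going
through the open interval also covers the endpoints. -/
theorem enorm_le_eLpNorm_top {f : ℝ → ℝ} (hf : Continuous f) {x : ℝ} (hx : x ∈ Icc (0 : ℝ) 1) :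
    ‖f x‖ₑ ≤ eLpNorm f ⊤ (volume.restrict (Icc (0 : ℝ) 1)) := by
  rw [eLpNorm_exponent_top]
  set M := eLpNormEssSup f (volume.restrict (Icc (0 : ℝ) 1))
  have h1 : ∀ᵐ y, y ∈ Icc (0 : ℝ) 1 → ‖f y‖ₑ ≤ M :=
    (ae_restrict_iff' measurableSet_Icc).1 (ae_le_eLpNormEssSup (f := f))
  have h2 := (Measure.dense_of_ae h1).open_subset_closure_inter (isOpen_Ioo (a := (0 : ℝ)) (b := 1))
  have hcl : IsClosed {y | ‖f y‖ₑ ≤ M} := isClosed_le hf.enorm continuous_const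
  have h3 : closure (Ioo (0 : ℝ) 1 ∩ {y | y ∈ Icc (0 : ℝ) 1 → ‖f y‖ₑ ≤ M}) ⊆
      {y | ‖f y‖ₑ ≤ M} :=
    closure_minimal (fun y hy => hy.2 (Ioo_subset_Icc_self hy.1)) hcl
  have h4 := closure_minimal (h2.trans h3) hcl
  rw [closure_Ioo zero_ne_one] at h4
  exact h4 hx

end Norms

/-! ### From moments in `η` to norms in time. -/

section Blowup

variable {a r u₀ ρ₀ : ℝ → ℝ} {lam kap μ : ℝ} {u ρ : ℝ → ℝ → ℝ}

theorem IsSmoothSolution.continuous_dx {T : ℝ} (hsol : IsSmoothSolution lam kap u₀ ρ₀ T u ρ)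
    {t : ℝ} (ht : t ∈ Ico 0 T) : Continuous fun x => dx u x t :=
  (SmoothOnStrip.dx_smooth hsol.smooth_u).continuousOn.comp_continuous
    (f := fun x : ℝ => (x, t)) (by fun_prop) fun _ => ⟨mem_univ _, ht⟩

variable (h : IsProfile a r μ) (hlam : lam < 0 ∨ 1 < lam) (ha : ∀ x, a x = lam * deriv u₀ x)
  (hr : ∀ x, r x ^ 2 = -(lam * kap) * ρ₀ x ^ 2)
  (hsol : IsSmoothSolution lam kap u₀ ρ₀ (clock lam a r (1 / μ)) u ρ)
include h hlam ha hr hsol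

theorem IsSmoothSolution.exists_uxNorm_eq {p : ℝ} (hp : 0 < p) :
    ∀ t ∈ Ioo 0 (clock lam a r (1 / μ)), ∃ η ∈ Ioo 0 (1 / μ), clock lam a r η = t ∧
      uxNorm u (ENNReal.ofReal p) t = ENNReal.ofReal (moment lam a r p η ^ p⁻¹) := by
  intro t ht
  have hlam0 : lam ≠ 0 := by rcases hlam with h | h <;> linarith
  obtain ⟨η, hη, hclock, -, hφ⟩ := hsol.representation hlam0 h ha hr ht
  refine ⟨η, hη, hclock, ?_⟩
  rw [uxNorm, eLpNorm_restrict_Icc (hsol.continuous_dx (Ioo_subset_Ico_self ht)) hp]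
  have := hφ (fun v => |v| ^ p) (continuous_abs.rpow_const fun _ => Or.inr hp.le)
  rw [this, moment]

theorem IsSmoothSolution.tendsto_uxNorm_top {p : ℝ} (hp : 0 < p)
    (hm : Tendsto (moment lam a r p) (𝓝[<] (1 / μ)) atTop) :
    Tendsto (uxNorm u (ENNReal.ofReal p)) (𝓝[<] (clock lam a r (1 / μ))) (𝓝 ⊤) :=
  h.tendsto_of_clock hlam (ENNReal.tendsto_ofReal_atTop.comp
    ((tendsto_rpow_atTop (inv_pos.2 hp)).comp hm)) (hsol.exists_uxNorm_eq h hlam ha hr hp)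

theorem IsSmoothSolution.exists_tendsto_uxNorm {p L : ℝ} (hp : 0 < p)
    (hm : Tendsto (moment lam a r p) (𝓝[<] (1 / μ)) (𝓝 L)) :
    ∃ L : ENNReal, L < ⊤ ∧
      Tendsto (uxNorm u (ENNReal.ofReal p)) (𝓝[<] (clock lam a r (1 / μ))) (𝓝 L) :=
  ⟨ENNReal.ofReal (L ^ p⁻¹), ENNReal.ofReal_lt_top,
    h.tendsto_of_clock hlam (ENNReal.tendsto_ofReal (hm.rpow_const (Or.inr (inv_nonneg.2 hp.le))))
      (hsol.exists_uxNorm_eq h hlam ha hr hp)⟩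

theorem IsSmoothSolution.tendsto_uxNorm_top_top :
    Tendsto (uxNorm u ⊤) (𝓝[<] (clock lam a r (1 / μ))) (𝓝 ⊤) := by
  have hpos := h.clock_max_pos hlam
  have hev : ∀ᶠ t in 𝓝[<] (clock lam a r (1 / μ)), t ∈ Ioo 0 (clock lam a r (1 / μ)) :=
    Ioo_mem_nhdsLT hpos
  rcases hlam with hneg | hone
  · have hrep := fun t (ht : t ∈ Ioo 0 (clock lam a r (1 / μ))) =>
      hsol.representation hneg.ne h ha hr ht
    choose! H hH hclock hval _ using hrep
    have hHt : Tendsto H (𝓝[<] (clock lam a r (1 / μ))) (𝓝[<] (1 / μ)) :=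
      h.tendsto_of_clock (Or.inl hneg) tendsto_id fun t ht => ⟨H t, hH t ht, hclock t ht, rfl⟩
    rw [ENNReal.tendsto_nhds_top_iff_nnreal]
    intro R
    filter_upwards [hHt.eventually (h.eventually_exists_le_abs_strain hneg (R + 1)), hev]
      -- For negative `lam` the strain is large at some label, which corresponds to a point of space
      -- that periodicity moves into `[0, 1]`.
      with t ht ht'
    obtain ⟨α, hα⟩ := ht (strainShift lam a r (H t))
    obtain ⟨x, hx⟩ := hval t ht' α
    have hper := dx_periodic (hsol.periodic_u t (Ioo_subset_Ico_self ht'))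
    obtain ⟨y, hy, hxy⟩ := hper.exists_mem_Ico₀ one_pos x
    rw [← hx, hxy] at hα
    refine lt_of_lt_of_le ?_ (enorm_le_eLpNorm_top (hsol.continuous_dx
      (Ioo_subset_Ico_self ht')) (Ico_subset_Icc_self hy))
    rw [Real.enorm_eq_ofReal_abs, ENNReal.lt_ofReal_iff_toReal_lt ENNReal.coe_ne_top,
      ENNReal.coe_toReal]
    linarith
  -- For `lam > 1` the blowup of the `L²` norm already forces that of the `L^∞` norm.
  · have : IsProbabilityMeasure (volume.restrict (Icc (0 : ℝ) 1)) := ⟨by simp⟩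
    refine tendsto_nhds_top_mono (hsol.tendsto_uxNorm_top h (Or.inr hone) ha hr two_pos
      (h.tendsto_moment_atTop_of_one_lt hone one_lt_two)) ?_
    filter_upwards [hev] with t ht
    exact eLpNorm_le_eLpNorm_of_exponent_le le_top
      (hsol.continuous_dx (Ioo_subset_Ico_self ht)).aestronglyMeasurable

end Blowup

/-! ### Admissible data give profiles. -/

theorem IsAdmissible.exists_isProfile {lam kap : ℝ} {u₀ ρ₀ : ℝ → ℝ} (hlk : lam * kap < 0)
    (h : IsAdmissible lam u₀ ρ₀) :
    ∃ μ, IsProfile (fun x => lam * deriv u₀ x) (fun x => √(-(lam * kap)) * ρ₀ x) μ ∧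
      extremalZeros lam u₀ ρ₀ ⊆
        peaks (fun x => lam * deriv u₀ x) (fun x => √(-(lam * kap)) * ρ₀ x) μ := by
  -- `lam * kap < 0` makes this scaling of `ρ₀` real and nonzero, so zeros are unchanged; the factor
  -- `lam` in `a` merges the minimum case `lam < 0` and the maximum case `lam > 0`.
  have hs : 0 < √(-(lam * kap)) := Real.sqrt_pos.2 (by linarith)
  obtain ⟨x, hx, hxpos⟩ := h.exists_pos
  obtain ⟨m, hm, hmax⟩ := h.finite_zeros.exists_maximalFor (fun x => lam * deriv u₀ x) _ ⟨x, hx⟩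
  have hle : ∀ y ∈ zeroSet ρ₀, lam * deriv u₀ y ≤ lam * deriv u₀ m := fun y hy => by
    rcases le_total (lam * deriv u₀ y) (lam * deriv u₀ m) with h | h
    · exact h
    · exact hmax hy h
  have hzero : ∀ y, √(-(lam * kap)) * ρ₀ y = 0 ↔ ρ₀ y = 0 := fun y => by simp [hs.ne']
  have hpeaks : peaks (fun x => lam * deriv u₀ x) (fun x => √(-(lam * kap)) * ρ₀ x)
      (lam * deriv u₀ m) = extremalZeros lam u₀ ρ₀ := by
    ext y
    constructor
    · rintro ⟨h1, h2, h3⟩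
      refine ⟨⟨h1, (hzero y).1 h2⟩, fun w hw => ?_⟩
      simp only at h3
      rw [h3]
      exact hle w hw
    · rintro ⟨⟨h1, h2⟩, h3⟩
      exact ⟨h1, (hzero y).2 h2, le_antisymm (hle y ⟨h1, h2⟩) (h3 m hm)⟩
  have hsd : ContDiff ℝ ∞ (deriv u₀) := (contDiff_infty_iff_deriv.1 h.smooth_u).2
  have hpd : Function.Periodic (deriv u₀) 1 := fun x => by
    rw [← deriv_comp_add_const]
    exact congrArg (fun f => deriv f x) (funext h.periodic_u)
  have hd1 : deriv (fun x => lam * deriv u₀ x) = fun x => lam * iteratedDeriv 2 u₀ x := by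
    ext x
    rw [deriv_const_mul_field, iteratedDeriv_succ, iteratedDeriv_one]
  have hd2 : deriv (deriv fun x => lam * deriv u₀ x) = fun x => lam * iteratedDeriv 3 u₀ x := by
    rw [hd1]
    ext x
    rw [deriv_const_mul_field, iteratedDeriv_succ (n := 2)]
  refine ⟨lam * deriv u₀ m, ?_, hpeaks.ge⟩
  refine ⟨contDiff_const.mul hsd, contDiff_const.mul h.smooth_rho, fun x => ?_, fun x => ?_,
    hxpos.trans_le (hle x hx), fun y hy hy0 => hle y ⟨hy, (hzero y).1 hy0⟩,
    ?_, ?_, fun z hz => ?_, fun z hz => ?_⟩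
  · simp only [hpd x]
  · simp only [h.periodic_rho x]
  · rw [hpeaks]
    exact h.finite_zeros.subset fun y hy => hy.1
  · rw [hpeaks]
    exact ⟨m, hm, hle⟩
  · rw [hpeaks] at hz
    rw [hd1]
    simp only [h.deriv_two z hz, mul_zero]
  · rw [hpeaks] at hz
    rw [hd2]
    exact h.deriv_three z hz

/-! ### An admissible pair with a flat extremal zero, for all signs. -/

section Example

open Real

theorem iteratedDeriv_two_sin : iteratedDeriv 2 (fun x => sin (2 * π * x)) =
    fun x => -(2 * π) ^ 2 * sin (2 * π * x) := by
  rw [iteratedDeriv_comp_const_mul contDiff_sin]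
  ext x
  simp [iteratedDeriv_succ]

theorem iteratedDeriv_three_sin : iteratedDeriv 3 (fun x => sin (2 * π * x)) =
    fun x => -(2 * π) ^ 3 * cos (2 * π * x) := by
  rw [iteratedDeriv_comp_const_mul contDiff_sin]
  ext x
  simp [iteratedDeriv_succ]

theorem deriv_sin_two_pi (x : ℝ) : deriv (fun x => sin (2 * π * x)) x =
    2 * π * cos (2 * π * x) := by
  have h1 : HasDerivAt (fun x => 2 * π * x) (2 * π) x := by
    simpa using! (hasDerivAt_id x).const_mul (2 * π)
  rw [h1.sin.deriv, mul_comm]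

theorem mem_zeroSet_sin_sq {x : ℝ} : x ∈ zeroSet (fun x => sin (2 * π * x) ^ 2) ↔
    x = 0 ∨ x = 1 / 2 ∨ x = 1 := by
  constructor
  · rintro ⟨hx, h0⟩
    obtain ⟨n, hn⟩ := sin_eq_zero_iff.1 (pow_eq_zero_iff two_ne_zero |>.1 h0)
    have hn' : (n : ℝ) = 2 * x := by
      have := pi_pos.ne'
      field_simp at hn
      linarith
    have h1 : (-1 : ℝ) < n := by linarith [hx.1]
    have h2 : (n : ℝ) < 3 := by linarith [hx.2]
    have h1' : -1 < n := by exact_mod_cast h1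
    have h2' : n < 3 := by exact_mod_cast h2
    interval_cases n
    · left; norm_num at hn'; linarith
    · right; left; norm_num at hn'; linarith
    · right; right; norm_num at hn'; linarith
  · rintro (rfl | rfl | rfl)
    · exact ⟨by norm_num, by simp⟩
    · refine ⟨by norm_num, ?_⟩
      have : 2 * π * (1 / 2) = π := by ring
      simp only [this, sin_pi, ne_eq, OfNat.ofNat_ne_zero, not_false_eq_true, zero_pow]
    · exact ⟨by norm_num, by simp⟩

/-- At the zeros `0`, `1/2`, `1` the derivative of `u₀` is `2π`, `-2π`, `2π`, so either sign of
`lam` finds a positive value. There `u₀'' = 0`, and `u₀'''` has the sign opposite to `u₀'`. Squaring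
the sine in `ρ₀` makes every zero flat. -/
theorem isAdmissible_sin {lam : ℝ} (hlam : lam ≠ 0) :
    IsAdmissible lam (fun x => sin (2 * π * x)) fun x => sin (2 * π * x) ^ 2 := by
  have hπ := pi_pos
  have hhalf : 2 * π * (1 / 2) = π := by ring
  have hsin : ∀ x ∈ zeroSet (fun x => sin (2 * π * x) ^ 2), sin (2 * π * x) = 0 :=
    fun x hx => pow_eq_zero_iff two_ne_zero |>.1 hx.2
  have hper : Function.Periodic (fun x => sin (2 * π * x)) 1 := fun x => by
    simp only [mul_add, mul_one, sin_add_two_pi]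
  have hpos : ∃ x ∈ zeroSet (fun x => sin (2 * π * x) ^ 2), 0 < lam * cos (2 * π * x) := by
    rcases lt_or_gt_of_ne hlam with h | h
    · exact ⟨1 / 2, mem_zeroSet_sin_sq.2 (by simp), by
        rw [hhalf, cos_pi]
        linarith⟩
    · exact ⟨0, mem_zeroSet_sin_sq.2 (by simp), by simp [h]⟩
  refine ⟨by fun_prop, by fun_prop, hper, fun x => by simp only [hper x], ?_, fun x hx => ?_, ?_,
    fun x hx => ?_, fun x hx => ?_⟩
  · refine (Set.toFinite {0, 1 / 2, 1}).subset fun x hx => ?_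
    simpa using mem_zeroSet_sin_sq.1 hx
  · rw [deriv_sin_two_pi]
    have h1 := sin_sq_add_cos_sq (2 * π * x)
    rw [hsin x hx] at h1
    have h2 : cos (2 * π * x) ≠ 0 := by rintro h; simp [h] at h1
    positivity
  · obtain ⟨x, hx, h⟩ := hpos
    refine ⟨x, hx, ?_⟩
    rw [deriv_sin_two_pi]
    have : 0 < 2 * π * (lam * cos (2 * π * x)) := by positivity
    linarith
  · rw [iteratedDeriv_two_sin]
    simp only [hsin x hx.1, mul_zero]
  · obtain ⟨y, hy, h⟩ := hpos
    have h1 := hx.2 y hy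
    rw [deriv_sin_two_pi, deriv_sin_two_pi] at h1
    rw [iteratedDeriv_three_sin]
    have h2 : 0 < 2 * π * (lam * cos (2 * π * x)) := by
      have : 0 < 2 * π * (lam * cos (2 * π * y)) := by positivity
      linarith
    have h3 : 0 < (2 * π) ^ 2 * (2 * π * (lam * cos (2 * π * x))) := by positivity
    simp only
    linarith

theorem hasFlatExtremalZero_sin (lam : ℝ) :
    HasFlatExtremalZero lam (fun x => sin (2 * π * x)) fun x => sin (2 * π * x) ^ 2 := by
  have hfin : (zeroSet fun x => sin (2 * π * x) ^ 2).Finite :=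
    (Set.toFinite {0, 1 / 2, 1}).subset fun x hx => by simpa using mem_zeroSet_sin_sq.1 hx
  obtain ⟨m, hm, hmax⟩ := hfin.exists_maximalFor
    (fun x => lam * deriv (fun x => sin (2 * π * x)) x) _ ⟨0, mem_zeroSet_sin_sq.2 (by simp)⟩
  refine ⟨m, ⟨hm, fun y hy => ?_⟩, ?_⟩
  · rcases le_total (lam * deriv (fun x => sin (2 * π * x)) y)
      (lam * deriv (fun x => sin (2 * π * x)) m) with h | h
    · exact h
    · exact hmax hy h
  · have h1 : DifferentiableAt ℝ (fun x => sin (2 * π * x)) m := by fun_prop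
    rw [deriv_fun_pow h1, pow_eq_zero_iff two_ne_zero |>.1 hm.2]
    simp

end Example

end GenHunterSaxton

theorem mainTheorem1 :
    (∃ u₀ ρ₀ : ℝ → ℝ, ∀ lam kap : ℝ, lam * kap < 0 →
      GenHunterSaxton.IsAdmissible lam u₀ ρ₀ ∧
        GenHunterSaxton.HasFlatExtremalZero lam u₀ ρ₀) ∧
    ∀ (lam kap : ℝ) (u₀ ρ₀ : ℝ → ℝ), lam * kap < 0 → (lam < 0 ∨ 1 < lam) →
      GenHunterSaxton.IsAdmissible lam u₀ ρ₀ →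
      ∃ tStar : ℝ, GenHunterSaxton.IsBlowupTime lam kap u₀ ρ₀ tStar ∧
        ∀ u ρ : ℝ → ℝ → ℝ, GenHunterSaxton.IsSmoothSolution lam kap u₀ ρ₀ tStar u ρ →
          (∀ p : ℝ, 1 < p →
            (1 < lam ∨ (lam ≤ -2 / p ∧ GenHunterSaxton.HasFlatExtremalZero lam u₀ ρ₀)) →
            Tendsto (GenHunterSaxton.uxNorm u (ENNReal.ofReal p)) (𝓝[<] tStar) (𝓝 ⊤)) ∧
          (∀ p : ℝ, 1 ≤ p → -2 / (2 * p - 1) < lam → lam < 0 →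
            ∃ L : ENNReal, L < ⊤ ∧
              Tendsto (GenHunterSaxton.uxNorm u (ENNReal.ofReal p)) (𝓝[<] tStar) (𝓝 L)) := by
  refine ⟨⟨_, _, fun lam kap hlk => ⟨GenHunterSaxton.isAdmissible_sin (left_ne_zero_of_mul hlk.ne),
    GenHunterSaxton.hasFlatExtremalZero_sin lam⟩⟩, fun lam kap u₀ ρ₀ hlk hlam hadm => ?_⟩
  obtain ⟨μ, h, hsub⟩ := hadm.exists_isProfile hlk
  have hr : ∀ x, (√(-(lam * kap)) * ρ₀ x) ^ 2 = -(lam * kap) * ρ₀ x ^ 2 := fun x => by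
    rw [mul_pow, Real.sq_sqrt (by linarith)]
  refine ⟨_, ⟨h.clock_max_pos hlam, h.exists_isSmoothSolution hlam (fun _ => rfl) hr hadm.smooth_u
    hadm.smooth_rho hadm.periodic_u hadm.periodic_rho, fun u ρ hsol =>
      hsol.tendsto_uxNorm_top_top h hlam (fun _ => rfl) hr⟩, fun u ρ hsol =>
      ⟨fun p hp hcase => ?_, fun p hp hlp hneg => ?_⟩⟩
  · refine hsol.tendsto_uxNorm_top h hlam (fun _ => rfl) hr (by linarith) ?_
    rcases hcase with hone | ⟨hlp, z, hz, hz'⟩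
    · exact h.tendsto_moment_atTop_of_one_lt hone hp
    · have hneg : lam < 0 := hlp.trans_lt (div_neg_of_neg_of_pos (by norm_num) (by linarith))
      refine h.tendsto_moment_atTop_of_neg hneg hp hlp ⟨z, hsub hz, ?_⟩
      rw [deriv_const_mul_field, hz', mul_zero]
  · obtain ⟨L, hL⟩ := h.exists_tendsto_moment hp hlp hneg
    exact hsol.exists_tendsto_uxNorm h hlam (fun _ => rfl) hr (by linarith) hL
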